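/- Let $G=(V+r,E)$ be a finite directed multigraph with a distinguished node $r\notin V$, nonnegative rational edge costs $c$, and a set $T\subseteq V$ of terminals, and let $f:2^V\to\mathbb Z$. For a (multi)set $I$ of arcs on $V+r$ and $A\subseteq V$ let $d_I(A)$ be the number of arcs of $I$ that enter $A$ (head in $A$, tail not in $A$). We say that $I$ covers $f$ if $d_I(A)\ge f(A)$ for all $A\subseteq V$, and that $I$ covers a family $\mathcal F\subseteq 2^V$ if $d_I(A)\ge 1$ for all $A\in\mathcal F$. Let $f^I(A)=\max\{f(A)-d_I(A),0\}$, and for a set function $g$ let $k_g=\max_{A\subseteq V}g(A)$. A core of a family is an inclusion-minimal member of it. A set $A$ is $f$-positive if $f(A)>0$. Assume that * $f$ is positively $T$-intersecting supermodular: $f(A)+f(B)\le f(A\cap B)+f(A\cup B)$ whenever $A\cap B\cap T\ne\emptyset$ and $f(A),f(B)>0$; and every $f$-positive set contains a terminal; * $G$ is quasi-bipartite: every edge of $G$ has an end that is in $T$ or belongs to no $f$-positive set; * $k_f\ge 1$, and some $J\subseteq E$ covers $f$; let $\tau_f$ be the minimum cost $c(J)$ of such a $J$. The function $f$ is accessible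 only through an oracle that, given any finite multiset $I$ of arcs on $V+r$, lists the cores of $\{A\subseteq V: f^I(A)=k_{f^I}\}$ (each call is charged the lengths of the query and of the answer). Then there is a single deterministic oracle algorithm that, for every such instance, given $V,T,E,c$ and the oracle, computes, in time polynomial in the length of the encoding of $(V,T,E,c)$, an edge set $I\subseteq E$ that covers $\mathcal F=\{A\subseteq V:f(A)=k_f\}$ and satisfies $$c(I)\le \frac{2}{k_f}\,\bigl(1+\ln\nu_f(\emptyset)\bigr)\,\tau_f ,$$ where $\nu_f(\emptyset)$ is the number of cores of $\mathcal F$. -/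

import Mathlib

/-! ## A programming language with a step count and an oracle -/

/-- The values programs work on: binary trees whose leaves are natural numbers. -/
inductive Data : Type
  | num (n : ℕ) : Data
  | pair (a b : Data) : Data
  deriving DecidableEq

/-- The size of a value: the numbers at the leaves count with their binary length. -/
def Data.size : Data → ℕ
  | .num n => Nat.size n + 1
  | .pair a b => a.size + b.size + 1

/-- Lists of values: `num 0` is the empty list, `pair a l` is the list `a :: l`. -/
def Data.ofList : List Data → Data
  | [] => .num 0
  | a :: l => .pair a (Data.ofList l)

/-- The truth values `1` and `0`. -/
def Data.ofBool (b : Bool) : Data := .num (if b then 1 else 0)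

/-- The primitive operations. -/
inductive Prim : Type
  | id | lit (n : ℕ) | fst | snd | isPair | eq | le | add | sub | mul | div

/-- A binary operation on a pair of numbers; it returns `0` on all other values. -/
def Data.onNums (op : ℕ → ℕ → ℕ) : Data → Data
  | .pair (.num a) (.num b) => .num (op a b)
  | _ => .num 0

/-- The meaning of the primitive operations. -/
def Prim.apply : Prim → Data → Data
  | .id, x => x
  | .lit n, _ => .num n
  | .fst, .pair a _ => a
  | .fst, .num _ => .num 0
  | .snd, .pair _ b => b
  | .snd, .num _ => .num 0
  | .isPair, .pair _ _ => Data.ofBool true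
  | .isPair, .num _ => Data.ofBool false
  | .eq, .pair a b => Data.ofBool (decide (a = b))
  | .eq, .num _ => .num 0
  | .le, x => x.onNums (fun a b => if a ≤ b then 1 else 0)
  | .add, x => x.onNums (fun a b => a + b)
  | .sub, x => x.onNums (fun a b => a - b)
  | .mul, x => x.onNums (fun a b => a * b)
  | .div, x => x.onNums (fun a b => a / b)

/-- Programs. A program maps an input value to an output value (or runs forever).
`comp g f` runs `f` and then `g`; `pair f g` runs both on the input and pairs the results;
`ite c f g` runs `f` if the result of `c` is not `0`, and `g` otherwise;
`loop c b` repeats `x := b x` as long as the result of `c` on `x` is not `0`;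
`oracle` passes its input to the oracle and returns the answer. -/
inductive Program : Type
  | prim (p : Prim) : Program
  | oracle : Program
  | comp (g f : Program) : Program
  | pair (f g : Program) : Program
  | ite (c f g : Program) : Program
  | loop (c b : Program) : Program

/-- `P.Runs O x y t`: with oracle `O` and input `x`, the program `P` halts with output `y` after
time `t`. A primitive operation is charged the full sizes of its input and of its output, and an
oracle call is charged the sizes of the query and of the answer (hence `t` bounds the size of every
value that occurs in the run, and a Turing machine with the same oracle simulates the run in time
polynomial in `t`). -/
inductive Program.Runs (O : Data → Data) : Program → Data → Data → ℕ → Prop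
  | prim (p : Prim) (x : Data) :
      Runs O (.prim p) x (p.apply x) (x.size + (p.apply x).size)
  | oracle (x : Data) :
      Runs O .oracle x (O x) (x.size + (O x).size)
  | comp {f g : Program} {x y z : Data} {s t : ℕ} :
      Runs O f x y s → Runs O g y z t → Runs O (.comp g f) x z (s + t + 1)
  | pair {f g : Program} {x y z : Data} {s t : ℕ} :
      Runs O f x y s → Runs O g x z t → Runs O (.pair f g) x (.pair y z) (s + t + 1)
  | ite_then {c f g : Program} {x y z : Data} {s t : ℕ} :
      Runs O c x y s → y ≠ .num 0 → Runs O f x z t → Runs O (.ite c f g) x z (s + t + 1)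
  | ite_else {c f g : Program} {x z : Data} {s t : ℕ} :
      Runs O c x (.num 0) s → Runs O g x z t → Runs O (.ite c f g) x z (s + t + 1)
  | loop_done {c b : Program} {x : Data} {s : ℕ} :
      Runs O c x (.num 0) s → Runs O (.loop c b) x x (s + 1)
  | loop_step {c b : Program} {x y x' z : Data} {s t u : ℕ} :
      Runs O c x y s → y ≠ .num 0 → Runs O b x x' t → Runs O (.loop c b) x' z u →
        Runs O (.loop c b) x z (s + t + u + 1)

/-- Programs are deterministic: output and running time are determined by oracle and input. -/
theorem Program.Runs.unique {O : Data → Data} {P : Program} {x y : Data} {t : ℕ}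
    (h : P.Runs O x y t) : ∀ {y' : Data} {t' : ℕ}, P.Runs O x y' t' → y = y' ∧ t = t' := by
  induction h with
  | prim p x => intro y' t' h'; cases h'; exact ⟨rfl, rfl⟩
  | oracle x => intro y' t' h'; cases h'; exact ⟨rfl, rfl⟩
  | comp _ _ ih1 ih2 =>
    intro y' t' h'
    cases h' with
    | comp a b =>
      obtain ⟨rfl, rfl⟩ := ih1 a
      obtain ⟨rfl, rfl⟩ := ih2 b
      exact ⟨rfl, rfl⟩
  | pair _ _ ih1 ih2 =>
    intro y' t' h'
    cases h' with
    | pair a b =>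
      obtain ⟨rfl, rfl⟩ := ih1 a
      obtain ⟨rfl, rfl⟩ := ih2 b
      exact ⟨rfl, rfl⟩
  | ite_then _ hy _ ih1 ih2 =>
    intro y' t' h'
    cases h' with
    | ite_then a _ b =>
      obtain ⟨rfl, rfl⟩ := ih1 a
      obtain ⟨rfl, rfl⟩ := ih2 b
      exact ⟨rfl, rfl⟩
    | ite_else a _ => exact absurd (ih1 a).1 hy
  | ite_else _ _ ih1 ih2 =>
    intro y' t' h'
    cases h' with
    | ite_then a hy _ => exact absurd (ih1 a).1.symm hy
    | ite_else a b =>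
      obtain ⟨_, rfl⟩ := ih1 a
      obtain ⟨rfl, rfl⟩ := ih2 b
      exact ⟨rfl, rfl⟩
  | loop_done _ ih1 =>
    intro y' t' h'
    cases h' with
    | loop_done a =>
      obtain ⟨_, rfl⟩ := ih1 a
      exact ⟨rfl, rfl⟩
    | loop_step a hy _ _ => exact absurd (ih1 a).1.symm hy
  | loop_step _ hy _ _ ih1 ih2 ih3 =>
    intro y' t' h'
    cases h' with
    | loop_done a => exact absurd (ih1 a).1 hy
    | loop_step a _ b c =>
      obtain ⟨rfl, rfl⟩ := ih1 a
      obtain ⟨rfl, rfl⟩ := ih2 b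
      obtain ⟨rfl, rfl⟩ := ih3 c
      exact ⟨rfl, rfl⟩

/-! ## Set functions, set families and cores on the ground set `V = Fin n` -/

/-- The supermodular inequality holds for `f`-positive sets that share an element of `T`. -/
def PositivelyTIntersectingSupermodular {n : ℕ} (T : Finset (Fin n))
    (f : Finset (Fin n) → ℤ) : Prop :=
  ∀ A B : Finset (Fin n), (A ∩ B ∩ T).Nonempty → 0 < f A → 0 < f B →
    f A + f B ≤ f (A ∩ B) + f (A ∪ B)

/-- `k_f`, the maximum value of `f`. -/
def maxVal {n : ℕ} (f : Finset (Fin n) → ℤ) : ℤ :=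
  (Finset.univ : Finset (Finset (Fin n))).sup' Finset.univ_nonempty f

/-- The family of all sets `A` with `f A = k_f`. -/
def maxFamily {n : ℕ} (f : Finset (Fin n) → ℤ) : Finset (Finset (Fin n)) :=
  Finset.univ.filter (fun A => f A = maxVal f)

/-- The cores of a family: its inclusion-minimal members. -/
def cores {n : ℕ} (F : Finset (Finset (Fin n))) : Finset (Finset (Fin n)) :=
  F.filter (fun A => ∀ B ∈ F, B ⊆ A → B = A)

/-! ## Arcs on `V + r` -/

/-- An arc `(tail, head)` on the node set `V + r`; a node `v` of `V` is `some v`, and `r` is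
`none`. -/
abbrev Arc (n : ℕ) : Type := Option (Fin n) × Option (Fin n)

/-- The arc enters (covers) `A`: its head lies in `A` and its tail does not. -/
def Arc.Enters {n : ℕ} (a : Arc n) (A : Finset (Fin n)) : Prop :=
  (∃ v ∈ A, a.2 = some v) ∧ ¬ ∃ u ∈ A, a.1 = some u

instance {n : ℕ} (a : Arc n) (A : Finset (Fin n)) : Decidable (a.Enters A) :=
  inferInstanceAs (Decidable ((∃ v ∈ A, a.2 = some v) ∧ ¬ ∃ u ∈ A, a.1 = some u))

/-- The residual function `A ↦ max (f A - d_L A) 0` for a finite multiset of arcs on `V + r`,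
given as a list `L`. -/
def residualFun {n : ℕ} (f : Finset (Fin n) → ℤ) (L : List (Arc n)) :
    Finset (Fin n) → ℤ :=
  fun A => max (f A - (L.countP (fun a => decide (a.Enters A)) : ℤ)) 0

/-! ## Instances: a digraph with root `r`, edge costs and terminals -/

/-- A directed multigraph with node set `V + r`, `V = Fin n`, with edges `0, …, m - 1`, nonnegative
rational edge costs, and a set `T ⊆ V` of terminals. -/
structure CoverInstance where
  n : ℕ
  m : ℕ
  T : Finset (Fin n)
  arc : Fin m → Arc n
  c : Fin m → ℚ≥0

namespace CoverInstance

/-- `d_I A`, the number of edges in `I` that enter `A`. -/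
def inDeg (G : CoverInstance) (I : Finset (Fin G.m)) (A : Finset (Fin G.n)) : ℕ :=
  (I.filter (fun e => (G.arc e).Enters A)).card

/-- The cost `c(I)`. -/
def cost (G : CoverInstance) (I : Finset (Fin G.m)) : ℚ≥0 := ∑ e ∈ I, G.c e

/-- `J` covers the set function `f`. -/
def CoversFun (G : CoverInstance) (J : Finset (Fin G.m)) (f : Finset (Fin G.n) → ℤ) : Prop :=
  ∀ A, f A ≤ (G.inDeg J A : ℤ)

/-- `I` covers the set family `F`. -/
def CoversFamily (G : CoverInstance) (I : Finset (Fin G.m)) (F : Finset (Finset (Fin G.n))) :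
    Prop :=
  ∀ A ∈ F, 1 ≤ G.inDeg I A

/-- `τ` is the optimal value `τ_f`: the minimum cost of an edge set covering `f`. In particular
such an edge set exists. -/
def IsOptValue (G : CoverInstance) (f : Finset (Fin G.n) → ℤ) (τ : ℚ≥0) : Prop :=
  IsLeast {x : ℚ≥0 | ∃ J : Finset (Fin G.m), G.CoversFun J f ∧ G.cost J = x} τ

/-- The residual family: the members of `F` that are not covered by `I`. -/
def residualFamily (G : CoverInstance) (F : Finset (Finset (Fin G.n))) (I : Finset (Fin G.m)) :
    Finset (Finset (Fin G.n)) :=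
  F.filter (fun A => G.inDeg I A = 0)

/-- `ν_f(I)`: the number of cores of the residual family of `{A : f A = k_f}` with respect
to `I`. -/
def nu (G : CoverInstance) (f : Finset (Fin G.n) → ℤ) (I : Finset (Fin G.m)) : ℕ :=
  (cores (G.residualFamily (maxFamily f) I)).card

/-- The node `x` of `V + r` is a terminal or belongs to no `f`-positive set. -/
def GoodEnd (G : CoverInstance) (f : Finset (Fin G.n) → ℤ) (x : Option (Fin G.n)) : Prop :=
  (∃ t ∈ G.T, x = some t) ∨ ∀ A : Finset (Fin G.n), 0 < f A → ∀ v ∈ A, x ≠ some v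

/-- Every edge has an end that is a terminal or belongs to no `f`-positive set. -/
def QuasiBipartite (G : CoverInstance) (f : Finset (Fin G.n) → ℤ) : Prop :=
  ∀ e : Fin G.m, G.GoodEnd f (G.arc e).1 ∨ G.GoodEnd f (G.arc e).2

end CoverInstance

/-! ## Encodings -/

/-- A subset of `Fin n` as the list of the `n` bits of its characteristic vector. -/
def encodeSet {n : ℕ} (A : Finset (Fin n)) : Data :=
  Data.ofList ((List.finRange n).map (fun v => Data.ofBool (decide (v ∈ A))))

/-- The node `r` is the number `0`, the node `v` of `V` is the number `v + 1`. -/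
def encodeNode {n : ℕ} : Option (Fin n) → Data
  | none => .num 0
  | some v => .num (v.val + 1)

def encodeArc {n : ℕ} (a : Arc n) : Data := .pair (encodeNode a.1) (encodeNode a.2)

/-- The input of the algorithm: the list of the bits of `T` (of length `n`) and the list of the
edges, each with its cost as a fraction in lowest terms. -/
def CoverInstance.encode (G : CoverInstance) : Data :=
  .pair (encodeSet G.T)
    (Data.ofList ((List.finRange G.m).map (fun e =>
      .pair (encodeArc (G.arc e)) (.pair (.num (G.c e).num) (.num (G.c e).den)))))

/-- `O` finds cores for `f`: given any finite list `L` of arcs on `V + r` (parallel arcs allowed),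
with residual function `g`, it returns a list, in some order and without repetition, of the cores
of `{A : g A = k_g}`. -/
def IsCoreOracle {n : ℕ} (f : Finset (Fin n) → ℤ) (O : Data → Data) : Prop :=
  ∀ L : List (Arc n), ∃ l : List (Finset (Fin n)), l.Nodup ∧
    (∀ C, C ∈ l ↔ C ∈ cores (maxFamily (residualFun f L))) ∧
    O (Data.ofList (L.map encodeArc)) = Data.ofList (l.map encodeSet)

/-!
The algorithm is greedy. Let `k = k_f`. For an edge list `I`, the sets of value `k` that `I` does not
cover form a family that is closed under intersection and union of members sharing a terminal
(`OracleInstance.intersectingFamily`), so the terminal parts of its cores are disjoint, and a core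
is represented by one of its terminals `t`. The members that contain the core of `t` and no other
core form a ring family; its largest member is called the hull of the core. A star consists of an
edge `(u, v)` and, for some cores whose hulls the edge enters, shortest paths from `v` to the core
inside the hull. In each round the star with the smallest ratio of its cost to the number of cores
it removes is added to `I`.

The number of cores drops by at least the number `s` of cores of the star, unless some uncovered
set contains `u` and no core outside the star (`exists_rep_of_not_entered`,
`card_reps_add_card_le`). The best ratio is at most `2 c(J) / (k ν)` for every cover `J` of `f`,
where `ν` is the current number of cores (`mul_card_reps_le_cost`): the sets of nodes within a given
distance from a core belong to the family, so `J` enters each of them `k` times; on the other hand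
an edge `e` enters at most `c(e)` of them as an edge inside a hull, and at most `c(e)` in its role as
the edge of a star, or `2 c(e)` when its star has to be split in two, which happens only if `e` lies
inside no hull. Quasi-bipartiteness ensures that an edge lies inside at most one hull or is attached
to at most one core. Summing `δ / ν` over the rounds, where `δ` is the number of cores removed,
gives a harmonic number and hence the factor `1 + ln ν` (`OracleInstance.greedy_invariant`).

The oracle answers constrained questions, since adding many parallel copies of an arc `(x, y)` to a
query excludes the sets that contain `y` but not `x`. In this way it yields `k` and the least
uncovered set that contains two given nodes, one of them a terminal, and avoids given nodes
(`OracleInstance.leastSet_spec`). Cores, hulls and paths are computed from such sets.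

The running time is bounded by composition: `PolyTime` is the class of functions of a context that
are computed by oracle programs in polynomial time, and it is closed under the operations on
numbers and lists from which the algorithm is built.
-/

/-! ### Running times of programs -/

/-- With oracle `O` and input `x`, the program `P` halts with output `y` within time `B`. -/
def Program.RunsIn (O : Data → Data) (P : Program) (x y : Data) (B : ℕ) : Prop :=
  ∃ t ≤ B, P.Runs O x y t

namespace Program

variable {O : Data → Data}

theorem RunsIn.mono {P : Program} {x y : Data} {B B' : ℕ} (h : P.RunsIn O x y B) (hB : B ≤ B') :
    P.RunsIn O x y B' :=
  let ⟨t, ht, hr⟩ := h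
  ⟨t, ht.trans hB, hr⟩

theorem RunsIn.prim (p : Prim) (x : Data) :
    (Program.prim p).RunsIn O x (p.apply x) (x.size + (p.apply x).size) :=
  ⟨_, le_rfl, .prim p x⟩

theorem RunsIn.comp {f g : Program} {x y z : Data} {s t : ℕ} (hf : f.RunsIn O x y s)
    (hg : g.RunsIn O y z t) : (Program.comp g f).RunsIn O x z (s + t + 1) := by
  obtain ⟨a, ha, hra⟩ := hf
  obtain ⟨b, hb, hrb⟩ := hg
  exact ⟨_, by omega, .comp hra hrb⟩

theorem RunsIn.pair {f g : Program} {x y z : Data} {s t : ℕ} (hf : f.RunsIn O x y s)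
    (hg : g.RunsIn O x z t) : (Program.pair f g).RunsIn O x (.pair y z) (s + t + 1) := by
  obtain ⟨a, ha, hra⟩ := hf
  obtain ⟨b, hb, hrb⟩ := hg
  exact ⟨_, by omega, .pair hra hrb⟩

theorem RunsIn.ite_then {c f g : Program} {x y z : Data} {s t : ℕ} (hc : c.RunsIn O x y s)
    (hy : y ≠ .num 0) (hf : f.RunsIn O x z t) : (Program.ite c f g).RunsIn O x z (s + t + 1) := by
  obtain ⟨a, ha, hra⟩ := hc
  obtain ⟨b, hb, hrb⟩ := hf
  exact ⟨_, by omega, .ite_then hra hy hrb⟩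

theorem RunsIn.ite_else {c f g : Program} {x z : Data} {s t : ℕ} (hc : c.RunsIn O x (.num 0) s)
    (hg : g.RunsIn O x z t) : (Program.ite c f g).RunsIn O x z (s + t + 1) := by
  obtain ⟨a, ha, hra⟩ := hc
  obtain ⟨b, hb, hrb⟩ := hg
  exact ⟨_, by omega, .ite_else hra hrb⟩

theorem Runs.size_le {P : Program} {x y : Data} {t : ℕ} (h : P.Runs O x y t) :
    x.size ≤ t ∧ y.size ≤ t := by
  induction h with
  | prim p x => omega
  | oracle x => omega
  | comp _ _ h1 h2 => omega
  | pair _ _ h1 h2 => simp only [Data.size]; omega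
  | ite_then _ _ _ h1 h2 => omega
  | ite_else _ _ h1 h2 => omega
  | loop_done _ h1 => omega
  | loop_step _ _ _ _ h1 h2 h3 => omega

theorem RunsIn.size_le {P : Program} {x y : Data} {B : ℕ} (h : P.RunsIn O x y B) :
    x.size ≤ B ∧ y.size ≤ B := by
  obtain ⟨t, ht, hr⟩ := h
  have := hr.size_le
  omega

end Program

theorem Polynomial.eval_nat_mono (p : Polynomial ℕ) {a b : ℕ} (h : a ≤ b) : p.eval a ≤ p.eval b := by
  rw [Polynomial.eval_eq_sum_range, Polynomial.eval_eq_sum_range]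
  gcongr

/-! ### Encoded types and functions computable in polynomial time -/

/-- A type whose elements are represented as values of the programming language. -/
class Enc (α : Type) where
  enc : α → Data

open Enc (enc)

instance : Enc ℕ := ⟨Data.num⟩
instance : Enc Bool := ⟨Data.ofBool⟩
instance {α β : Type} [Enc α] [Enc β] : Enc (α × β) := ⟨fun x => .pair (enc x.1) (enc x.2)⟩
instance {α : Type} [Enc α] : Enc (List α) := ⟨fun l => Data.ofList (l.map enc)⟩

section
variable {α β : Type} [Enc α] [Enc β]
theorem enc_nat (n : ℕ) : enc n = Data.num n := rfl
theorem enc_bool (b : Bool) : enc b = Data.num (if b then 1 else 0) := rfl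
theorem enc_prod (x : α × β) : enc x = Data.pair (enc x.1) (enc x.2) := rfl
theorem enc_nil : enc ([] : List α) = Data.num 0 := rfl
theorem enc_cons (a : α) (l : List α) : enc (a :: l) = Data.pair (enc a) (enc l) := rfl
theorem size_nil : (enc ([] : List α)).size = 1 := rfl
theorem size_cons (a : α) (l : List α) :
    (enc (a :: l)).size = (enc a).size + (enc l).size + 1 := rfl
theorem size_prod (x : α × β) : (enc x).size = (enc x.1).size + (enc x.2).size + 1 := rfl
theorem size_nat (n : ℕ) : (enc n).size = Nat.size n + 1 := rfl
theorem size_bool_le (b : Bool) : (enc b).size ≤ 2 := by cases b <;> simp [enc_bool, Data.size]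

theorem length_le_size (l : List α) : l.length ≤ (enc l).size := by
  induction l with
  | nil => simp
  | cons a l ih => rw [size_cons, List.length_cons]; omega

theorem size_mem_le {l : List α} {a : α} (h : a ∈ l) : (enc a).size ≤ (enc l).size := by
  induction l with
  | nil => simp at h
  | cons b l ih =>
    rw [size_cons]
    rcases List.mem_cons.1 h with rfl | h
    · omega
    · have := ih h; omega

theorem size_append (l l' : List α) : (enc (l ++ l')).size + 1 = (enc l).size + (enc l').size := by
  induction l with
  | nil => rw [size_nil, List.nil_append]; omega
  | cons a l ih => rw [List.cons_append, size_cons, size_cons]; omega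

theorem size_reverse (l : List α) : (enc l.reverse).size = (enc l).size := by
  induction l with
  | nil => rfl
  | cons a l ih =>
    rw [List.reverse_cons, size_cons]
    have := size_append l.reverse [a]
    rw [size_cons, size_nil] at this
    omega

theorem size_sublist {l l' : List α} (h : l.Sublist l') : (enc l).size ≤ (enc l').size := by
  induction h with
  | slnil => rfl
  | cons a _ ih => rw [size_cons]; omega
  | cons_cons a _ ih => rw [size_cons, size_cons]; omega

theorem size_list_le {l : List α} {B : ℕ} (h : ∀ a ∈ l, (enc a).size ≤ B) :
    (enc l).size ≤ l.length * (B + 1) + 1 := by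
  induction l with
  | nil => rw [size_nil]; omega
  | cons a l ih =>
    rw [size_cons, List.length_cons, Nat.succ_mul]
    have h1 := ih (fun b hb => h b (List.mem_cons_of_mem _ hb))
    have h2 := h a List.mem_cons_self
    omega
end

/-- An instance of the covering problem together with an oracle for it. -/
structure OracleInstance where
  G : CoverInstance
  f : Finset (Fin G.n) → ℤ
  O : Data → Data
  supermodular : PositivelyTIntersectingSupermodular G.T f
  terminal : ∀ A, 0 < f A → (A ∩ G.T).Nonempty
  quasiBipartite : G.QuasiBipartite f
  one_le_maxVal : 1 ≤ maxVal f
  coverable : ∃ J : Finset (Fin G.m), G.CoversFun J f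
  coreOracle : IsCoreOracle f O

/-- A type of contexts: the values of the variables that are in scope while a program runs, with
the problem instance among them. A context is represented as a value of the programming language,
from which the encoding of the instance can be read off in polynomial time. -/
class Ctx (X : Type) where
  inst : X → OracleInstance
  code : X → Data
  read : ∃ (P : Program) (p : Polynomial ℕ), ∀ x,
    P.RunsIn (inst x).O (code x) (inst x).G.encode (p.eval (code x).size)

open Ctx (code)

instance : Ctx OracleInstance where
  inst := id
  code E := E.G.encode
  read := ⟨.prim .id, 2 * Polynomial.X, fun x => (Program.RunsIn.prim .id _).mono (by
    simp [Prim.apply]; omega)⟩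

instance {X β : Type} [Ctx X] [Enc β] : Ctx (X × β) where
  inst x := Ctx.inst x.1
  code x := .pair (code x.1) (enc x.2)
  read := by
    obtain ⟨P, p, h⟩ := Ctx.read (X := X)
    refine ⟨.comp P (.prim .fst), 2 * Polynomial.X + p + 1, fun x => ?_⟩
    refine ((Program.RunsIn.prim .fst _).comp (h x.1)).mono ?_
    simp only [Prim.apply, Data.size, Polynomial.eval_add, Polynomial.eval_mul, Polynomial.eval_X,
      Polynomial.eval_one, Polynomial.eval_ofNat]
    have := p.eval_nat_mono (a := (code x.1).size) (b := (code x.1).size + (enc x.2).size + 1)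
      (by omega)
    omega

section
variable {X Y α β γ δ σ : Type} [Ctx X] [Ctx Y] [Enc α] [Enc β] [Enc γ] [Enc δ] [Enc σ]

theorem code_prod (x : X × β) : code x = Data.pair (code x.1) (enc x.2) := rfl
theorem size_code_prod (x : X × β) : (code x).size = (code x.1).size + (enc x.2).size + 1 := rfl

/-- The function `F` of the context is computed by an oracle program in time polynomial in the size
of the context. -/
def PolyTime (F : X → β) : Prop :=
  ∃ (P : Program) (p : Polynomial ℕ), ∀ x,
    P.RunsIn (Ctx.inst x).O (code x) (enc (F x)) (p.eval (code x).size)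

/-- The map `s` between contexts keeps the instance and is computed in polynomial time. -/
def PolyMap (s : X → Y) : Prop :=
  (∀ x, Ctx.inst (s x) = Ctx.inst x) ∧ ∃ (P : Program) (p : Polynomial ℕ), ∀ x,
    P.RunsIn (Ctx.inst x).O (code x) (code (s x)) (p.eval (code x).size)

theorem PolyTime.size_le {F : X → β} (h : PolyTime F) :
    ∃ p : Polynomial ℕ, ∀ x, (enc (F x)).size ≤ p.eval (code x).size := by
  obtain ⟨P, p, h⟩ := h
  exact ⟨p, fun x => (h x).size_le.2⟩

theorem PolyMap.inst : PolyMap (Ctx.inst : X → OracleInstance) :=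
  ⟨fun _ => rfl, Ctx.read⟩

theorem PolyMap.fst : PolyMap (Prod.fst : X × β → X) :=
  ⟨fun _ => rfl, .prim .fst, 2 * Polynomial.X, fun x => (Program.RunsIn.prim .fst _).mono (by
    simp [Prim.apply, code_prod, Data.size]; omega)⟩

theorem PolyMap.pair {s : X → Y} {F : X → β} (hs : PolyMap s) (hF : PolyTime F) :
    PolyMap (fun x => (s x, F x)) := by
  obtain ⟨h0, P, p, hP⟩ := hs
  obtain ⟨Q, q, hQ⟩ := hF
  exact ⟨h0, .pair P Q, p + q + 1, fun x => ((hP x).pair (hQ x)).mono (by simp)⟩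

theorem PolyTime.subst {F : Y → β} {s : X → Y} (hF : PolyTime F) (hs : PolyMap s) :
    PolyTime (fun x => F (s x)) := by
  obtain ⟨h0, P, p, hP⟩ := hs
  obtain ⟨Q, q, hQ⟩ := hF
  refine ⟨.comp Q P, p + q.comp p + 1, fun x => ?_⟩
  have h1 := hQ (s x)
  rw [h0] at h1
  refine ((hP x).comp h1).mono ?_
  have := q.eval_nat_mono (hP x).size_le.2
  simp only [Polynomial.eval_add, Polynomial.eval_comp, Polynomial.eval_one]
  omega

theorem PolyMap.comp {Z : Type} [Ctx Z] {s : X → Y} {r : Y → Z} (hr : PolyMap r) (hs : PolyMap s) :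
    PolyMap (fun x => r (s x)) := by
  obtain ⟨h0, P, p, hP⟩ := hs
  obtain ⟨h0', Q, q, hQ⟩ := hr
  refine ⟨fun x => (h0' _).trans (h0 _), .comp Q P, p + q.comp p + 1, fun x => ?_⟩
  have h1 := hQ (s x)
  rw [h0] at h1
  refine ((hP x).comp h1).mono ?_
  have := q.eval_nat_mono (hP x).size_le.2
  simp only [Polynomial.eval_add, Polynomial.eval_comp, Polynomial.eval_one]
  omega

/-- A primitive operation, followed by a polynomial-time computation, is a polynomial-time
computation. -/
theorem PolyTime.prim {F : X → β} {G : X → γ} (hF : PolyTime F) (p : Prim) (q : Polynomial ℕ)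
    (hG : ∀ x, p.apply (enc (F x)) = enc (G x))
    (hq : ∀ x, (enc (G x)).size ≤ q.eval (enc (F x)).size) : PolyTime G := by
  obtain ⟨P, r, hP⟩ := hF
  refine ⟨.comp (.prim p) P, r + (r + q.comp r) + 1, fun x => ?_⟩
  have h1 := Program.RunsIn.prim (O := (Ctx.inst x).O) p (enc (F x))
  have h2 := (hP x).size_le.2
  have h3 := q.eval_nat_mono h2
  rw [hG] at h1
  refine ((hP x).comp h1).mono ?_
  have := hq x
  simp only [Polynomial.eval_add, Polynomial.eval_comp, Polynomial.eval_one]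
  omega

theorem PolyTime.var : PolyTime (fun x : X × β => x.2) :=
  ⟨.prim .snd, 2 * Polynomial.X, fun x => (Program.RunsIn.prim .snd _).mono (by
    simp [Prim.apply, code_prod, Data.size]; omega)⟩

theorem PolyTime.weaken {F : X → γ} (h : PolyTime F) : PolyTime (fun x : X × β => F x.1) :=
  h.subst PolyMap.fst

theorem PolyTime.pair {F : X → β} {G : X → γ} (hF : PolyTime F) (hG : PolyTime G) :
    PolyTime (fun x => (F x, G x)) := by
  obtain ⟨P, p, hP⟩ := hF
  obtain ⟨Q, q, hQ⟩ := hG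
  exact ⟨.pair P Q, p + q + 1, fun x => ((hP x).pair (hQ x)).mono (by simp)⟩

theorem PolyTime.fst {F : X → β × γ} (h : PolyTime F) : PolyTime (fun x => (F x).1) :=
  h.prim .fst Polynomial.X (fun _ => rfl) (fun x => by
    rw [Polynomial.eval_X, size_prod]; omega)

theorem PolyTime.snd {F : X → β × γ} (h : PolyTime F) : PolyTime (fun x => (F x).2) :=
  h.prim .snd Polynomial.X (fun _ => rfl) (fun x => by
    rw [Polynomial.eval_X, size_prod]; omega)

theorem PolyTime.const (n : ℕ) : PolyTime (fun _ : X => n) :=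
  ⟨.prim (.lit n), Polynomial.X + Polynomial.C (Nat.size n + 1), fun x =>
    (Program.RunsIn.prim (.lit n) _).mono (by
      simp only [Prim.apply, Data.size, Polynomial.eval_add, Polynomial.eval_X,
        Polynomial.eval_C]; omega)⟩

theorem PolyTime.nil : PolyTime (fun _ : X => ([] : List β)) := PolyTime.const (X := X) 0

theorem PolyTime.constTrue : PolyTime (fun _ : X => true) := PolyTime.const (X := X) 1

theorem PolyTime.constFalse : PolyTime (fun _ : X => false) := PolyTime.const (X := X) 0

theorem PolyTime.cons {F : X → β} {l : X → List β} (hF : PolyTime F) (hl : PolyTime l) :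
    PolyTime (fun x => F x :: l x) := PolyTime.pair hF hl

theorem Nat.size_add_le' (a b : ℕ) : Nat.size (a + b) ≤ Nat.size a + Nat.size b := by
  rcases Nat.eq_zero_or_pos a with rfl | ha
  · simp
  rcases Nat.eq_zero_or_pos b with rfl | hb
  · simp
  have h1 := Nat.size_pos.2 ha
  have h2 := Nat.size_pos.2 hb
  rw [Nat.size_le]
  have e1 := Nat.lt_size_self a
  have e2 := Nat.lt_size_self b
  have h3 : 2 ^ (Nat.size a + Nat.size b) = 2 ^ Nat.size a * 2 ^ Nat.size b := pow_add _ _ _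
  nlinarith

theorem Nat.size_mul_le' (a b : ℕ) : Nat.size (a * b) ≤ Nat.size a + Nat.size b := by
  rw [Nat.size_le, pow_add]
  exact Nat.mul_lt_mul'' (Nat.lt_size_self a) (Nat.lt_size_self b)

theorem PolyTime.add {F G : X → ℕ} (hF : PolyTime F) (hG : PolyTime G) : PolyTime (fun x => F x + G x) :=
  (hF.pair hG).prim .add Polynomial.X (fun _ => rfl) (fun x => by
    have := Nat.size_add_le' (F x) (G x)
    simp only [Polynomial.eval_X, size_prod, size_nat]; omega)

theorem PolyTime.mul {F G : X → ℕ} (hF : PolyTime F) (hG : PolyTime G) : PolyTime (fun x => F x * G x) :=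
  (hF.pair hG).prim .mul Polynomial.X (fun _ => rfl) (fun x => by
    have := Nat.size_mul_le' (F x) (G x)
    simp only [Polynomial.eval_X, size_prod, size_nat]; omega)

theorem PolyTime.sub {F G : X → ℕ} (hF : PolyTime F) (hG : PolyTime G) : PolyTime (fun x => F x - G x) :=
  (hF.pair hG).prim .sub Polynomial.X (fun _ => rfl) (fun x => by
    have := Nat.size_le_size (Nat.sub_le (F x) (G x))
    simp only [Polynomial.eval_X, size_prod, size_nat]; omega)

theorem PolyTime.div {F G : X → ℕ} (hF : PolyTime F) (hG : PolyTime G) : PolyTime (fun x => F x / G x) :=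
  (hF.pair hG).prim .div Polynomial.X (fun _ => rfl) (fun x => by
    have := Nat.size_le_size (Nat.div_le_self (F x) (G x))
    simp only [Polynomial.eval_X, size_prod, size_nat]; omega)

theorem PolyTime.le {F G : X → ℕ} (hF : PolyTime F) (hG : PolyTime G) : PolyTime (fun x => decide (F x ≤ G x)) :=
  (hF.pair hG).prim .le 2 (fun x => by
      simp only [Prim.apply, Data.onNums, enc_prod, enc_nat, enc_bool, decide_eq_true_eq])
    (fun x => by simpa using size_bool_le _)

theorem PolyTime.eq {F G : X → ℕ} (hF : PolyTime F) (hG : PolyTime G) : PolyTime (fun x => decide (F x = G x)) :=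
  (hF.pair hG).prim .eq 2 (fun x => by
      simp only [Prim.apply, enc_prod, enc_nat, Data.num.injEq]; rfl)
    (fun x => by simpa using size_bool_le _)

theorem PolyTime.ite {c : X → Bool} {F G : X → β} (hc : PolyTime c) (hF : PolyTime F) (hG : PolyTime G) :
    PolyTime (fun x => if c x then F x else G x) := by
  obtain ⟨C, r, hC⟩ := hc
  obtain ⟨P, p, hP⟩ := hF
  obtain ⟨Q, q, hQ⟩ := hG
  refine ⟨.ite C P Q, r + (p + q) + 1, fun x => ?_⟩
  have h := hC x
  simp only [Polynomial.eval_add, Polynomial.eval_one]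
  cases hx : c x with
  | true =>
    rw [hx] at h
    exact (h.ite_then (by simp [enc_bool]) (hP x)).mono (by omega)
  | false =>
    rw [hx] at h
    exact (Program.RunsIn.ite_else h (hQ x)).mono (by omega)

theorem PolyTime.not {c : X → Bool} (hc : PolyTime c) : PolyTime (fun x => !c x) := by
  convert hc.ite PolyTime.constFalse PolyTime.constTrue using 2 with x
  cases c x <;> rfl

theorem PolyTime.and {c d : X → Bool} (hc : PolyTime c) (hd : PolyTime d) : PolyTime (fun x => c x && d x) := by
  convert hc.ite hd PolyTime.constFalse using 2 with x
  cases c x <;> rfl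

theorem PolyTime.or {c d : X → Bool} (hc : PolyTime c) (hd : PolyTime d) : PolyTime (fun x => c x || d x) := by
  convert hc.ite PolyTime.constTrue hd using 2 with x
  cases c x <;> rfl

theorem PolyTime.isEmpty {l : X → List β} (hl : PolyTime l) : PolyTime (fun x => (l x).isEmpty) := by
  have h : PolyTime (fun x => !(l x).isEmpty) := hl.prim .isPair 2 (fun x => by
      cases l x <;> rfl) (fun x => by simpa using size_bool_le _)
  simpa using h.not

theorem PolyTime.headD_nil {l : X → List (List β)} (hl : PolyTime l) : PolyTime (fun x => (l x).headD []) :=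
  hl.prim .fst Polynomial.X (fun x => by cases l x <;> rfl) (fun x => by
    cases l x with
    | nil => simp [size_nil]
    | cons a l => rw [Polynomial.eval_X, size_cons, List.headD_cons]; omega)

/-! ### Loops over lists -/

/-- The loop body that processes the head of the list in the state `((x, l), s)`. -/
def foldBody (P : Program) : Program :=
  .pair (.pair (.comp (.prim .fst) (.prim .fst))
      (.comp (.prim .snd) (.comp (.prim .snd) (.prim .fst))))
    (.comp P (.pair (.pair (.comp (.prim .fst) (.prim .fst)) (.prim .snd))
      (.comp (.prim .fst) (.comp (.prim .snd) (.prim .fst)))))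

/-- The loop that folds over a list. -/
def foldLoop (P : Program) : Program :=
  .loop (.comp (.prim .isPair) (.comp (.prim .snd) (.prim .fst))) (foldBody P)

theorem foldLoop_runsIn {O : Data → Data} {P : Program} {d : Data} {F : σ → β → σ} {S T : ℕ}
    (l : List β) : ∀ s : σ,
    (∀ l', l' <+: l → (enc (l'.foldl F s)).size ≤ S) →
    (∀ l' b, l' ++ [b] <+: l → P.RunsIn O
      (.pair (.pair d (enc (l'.foldl F s))) (enc b)) (enc (F (l'.foldl F s) b)) T) →
    (foldLoop P).RunsIn O (.pair (.pair d (enc l)) (enc s))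
      (.pair (.pair d (enc ([] : List β))) (enc (l.foldl F s)))
      ((l.length + 1) * (100 * (d.size + (enc l).size + S + 3) + T)) := by
  induction l with
  | nil =>
    intro s hS _
    have h1 := ((Program.RunsIn.prim (O := O) .fst
      (.pair (.pair d (enc ([] : List β))) (enc s))).comp (.prim .snd _)).comp (.prim .isPair _)
    obtain ⟨t, ht, hr⟩ := h1
    refine ⟨_, ?_, .loop_done hr⟩
    have := hS [] (List.nil_prefix)
    simp only [List.foldl_nil] at this
    simp only [Prim.apply, Data.size, enc_nil, Data.ofBool, List.length_nil, Nat.size_zero, if_false,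
      Bool.false_eq_true] at ht ⊢
    omega
  | cons b l ih =>
    intro s hS hT
    have hs := hS [] (List.nil_prefix)
    have hs' := hS [b] (by simp)
    have hb := hT [] b (by simp)
    simp only [List.foldl_nil, List.foldl_cons] at hs hs' hb
    obtain ⟨t, ht, hr⟩ := ih (F s b)
      (fun l' h => hS (b :: l') (by simpa using h))
      (fun l' b' h => hT (b :: l') b' (by simpa using h))
    have h1 := ((Program.RunsIn.prim (O := O) .fst
      (.pair (.pair d (enc (b :: l))) (enc s))).comp (.prim .snd _)).comp (.prim .isPair _)
    have hx1 := (Program.RunsIn.prim (O := O) .fst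
      (.pair (.pair d (enc (b :: l))) (enc s))).comp (.prim .fst _)
    have hx2 := ((Program.RunsIn.prim (O := O) .fst
      (.pair (.pair d (enc (b :: l))) (enc s))).comp (.prim .snd _)).comp (.prim .snd _)
    have hx3 := ((Program.RunsIn.prim (O := O) .fst
      (.pair (.pair d (enc (b :: l))) (enc s))).comp (.prim .snd _)).comp (.prim .fst _)
    have hx4 := (Program.RunsIn.prim (O := O) .snd
      (.pair (.pair d (enc (b :: l))) (enc s)))
    have h2 := (hx1.pair hx2).pair (((hx1.pair hx4).pair hx3).comp hb)
    obtain ⟨t1, ht1, hr1⟩ := h1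
    obtain ⟨t2, ht2, hr2⟩ := h2
    refine ⟨_, ?_, .loop_step hr1 (by simp [Prim.apply, enc_cons, Data.ofBool]) hr2 hr⟩
    simp only [Prim.apply, Data.size, enc_cons, Data.ofBool, if_true, List.length_cons] at ht ht1 ht2 ⊢
    have e1 : Nat.size 1 = 1 := rfl
    have hlen : (l.length + 1) * (100 * (d.size + (enc l).size + S + 3) + T) ≤
      (l.length + 1) * (100 * (d.size + ((enc b).size + (enc l).size + 1) + S + 3) + T) := by
      gcongr; omega
    rw [add_mul _ 1]
    rw [e1] at ht1
    generalize (l.length + 1) * (100 * (d.size + ((enc b).size + (enc l).size + 1) + S + 3) + T)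
      = Z at *
    omega

/-- A fold whose intermediate results have polynomial size is computed in polynomial time. -/
theorem PolyTime.foldl {F : X → σ → β → σ} {l : X → List β} {s : X → σ}
    (hF : PolyTime (fun p : (X × σ) × β => F p.1.1 p.1.2 p.2)) (hl : PolyTime l) (hs : PolyTime s)
    (q : Polynomial ℕ)
    (hq : ∀ x, ∀ l', l' <+: l x → (enc (l'.foldl (F x) (s x))).size ≤ q.eval (code x).size) :
    PolyTime (fun x => (l x).foldl (F x) (s x)) := by
  obtain ⟨P, p, hP⟩ := hF
  obtain ⟨L, pl, hL⟩ := hl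
  obtain ⟨I, pi, hI⟩ := hs
  refine ⟨.comp (.prim .snd) (.comp (foldLoop P) (.pair (.pair (.prim .id) L) I)),
    (Polynomial.X + Polynomial.X + pl + 1 + pi + 1) +
      (pl + 1) * (100 * (Polynomial.X + pl + q + 3) + p.comp (Polynomial.X + q + pl + 2)) + 1
      + (Polynomial.X + q + q + 4) + 1, fun x => ?_⟩
  have hlx := (hL x).size_le.2
  have h1 : ∀ l' b, l' ++ [b] <+: l x → P.RunsIn (Ctx.inst x).O
      (.pair (.pair (code x) (enc (l'.foldl (F x) (s x)))) (enc b))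
      (enc (F x (l'.foldl (F x) (s x)) b))
      (p.eval ((code x).size + q.eval (code x).size + pl.eval (code x).size + 2)) := by
    intro l' b hpre
    refine (hP ((x, l'.foldl (F x) (s x)), b)).mono (p.eval_nat_mono ?_)
    simp only [size_code_prod]
    have e1 := hq x l' ((List.prefix_append _ _).trans hpre)
    have e2 : (enc b).size ≤ (enc (l x)).size := size_mem_le (hpre.subset (by simp))
    omega
  have h2 := foldLoop_runsIn (l x) (s x) (hq x) h1
  refine (((((Program.RunsIn.prim .id (code x)).pair (hL x)).pair (hI x)).comp h2).comp
    (.prim .snd _)).mono ?_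
  simp only [Prim.apply, Data.size, enc_nil, Polynomial.eval_add, Polynomial.eval_mul,
    Polynomial.eval_X, Polynomial.eval_one, Polynomial.eval_ofNat, Polynomial.eval_comp,
    Nat.size_zero]
  have e3 := hq x (l x) (List.prefix_refl _)
  have e4 := length_le_size (l x)
  generalize hD : p.eval _ = D
  have e5 : ((l x).length + 1) * (100 * ((code x).size + (enc (l x)).size
      + q.eval (code x).size + 3) + D) ≤ (pl.eval (code x).size + 1) *
      (100 * ((code x).size + pl.eval (code x).size + q.eval (code x).size + 3) + D) := by
    gcongr
    omega
  omega

theorem PolyTime.reverse {l : X → List β} (hl : PolyTime l) : PolyTime (fun x => (l x).reverse) := by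
  obtain ⟨p, hp⟩ := hl.size_le
  have h : PolyTime (fun x => (l x).foldl (fun s b => b :: s) []) :=
    PolyTime.foldl (X := X) (F := fun _ s b => b :: s) (PolyTime.var.cons PolyTime.var.weaken) hl PolyTime.nil p
      (fun x l' hl' => by
        rw [List.foldl_flip_cons_eq_append', List.append_nil, size_reverse]
        exact (size_sublist hl'.sublist).trans (hp x))
  simpa [List.foldl_flip_cons_eq_append'] using h

theorem PolyTime.foldr {F : X → β → σ → σ} {l : X → List β} {s : X → σ}
    (hF : PolyTime (fun p : (X × σ) × β => F p.1.1 p.2 p.1.2)) (hl : PolyTime l) (hs : PolyTime s)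
    (q : Polynomial ℕ)
    (hq : ∀ x, ∀ l', l' <:+ l x → (enc (l'.foldr (F x) (s x))).size ≤ q.eval (code x).size) :
    PolyTime (fun x => (l x).foldr (F x) (s x)) := by
  have h := PolyTime.foldl (F := fun x a b => F x b a) hF hl.reverse hs q (fun x l' hl' => by
    have := hq x l'.reverse (by rw [← List.reverse_prefix, List.reverse_reverse]; exact hl')
    rwa [List.foldr_reverse] at this)
  simpa [List.foldl_reverse] using h

theorem PolyTime.map {F : X → β → γ} {l : X → List β}
    (hl : PolyTime l) (hF : PolyTime (fun p : X × β => F p.1 p.2)) :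
    PolyTime (fun x => (l x).map (F x)) := by
  obtain ⟨p, hp⟩ := hl.size_le
  obtain ⟨q, hq⟩ := hF.size_le
  have h : PolyTime (fun x => (l x).foldr (fun b s => F x b :: s) []) := by
    refine PolyTime.foldr (F := fun x b s => F x b :: s)
      ((hF.subst (s := fun p : (X × List γ) × β => (p.1.1, p.2)) (PolyMap.pair
        (PolyMap.fst.comp PolyMap.fst) PolyTime.var)).cons PolyTime.var.weaken) hl PolyTime.nil
      (p * (q.comp (Polynomial.X + p + 1) + 1) + 1) (fun x l' hl' => ?_)
    have e : ∀ l' : List β, l'.foldr (fun b s => F x b :: s) [] = l'.map (F x) := by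
      intro l'; induction l' <;> simp_all
    rw [e]
    refine (size_list_le (B := q.eval ((code x).size + p.eval (code x).size + 1)) ?_).trans ?_
    · intro c hc
      obtain ⟨b, hb, rfl⟩ := List.mem_map.1 hc
      refine (hq (x, b)).trans (q.eval_nat_mono ?_)
      have := (size_mem_le (hl'.subset hb)).trans (hp x)
      simp only [size_code_prod]
      omega
    · simp only [List.length_map, Polynomial.eval_add, Polynomial.eval_mul, Polynomial.eval_comp,
        Polynomial.eval_X, Polynomial.eval_one]
      gcongr
      exact hl'.length_le.trans ((length_le_size _).trans (hp x))
  convert h using 2 with x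
  induction l x <;> simp_all

theorem PolyTime.filter {c : X → β → Bool} {l : X → List β}
    (hl : PolyTime l) (hc : PolyTime (fun p : X × β => c p.1 p.2)) :
    PolyTime (fun x => (l x).filter (c x)) := by
  obtain ⟨p, hp⟩ := hl.size_le
  have e : ∀ x, ∀ l' : List β,
      l'.foldr (fun b s => if c x b then b :: s else s) [] = l'.filter (c x) := by
    intro x l'
    induction l' with
    | nil => rfl
    | cons a l ih => rw [List.foldr_cons, ih, List.filter_cons]
  have h : PolyTime (fun x => (l x).foldr (fun b s => if c x b then b :: s else s) []) := by
    refine PolyTime.foldr (F := fun x b s => if c x b then b :: s else s)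
      ((hc.subst (s := fun p : (X × List β) × β => (p.1.1, p.2)) (PolyMap.pair
        (PolyMap.fst.comp PolyMap.fst) PolyTime.var)).ite (PolyTime.var.cons PolyTime.var.weaken)
          PolyTime.var.weaken) hl PolyTime.nil p (fun x l' hl' => ?_)
    rw [e]
    exact (size_sublist (List.filter_sublist.trans hl'.sublist)).trans (hp x)
  simpa only [e] using h

theorem PolyTime.append {l l' : X → List β} (hl : PolyTime l) (hl' : PolyTime l') :
    PolyTime (fun x => l x ++ l' x) := by
  obtain ⟨p, hp⟩ := hl.size_le
  obtain ⟨p', hp'⟩ := hl'.size_le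
  have h : PolyTime (fun x => (l x).foldr List.cons (l' x)) := by
    refine PolyTime.foldr (F := fun _ => List.cons) (PolyTime.var.cons PolyTime.var.weaken) hl hl' (p + p')
      (fun x m hm => ?_)
    have e1 := size_append m (l' x)
    have e2 := hp x
    have e3 := hp' x
    have e4 := size_sublist hm.sublist
    rw [List.foldr_cons_eq_append', Polynomial.eval_add]
    omega
  simpa using h

theorem PolyTime.flatten {l : X → List (List β)} (hl : PolyTime l) : PolyTime (fun x => (l x).flatten) := by
  obtain ⟨p, hp⟩ := hl.size_le
  have e : ∀ l' : List (List β), l'.foldr (· ++ ·) [] = l'.flatten := by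
    intro l'; induction l' <;> simp_all
  have e' : ∀ l' : List (List β), (enc l'.flatten).size ≤ (enc l').size := by
    intro l'
    induction l' with
    | nil => rfl
    | cons a l ih =>
      have := size_append a l.flatten
      rw [List.flatten_cons, size_cons]; omega
  have h : PolyTime (fun x => (l x).foldr (· ++ ·) []) := by
    refine PolyTime.foldr (F := fun _ => (· ++ ·)) (PolyTime.var.append PolyTime.var.weaken) hl PolyTime.nil p
      (fun x m hm => ?_)
    rw [e]
    exact ((e' m).trans (size_sublist hm.sublist)).trans (hp x)
  simpa only [e] using h

theorem PolyTime.flatMap {F : X → β → List γ} {l : X → List β}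
    (hl : PolyTime l) (hF : PolyTime (fun p : X × β => F p.1 p.2)) :
    PolyTime (fun x => (l x).flatMap (F x)) := by
  simpa only [List.flatMap_def] using (hl.map hF).flatten

theorem PolyTime.any {c : X → β → Bool} {l : X → List β}
    (hl : PolyTime l) (hc : PolyTime (fun p : X × β => c p.1 p.2)) :
    PolyTime (fun x => (l x).any (c x)) := by
  have h := (hl.filter hc).isEmpty.not
  convert h using 2 with x
  rw [Bool.eq_iff_iff]
  simp [List.any_eq_true, List.filter_eq_nil_iff]

theorem PolyTime.all {c : X → β → Bool} {l : X → List β}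
    (hl : PolyTime l) (hc : PolyTime (fun p : X × β => c p.1 p.2)) :
    PolyTime (fun x => (l x).all (c x)) := by
  have h := (hl.any (c := fun x b => !c x b) hc.not).not
  convert h using 2 with x
  rw [Bool.eq_iff_iff]
  simp [List.all_eq_true]

theorem PolyTime.sum {l : X → List ℕ} (hl : PolyTime l) : PolyTime (fun x => (l x).sum) := by
  obtain ⟨p, hp⟩ := hl.size_le
  have h : PolyTime (fun x => (l x).foldr (fun a b => a + b) 0) := by
    refine PolyTime.foldr (F := fun _ a b => a + b) (PolyTime.var.add PolyTime.var.weaken) hl (PolyTime.const 0) p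
      (fun x m hm => ?_)
    refine le_trans ?_ ((size_sublist hm.sublist).trans (hp x))
    clear hm
    induction m with
    | nil => simp [size_nat, size_nil]
    | cons a m ih =>
      have := Nat.size_add_le' a (m.foldr (fun a b => a + b) 0)
      rw [List.foldr_cons, size_cons]
      rw [size_nat] at *
      rw [size_nat]
      omega
  simpa only [List.sum] using h

theorem PolyTime.prod {l : X → List ℕ} (hl : PolyTime l) : PolyTime (fun x => (l x).prod) := by
  obtain ⟨p, hp⟩ := hl.size_le
  have h : PolyTime (fun x => (l x).foldr (fun a b => a * b) 1) := by
    refine PolyTime.foldr (F := fun _ a b => a * b) (PolyTime.var.mul PolyTime.var.weaken) hl (PolyTime.const 1)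
      (p + 1) (fun x m hm => ?_)
    rw [Polynomial.eval_add, Polynomial.eval_one]
    refine le_trans ?_ (Nat.succ_le_succ ((size_sublist hm.sublist).trans (hp x)))
    clear hm
    induction m with
    | nil => simp [size_nat, size_nil]
    | cons a m ih =>
      have := Nat.size_mul_le' a (m.foldr (fun a b => a * b) 1)
      rw [List.foldr_cons, size_cons]
      rw [size_nat] at *
      rw [size_nat]
      omega
  simpa only [List.prod] using h

theorem PolyTime.length {l : X → List β} (hl : PolyTime l) : PolyTime (fun x => (l x).length) := by
  have h := (hl.map (F := fun _ _ => 1) (PolyTime.const 1)).sum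
  simpa using h

theorem PolyTime.zipIdx {l : X → List β} (hl : PolyTime l) : PolyTime (fun x => (l x).zipIdx) := by
  obtain ⟨p, hp⟩ := hl.size_le
  have e : ∀ (l' : List β) (i : ℕ) (acc : List (β × ℕ)),
      l'.foldl (fun (s : ℕ × List (β × ℕ)) b => (s.1 + 1, (b, s.1) :: s.2)) (i, acc) =
        (i + l'.length, (l'.zipIdx i).reverse ++ acc) := by
    intro l'
    induction l' with
    | nil => intro i acc; simp
    | cons a l ih =>
      intro i acc
      rw [List.foldl_cons, ih]
      simp [List.zipIdx_cons]
      omega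
  have h : PolyTime (fun x => (l x).foldl
      (fun (s : ℕ × List (β × ℕ)) b => (s.1 + 1, (b, s.1) :: s.2)) (0, [])) := by
    refine PolyTime.foldl (F := fun _ (s : ℕ × List (β × ℕ)) b => (s.1 + 1, (b, s.1) :: s.2))
      (PolyTime.pair (PolyTime.var.weaken.fst.add (PolyTime.const 1))
        ((PolyTime.var.pair PolyTime.var.weaken.fst).cons PolyTime.var.weaken.snd))
      hl ((PolyTime.const 0).pair PolyTime.nil) (p + 1 + (p * (p + (p + 1) + 1 + 1) + 1) + 1)
      (fun x l' hl' => ?_)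
    have e1 := (size_sublist hl'.sublist).trans (hp x)
    have e2 := (length_le_size l').trans e1
    have e4 : ∀ i, i ≤ l'.length → (enc i).size ≤ p.eval (code x).size + 1 := by
      intro i hi
      have h1 : Nat.size i ≤ i := by rw [Nat.size_le]; exact Nat.lt_two_pow_self
      rw [size_nat]; omega
    rw [e, List.append_nil, size_prod, size_reverse]
    have e5 : (enc (l'.zipIdx)).size ≤ l'.length *
        (p.eval (code x).size + (p.eval (code x).size + 1) + 1 + 1) + 1 := by
      have := size_list_le (l := l'.zipIdx)
        (B := p.eval (code x).size + (p.eval (code x).size + 1) + 1) (by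
          rintro ⟨b, i⟩ hb
          have hb1 := (size_mem_le (List.fst_mem_of_mem_zipIdx hb)).trans e1
          have hb2 := List.snd_lt_of_mem_zipIdx hb
          have hb3 := e4 i (by simp at hb2; omega)
          rw [size_prod]
          simp only at hb1 hb3 ⊢
          omega)
      simpa using this
    have e6 := e4 (0 + l'.length) (by omega)
    have e7 : l'.length * (p.eval (code x).size + (p.eval (code x).size + 1) + 1 + 1) ≤
      p.eval (code x).size * (p.eval (code x).size + (p.eval (code x).size + 1) + 1 + 1) := by
      gcongr
    simp only [Polynomial.eval_add, Polynomial.eval_mul, Polynomial.eval_one]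
    omega
  have h2 := h.snd.reverse
  simpa [e] using h2

theorem PolyTime.mem {a : X → ℕ} {l : X → List ℕ} (ha : PolyTime a) (hl : PolyTime l) :
    PolyTime (fun x => decide (a x ∈ l x)) := by
  have h := hl.any (c := fun x b => decide (b = a x)) (PolyTime.var.eq ha.weaken)
  convert h using 2 with x
  rw [Bool.eq_iff_iff]
  simp

end

/-! ### Intersecting families and representatives of their cores -/

section Family

variable {α : Type*} [DecidableEq α]

/-- The family `ℱ` is `T`-intersecting: every member contains an element of `T`, and `ℱ` is closed
under intersection and union of members that share an element of `T`. -/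
structure IntersectingFamily (T : Set α) (ℱ : Set (Finset α)) : Prop where
  inter : ∀ A ∈ ℱ, ∀ B ∈ ℱ, ∀ x ∈ T, x ∈ A → x ∈ B → A ∩ B ∈ ℱ
  union : ∀ A ∈ ℱ, ∀ B ∈ ℱ, ∀ x ∈ T, x ∈ A → x ∈ B → A ∪ B ∈ ℱ
  terminal : ∀ A ∈ ℱ, ∃ x ∈ T, x ∈ A

/-- `P ⊆ T` contains one element of each core of `ℱ`, in the form in which this is used: every
member of `ℱ` contains an element of `P`, and every element of `P` is the only one in some
member. -/
structure IsReps (T : Set α) (ℱ : Set (Finset α)) (P : Finset α) : Prop where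
  sub : ∀ t ∈ P, t ∈ T
  hit : ∀ A ∈ ℱ, ∃ t ∈ P, t ∈ A
  own : ∀ t ∈ P, ∃ C ∈ ℱ, t ∈ C ∧ ∀ s ∈ P, s ∈ C → s = t

/-- The members of `ℱ` whose only element in `P` is `t`: those that contain the core represented
by `t` and no other core. -/
def single (ℱ : Set (Finset α)) (P : Finset α) (t : α) : Set (Finset α) :=
  {A | A ∈ ℱ ∧ t ∈ A ∧ ∀ s ∈ P, s ∈ A → s = t}

/-- The node `x` lies in the largest member of `single ℱ P t`. -/
def InHull (ℱ : Set (Finset α)) (P : Finset α) (t x : α) : Prop :=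
  ∃ A ∈ single ℱ P t, x ∈ A

variable {T : Set α} {ℱ ℱ' : Set (Finset α)} {P P' : Finset α}

theorem single_inter (h : IntersectingFamily T ℱ) {t : α} (ht : t ∈ T) {A B : Finset α}
    (hA : A ∈ ℱ) (htA : t ∈ A) (hB : B ∈ single ℱ P t) : A ∩ B ∈ single ℱ P t :=
  ⟨h.inter A hA B hB.1 t ht htA hB.2.1, Finset.mem_inter.2 ⟨htA, hB.2.1⟩,
    fun s hs hsA => hB.2.2 s hs (Finset.mem_inter.1 hsA).2⟩

theorem single_union (h : IntersectingFamily T ℱ) {t : α} (ht : t ∈ T) {A B : Finset α}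
    (hA : A ∈ single ℱ P t) (hB : B ∈ single ℱ P t) : A ∪ B ∈ single ℱ P t :=
  ⟨h.union A hA.1 B hB.1 t ht hA.2.1 hB.2.1, Finset.mem_union_left _ hA.2.1,
    fun s hs hsA => (Finset.mem_union.1 hsA).elim (hA.2.2 s hs) (hB.2.2 s hs)⟩

theorem exists_least_mem (h : IntersectingFamily T ℱ) {t : α} (ht : t ∈ T) {A : Finset α}
    (hA : A ∈ ℱ) (htA : t ∈ A) : ∃ C ∈ ℱ, t ∈ C ∧ ∀ B ∈ ℱ, t ∈ B → C ⊆ B := by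
  obtain ⟨C, ⟨hC, htC⟩, hmin⟩ := WellFounded.has_min (measure (Finset.card (α := α))).wf
    {A | A ∈ ℱ ∧ t ∈ A} ⟨A, hA, htA⟩
  refine ⟨C, hC, htC, fun B hB htB => ?_⟩
  have h1 := hmin (C ∩ B) ⟨h.inter C hC B hB t ht htC htB, Finset.mem_inter.2 ⟨htC, htB⟩⟩
  have h2 : C ∩ B = C := Finset.eq_of_subset_of_card_le Finset.inter_subset_left (not_lt.1 h1)
  rw [← h2]
  exact Finset.inter_subset_right

theorem exists_greatest_single (h : IntersectingFamily T ℱ) {U : Finset α} (hU : ∀ A ∈ ℱ, A ⊆ U)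
    (hP : IsReps T ℱ P) {t : α} (ht : t ∈ P) :
    ∃ M ∈ single ℱ P t, ∀ A ∈ single ℱ P t, A ⊆ M := by
  obtain ⟨C, hC, htC, hC'⟩ := hP.own t ht
  obtain ⟨M, hM, hmax⟩ := WellFounded.has_min
    (measure (fun A : Finset α => U.card - A.card)).wf (single ℱ P t) ⟨C, hC, htC, hC'⟩
  refine ⟨M, hM, fun B hB => ?_⟩
  have hun := single_union h (hP.sub t ht) hM hB
  have h1 : ¬ U.card - (M ∪ B).card < U.card - M.card := hmax _ hun
  have h2 := Finset.card_le_card (hU _ hun.1)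
  have h3 : M = M ∪ B := Finset.eq_of_subset_of_card_le Finset.subset_union_left (by omega)
  rw [h3]
  exact Finset.subset_union_right

theorem InHull.unique (h : IntersectingFamily T ℱ) (hP : IsReps T ℱ P) {s t x : α} (hx : x ∈ T)
    (hs : InHull ℱ P s x) (ht : InHull ℱ P t x) : s = t := by
  obtain ⟨A, hA, hxA⟩ := hs
  obtain ⟨B, hB, hxB⟩ := ht
  obtain ⟨r, hr, hrAB⟩ := hP.hit _ (h.inter A hA.1 B hB.1 x hx hxA hxB)
  rw [Finset.mem_inter] at hrAB
  rw [← hA.2.2 r hr hrAB.1, ← hB.2.2 r hr hrAB.2]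

/-- If every member of the smaller family contains a representative outside `S`, the number of
cores drops by at least `|S|`. -/
theorem card_reps_add_card_le (h' : IntersectingFamily T ℱ') (hP : IsReps T ℱ P)
    (hP' : IsReps T ℱ' P') {S : Finset α} (hS : S ⊆ P)
    (hgood : ∀ A ∈ ℱ', ∃ t ∈ P, t ∉ S ∧ t ∈ A) : P'.card + S.card ≤ P.card := by
  rcases P'.eq_empty_or_nonempty with rfl | ⟨x, -⟩
  · simpa using Finset.card_le_card hS
  have : Nonempty α := ⟨x⟩
  choose! C hC htC hCu using hP'.own
  choose! g hgP hgS hgA using hgood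
  have h1 : P'.card ≤ (P \ S).card := by
    refine Finset.card_le_card_of_injOn (fun t => g (C t)) (fun t ht => ?_) (fun t ht s hs hts => ?_)
    · have := hC t ht
      simpa using ⟨hgP _ this, hgS _ this⟩
    · have ht' := hC t ht
      have hs' := hC s hs
      obtain ⟨r, hr, hrA⟩ := hP'.hit _ (h'.inter _ ht' _ hs' (g (C t))
        (hP.sub _ (hgP _ ht')) (hgA _ ht') (by
          simp only at hts; rw [hts]; exact hgA _ hs'))
      rw [Finset.mem_inter] at hrA
      rw [← hCu t ht r hr hrA.1, ← hCu s hs r hr hrA.2]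
  rw [Finset.card_sdiff_of_subset hS] at h1
  have := Finset.card_le_card hS
  omega

/-- A star consists of an edge `(u, v)` that enters the largest member of `single ℱ P t` for each
`t ∈ S`, and of paths `Y t` from `v` to the core of `t` inside this member. A member of `ℱ` that is
not covered by the star but in which all representatives belong to `S` contains `u`, since the edge
that covers its intersection with the largest member of `single ℱ P t` can only be `(u, v)`. -/
theorem exists_rep_of_not_entered (h : IntersectingFamily T ℱ) {U : Finset α}
    (hU : ∀ A ∈ ℱ, A ⊆ U) (hP : IsReps T ℱ P) {S : Finset α} {u v : α}
    {Y : α → Set (α × α)} {X : Set (α × α)} (he : (u, v) ∈ X) (hYX : ∀ t ∈ S, Y t ⊆ X)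
    (hu : ∀ t ∈ S, ¬ InHull ℱ P t u)
    (hYM : ∀ t ∈ S, ∀ g ∈ Y t, InHull ℱ P t g.1)
    (hYv : ∀ t ∈ S, ∀ A ∈ single ℱ P t, (∀ g ∈ Y t, g.2 ∈ A → g.1 ∈ A) → v ∈ A)
    (hgood : (∀ A ∈ ℱ, u ∈ A → ∃ t ∈ P, t ∉ S ∧ t ∈ A) ∨ ∀ s ∈ S, ∀ t ∈ S, s = t)
    {A : Finset α} (hA : A ∈ ℱ) (hXA : ∀ g ∈ X, g.2 ∈ A → g.1 ∈ A) :
    ∃ t ∈ P, t ∉ S ∧ t ∈ A := by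
  by_contra hcon
  push Not at hcon
  have hPS : ∀ t ∈ P, t ∈ A → t ∈ S := fun t ht htA => by
    by_contra htS
    exact hcon t ht htS htA
  obtain ⟨t, ht, htA⟩ := hP.hit A hA
  have htS := hPS t ht htA
  obtain ⟨M, hM, hmax⟩ := exists_greatest_single h hU hP ht
  have hB := single_inter h (hP.sub t ht) hA htA hM
  have hv : v ∈ A ∩ M := by
    refine hYv t htS _ hB (fun g hg hg2 => ?_)
    rw [Finset.mem_inter] at hg2 ⊢
    obtain ⟨B, hB, hgB⟩ := hYM t htS g hg
    exact ⟨hXA g (hYX t htS hg) hg2.1, hmax B hB hgB⟩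
  have huA : u ∈ A := hXA _ he (Finset.mem_inter.1 hv).1
  rcases hgood with hgood | hgood
  · obtain ⟨s, hs, hsS, hsA⟩ := hgood A hA huA
    exact hcon s hs hsS hsA
  · exact hu t htS ⟨A, ⟨hA, htA, fun s hs hsA => hgood s (hPS s hs hsA) t htS⟩, huA⟩

/-! ### The density of the best star -/

/-- The dual argument: `d t` measures the distance from the core of `t` to the nodes `R t` reached
from it, and the layers `{x | d t x ≤ i}` with `i < θ` form a fractional packing of members of
`ℱ`. If no star has density below `θ`, an edge `e` enters at most `2 * c e` of these layers: at
most `c e` as an edge inside the hull of a core, and at most `c e` as the edge of a star. When the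
star of `e` is not good, it is the disjoint union of two good stars, but then `e` does not lie inside
the hull of a core. Since `J` enters each layer `k` times, this bounds the cost of `J` from
below. -/
theorem mul_card_reps_le_cost (h : IntersectingFamily T ℱ) (hP : IsReps T ℱ P) {ι : Type*}
    {J : Finset ι} {tail head : ι → α} {c : ι → ℕ} {R : α → Finset α} {d : α → α → ℕ} {θ k : ℕ}
    (hlayer : ∀ t ∈ P, ∀ i, (R t).filter (fun x => d t x ≤ i) ∈ single ℱ P t)
    (hstep : ∀ t ∈ P, ∀ e ∈ J, head e ∈ R t → InHull ℱ P t (tail e) →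
      tail e ∈ R t ∧ d t (tail e) ≤ d t (head e) + c e)
    (hk : ∀ A ∈ ℱ, k ≤ (J.filter (fun e => head e ∈ A ∧ tail e ∉ A)).card)
    (hq : ∀ e ∈ J, tail e ∈ T ∨ head e ∈ T ∨ (∀ A ∈ ℱ, tail e ∉ A) ∨ ∀ A ∈ ℱ, head e ∉ A)
    (hstar : ∀ e ∈ J, ∀ S S' : Finset α, (∀ t, t ∈ S' ↔
        t ∈ P ∧ ¬ InHull ℱ P t (tail e) ∧ head e ∈ R t ∧ d t (head e) < θ) →
      S.Nonempty → S ⊆ S' → ((∃ t, S = {t}) ∨ S = S' ∨ ∃ x ∈ S', S = S'.erase x) →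
      ((∀ A ∈ ℱ, tail e ∈ A → ∃ t ∈ P, t ∉ S ∧ t ∈ A) ∨ ∀ s ∈ S, ∀ t ∈ S, s = t) →
      θ * S.card ≤ c e + ∑ t ∈ S, d t (head e)) :
    k * θ * P.card ≤ 2 * ∑ e ∈ J, c e := by
  classical
  set w : ι → α → ℕ := fun e t => ((Finset.range θ).filter (fun i =>
    head e ∈ (R t).filter (fun x => d t x ≤ i) ∧ tail e ∉ (R t).filter (fun x => d t x ≤ i))).card
    with hw
  have hRmem : ∀ t ∈ P, ∀ x ∈ R t, InHull ℱ P t x := fun t ht x hx =>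
    ⟨_, hlayer t ht (d t x), by simp [hx]⟩
  have hsum : k * θ * P.card ≤ ∑ e ∈ J, ∑ t ∈ P, w e t := by
    calc k * θ * P.card = ∑ t ∈ P, ∑ i ∈ Finset.range θ, k := by simp; ring
      _ ≤ ∑ t ∈ P, ∑ i ∈ Finset.range θ, (J.filter (fun e =>
          head e ∈ (R t).filter (fun x => d t x ≤ i) ∧
            tail e ∉ (R t).filter (fun x => d t x ≤ i))).card :=
        Finset.sum_le_sum fun t ht => Finset.sum_le_sum fun i _ => hk _ (hlayer t ht i).1
      _ = ∑ t ∈ P, ∑ e ∈ J, w e t := by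
        refine Finset.sum_congr rfl fun t _ => ?_
        simp only [hw, Finset.card_filter]
        exact Finset.sum_comm
      _ = ∑ e ∈ J, ∑ t ∈ P, w e t := Finset.sum_comm
  refine hsum.trans ?_
  rw [Finset.mul_sum]
  refine Finset.sum_le_sum fun e he => ?_
  set S' := P.filter (fun t => ¬ InHull ℱ P t (tail e) ∧ head e ∈ R t ∧ d t (head e) < θ) with hS'
  have hS'iff : ∀ t, t ∈ S' ↔
      t ∈ P ∧ ¬ InHull ℱ P t (tail e) ∧ head e ∈ R t ∧ d t (head e) < θ := by
    intro t; rw [hS', Finset.mem_filter]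
  have hS'P : S' ⊆ P := Finset.filter_subset _ _
  -- an edge with its head outside the reached nodes enters no layer
  have hw0 : ∀ t, head e ∉ R t → w e t = 0 := by
    intro t ht
    simp [hw, ht]
  have hwin : ∀ t ∈ P, InHull ℱ P t (tail e) → w e t ≤ c e := by
    intro t ht hin
    by_cases hh : head e ∈ R t
    · obtain ⟨h1, h2⟩ := hstep t ht e he hh hin
      calc w e t ≤ (Finset.Ico (d t (head e)) (d t (tail e))).card := by
            refine Finset.card_le_card fun i hi => ?_
            simp only [Finset.mem_filter, hh, h1, true_and, not_le] at hi
            exact Finset.mem_Ico.2 hi.2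
        _ ≤ c e := by rw [Nat.card_Ico]; omega
    · rw [hw0 t hh]; exact Nat.zero_le _
  have hwout : ∀ t ∈ P, ¬ InHull ℱ P t (tail e) → t ∉ S' → w e t = 0 := by
    intro t ht hin htS
    rw [hS'iff] at htS
    by_cases hh : head e ∈ R t
    · have hd : θ ≤ d t (head e) := by
        by_contra hd
        exact htS ⟨ht, hin, hh, not_le.1 hd⟩
      rw [hw, Finset.card_eq_zero, Finset.filter_eq_empty_iff]
      intro i hi
      rw [Finset.mem_range] at hi
      simp only [Finset.mem_filter, hh, true_and, not_and]
      intro h3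
      omega
    · exact hw0 t hh
  have hwS : ∀ t ∈ S', w e t + d t (head e) ≤ θ := by
    intro t ht
    have ht' := (hS'iff t).1 ht
    have : w e t ≤ (Finset.Ico (d t (head e)) θ).card := by
      refine Finset.card_le_card fun i hi => ?_
      simp only [Finset.mem_filter, Finset.mem_range, ht'.2.2.1, true_and] at hi
      exact Finset.mem_Ico.2 ⟨hi.2.1, hi.1⟩
    rw [Nat.card_Ico] at this
    omega
  -- the number of layers entered by `e` as the edge of a good star
  have hgoodsum : ∀ S ⊆ S', ((∃ t, S = {t}) ∨ S = S' ∨ ∃ x ∈ S', S = S'.erase x) →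
      ((∀ A ∈ ℱ, tail e ∈ A → ∃ t ∈ P, t ∉ S ∧ t ∈ A) ∨ ∀ s ∈ S, ∀ t ∈ S, s = t) →
      ∑ t ∈ S, w e t ≤ c e := by
    intro S hS hshape hg
    rcases S.eq_empty_or_nonempty with rfl | hne
    · simp
    have h1 := hstar e he S S' hS'iff hne hS hshape hg
    have h2 : ∑ t ∈ S, (w e t + d t (head e)) ≤ ∑ t ∈ S, θ :=
      Finset.sum_le_sum fun t ht => hwS t (hS ht)
    rw [Finset.sum_add_distrib, Finset.sum_const, smul_eq_mul, mul_comm] at h2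
    omega
  have hsplit : ∑ t ∈ P, w e t =
      ∑ t ∈ P.filter (fun t => InHull ℱ P t (tail e)), w e t + ∑ t ∈ S', w e t := by
    rw [← Finset.sum_filter_add_sum_filter_not P (fun t => InHull ℱ P t (tail e))]
    congr 1
    symm
    refine Finset.sum_subset (fun t ht => ?_) (fun t ht htS => ?_)
    · have := (hS'iff t).1 ht
      exact Finset.mem_filter.2 ⟨this.1, this.2.1⟩
    · rw [Finset.mem_filter] at ht
      exact hwout t ht.1 ht.2 htS
  have hone : (∀ s ∈ P, ∀ t ∈ P, InHull ℱ P s (tail e) → head e ∈ R s → InHull ℱ P t (tail e) →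
      head e ∈ R t → s = t) →
      ∑ t ∈ P.filter (fun t => InHull ℱ P t (tail e)), w e t ≤ c e := by
    intro huniq
    by_cases hex : ∃ s ∈ P.filter (fun t => InHull ℱ P t (tail e)), head e ∈ R s
    · obtain ⟨s, hs, hsR⟩ := hex
      have hs' := Finset.mem_filter.1 hs
      rw [Finset.sum_eq_single_of_mem s hs]
      · exact hwin s hs'.1 hs'.2
      · intro t ht hts
        have ht' := Finset.mem_filter.1 ht
        refine hw0 t fun htR => hts ?_
        exact huniq t ht'.1 s hs'.1 ht'.2 htR hs'.2 hsR
    · push Not at hex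
      rw [Finset.sum_eq_zero fun t ht => hw0 t (hex t ht)]
      exact Nat.zero_le _
  rw [hsplit]
  rcases hq e he with hT | hT | hno | hno
  · have hin := hone (fun s _ t _ h1 _ h2 _ => InHull.unique h hP hT h1 h2)
    by_cases hex : ∃ t₀ ∈ P, InHull ℱ P t₀ (tail e)
    · obtain ⟨t₀, ht₀, B, hB, huB⟩ := hex
      have := hgoodsum S' subset_rfl (.inr (.inl rfl)) (.inl fun A hA huA => by
        obtain ⟨r, hr, hrA⟩ := hP.hit _ (h.inter A hA B hB.1 _ hT huA huB)
        rw [Finset.mem_inter] at hrA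
        have := hB.2.2 r hr hrA.2
        subst this
        exact ⟨r, hr, fun hrS => ((hS'iff r).1 hrS).2.1 ⟨B, hB, huB⟩, hrA.1⟩)
      omega
    · push Not at hex
      have hin0 : ∑ t ∈ P.filter (fun t => InHull ℱ P t (tail e)), w e t = 0 := by
        rw [Finset.filter_eq_empty_iff.2 (fun t ht => hex t ht), Finset.sum_empty]
      rw [hin0, zero_add]
      by_cases hg : ∀ A ∈ ℱ, tail e ∈ A → ∃ t ∈ P, t ∉ S' ∧ t ∈ A
      · have := hgoodsum S' subset_rfl (.inr (.inl rfl)) (.inl hg)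
        omega
      · push Not at hg
        obtain ⟨A, hA, huA, hAS⟩ := hg
        obtain ⟨C, hC, huC, hmin⟩ := exists_least_mem h hT hA huA
        obtain ⟨x, hx, hxC⟩ := hP.hit C hC
        have hxS : x ∈ S' := by
          by_contra hxS
          exact hAS x hx hxS (hmin A hA huA hxC)
        have h1 := hgoodsum (S'.erase x) (Finset.erase_subset _ _)
          (.inr (.inr ⟨x, hxS, rfl⟩))
          (.inl fun B hB huB => ⟨x, hx, Finset.notMem_erase _ _, hmin B hB huB hxC⟩)
        have h2 := hgoodsum {x} (Finset.singleton_subset_iff.2 hxS) (.inl ⟨x, rfl⟩)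
          (.inr fun s hs t ht => (Finset.mem_singleton.1 hs).trans (Finset.mem_singleton.1 ht).symm)
        rw [Finset.sum_singleton] at h2
        rw [← Finset.sum_erase_add _ _ hxS]
        omega
  · have huniq : ∀ s ∈ P, ∀ t ∈ P, head e ∈ R s → head e ∈ R t → s = t := fun s hs t ht h1 h2 =>
      InHull.unique h hP hT (hRmem s hs _ h1) (hRmem t ht _ h2)
    have hin := hone (fun s hs t ht _ h1 _ h2 => huniq s hs t ht h1 h2)
    have := hgoodsum S' subset_rfl (.inr (.inl rfl)) (.inr fun s hs t ht => by
      rw [hS'iff] at hs ht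
      exact huniq s hs.1 t ht.1 hs.2.2.1 ht.2.2.1)
    omega
  · have hin := hone (fun s _ t _ ⟨A, hA, h1⟩ _ _ _ => absurd h1 (hno A hA.1))
    have := hgoodsum S' subset_rfl (.inr (.inl rfl)) (.inl fun A hA huA => absurd huA (hno A hA))
    omega
  · have hnR : ∀ t ∈ P, head e ∉ R t := fun t ht hh => by
      obtain ⟨A, hA, h1⟩ := hRmem t ht _ hh
      exact hno A hA.1 h1
    rw [← hsplit, Finset.sum_eq_zero fun t ht => hw0 t (hnR t ht)]
    exact Nat.zero_le _

end Family

/-! ### Minimal elements of lists -/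

section MinBy

variable {β : Type}

/-- A list that holds one minimal element of `l` with respect to `le`, if there is one. -/
def minBy (le : β → β → Bool) (l : List β) : List β :=
  l.foldr (fun b acc => if acc.all (fun c => le b c) then [b] else acc) []

variable {le : β → β → Bool}

theorem minBy_sublist (l : List β) : (minBy le l).Sublist l := by
  induction l with
  | nil => exact List.Sublist.slnil
  | cons b l ih =>
    rw [minBy, List.foldr_cons]
    split
    · exact List.Sublist.cons_cons b (List.nil_sublist l)
    · exact ih.cons b

theorem minBy_eq_nil_or (l : List β) : (l = [] ∧ minBy le l = []) ∨ ∃ c ∈ l, minBy le l = [c] := by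
  induction l with
  | nil => exact .inl ⟨rfl, rfl⟩
  | cons b l ih =>
    right
    have e : minBy le (b :: l) =
      if (minBy le l).all (fun c => le b c) then [b] else minBy le l := rfl
    rw [e]
    split
    · exact ⟨b, List.mem_cons_self, rfl⟩
    · rcases ih with ⟨_, h⟩ | ⟨c, hc, h⟩
      · simp_all
      · exact ⟨c, List.mem_cons_of_mem _ hc, h⟩

theorem le_of_mem_minBy {p : β → Prop} (htot : ∀ a b, p a → p b → le a b = true ∨ le b a = true)
    (htrans : ∀ a b c, p a → p b → p c → le a b = true → le b c = true → le a c = true)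
    {l : List β} (hp : ∀ a ∈ l, p a) {c : β} (hc : c ∈ minBy le l) : ∀ b ∈ l, le c b = true := by
  induction l generalizing c with
  | nil => simp
  | cons a l ih =>
    have e : minBy le (a :: l) =
      if (minBy le l).all (fun c => le a c) then [a] else minBy le l := rfl
    have hpa := hp a List.mem_cons_self
    have hpl : ∀ b ∈ l, p b := fun b hb => hp b (List.mem_cons_of_mem _ hb)
    have hrefl : le a a = true := (htot a a hpa hpa).elim id id
    rw [e] at hc
    intro b hb
    split at hc
    · rename_i hall
      rw [List.mem_singleton] at hc
      subst hc
      rcases List.mem_cons.1 hb with rfl | hb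
      · exact hrefl
      · rcases minBy_eq_nil_or (le := le) l with ⟨rfl, _⟩ | ⟨d, hd, hmin⟩
        · simp at hb
        · have h1 : le c d = true := by simpa [hmin] using hall
          exact htrans c d b hpa (hpl d hd) (hpl b hb) h1 (ih hpl (by simp [hmin]) b hb)
    · rename_i hall
      rcases List.mem_cons.1 hb with rfl | hb
      · rcases minBy_eq_nil_or (le := le) l with ⟨_, h⟩ | ⟨d, hd, hmin⟩
        · simp [h] at hc
        · rw [hmin] at hc hall
          rw [List.mem_singleton] at hc
          subst hc
          simp only [List.all_cons, List.all_nil, Bool.and_true] at hall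
          exact (htot c b (hpl c hd) hpa).resolve_right hall
      · exact ih hpl hc b hb

theorem PolyTime.minBy {X : Type} [Ctx X] [Enc β] {le : X → β → β → Bool} {l : X → List β}
    (hl : PolyTime l) (hle : PolyTime (fun p : (X × β) × β => le p.1.1 p.1.2 p.2)) :
    PolyTime (fun x => minBy (le x) (l x)) := by
  obtain ⟨p, hp⟩ := hl.size_le
  refine PolyTime.foldr (F := fun x b acc => if acc.all (fun c => le x b c) then [b] else acc)
    (PolyTime.ite ?_ (PolyTime.var.cons PolyTime.nil) PolyTime.var.weaken) hl PolyTime.nil p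
    (fun x l' hl' => ?_)
  · exact PolyTime.all (X := (X × List β) × β) (c := fun p c => le p.1.1 p.2 c)
      PolyTime.var.weaken (hle.subst (s := fun p : ((X × List β) × β) × β =>
        ((p.1.1.1, p.1.2), p.2)) (((PolyMap.fst.comp (PolyMap.fst.comp PolyMap.fst)).pair
          PolyTime.var.weaken).pair PolyTime.var))
  · exact (size_sublist ((minBy_sublist l').trans hl'.sublist)).trans (hp x)

end MinBy

/-! ### Shortest paths -/

/-- An edge as it occurs in programs: its tail, head, cost and index. -/
abbrev Edge : Type := ℕ × ℕ × ℕ × ℕ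

/-- The total cost of a list of edges. -/
def costOf (p : List Edge) : ℕ := (p.map (fun e => e.2.2.1)).sum

theorem costOf_append (p q : List Edge) : costOf (p ++ q) = costOf p + costOf q := by
  simp [costOf]

/-- The labels that Dijkstra's algorithm may add to the list `S` of labelled nodes. A label is a
node together with the edges of a path that leads to it; an element `(y, x, q)` of `A` is an arc
from `y` to `x`, and following it adds the edges `q` to the path. -/
def extensions (A : List (ℕ × ℕ × List Edge)) (S : List (ℕ × List Edge)) : List (ℕ × List Edge) :=
  S.flatMap fun s => (A.filter fun a => decide (a.1 = s.1) &&
    !decide (a.2.1 ∈ S.map Prod.fst)).map fun a => (a.2.1, s.2 ++ a.2.2)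

/-- One round of Dijkstra's algorithm adds a label of minimum cost. -/
def dijkstraStep (A : List (ℕ × ℕ × List Edge)) (S : List (ℕ × List Edge)) :
    List (ℕ × List Edge) :=
  minBy (fun a b => decide (costOf a.2 ≤ costOf b.2)) (extensions A S) ++ S

/-- Dijkstra's algorithm with source `t`; the length of `rounds` is the number of rounds. -/
def dijkstra (A : List (ℕ × ℕ × List Edge)) (t : ℕ) (rounds : List ℕ) : List (ℕ × List Edge) :=
  rounds.foldl (fun S _ => dijkstraStep A S) [(t, [])]

section Dijkstra

variable {A : List (ℕ × ℕ × List Edge)} {S : List (ℕ × List Edge)} {t : ℕ}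

theorem mem_extensions {c : ℕ × List Edge} : c ∈ extensions A S ↔
    ∃ s ∈ S, ∃ a ∈ A, a.1 = s.1 ∧ a.2.1 ∉ S.map Prod.fst ∧ c = (a.2.1, s.2 ++ a.2.2) := by
  simp only [extensions, List.mem_flatMap, List.mem_map, List.mem_filter, Bool.and_eq_true,
    decide_eq_true_eq, Bool.not_eq_true', decide_eq_false_iff_not]
  constructor
  · rintro ⟨s, hs, a, ⟨ha, h1, h2⟩, rfl⟩
    exact ⟨s, hs, a, ha, h1, h2, rfl⟩
  · rintro ⟨s, hs, a, ha, h1, h2, rfl⟩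
    exact ⟨s, hs, a, ⟨ha, h1, h2⟩, rfl⟩

/-- The invariant of Dijkstra's algorithm. -/
structure DijkstraInv (A : List (ℕ × ℕ × List Edge)) (t : ℕ) (S : List (ℕ × List Edge)) :
    Prop where
  nodup : (S.map Prod.fst).Nodup
  source : (t, []) ∈ S
  step : ∀ s ∈ S, ∀ a ∈ A, a.1 = s.1 →
    (∃ s' ∈ S, s'.1 = a.2.1 ∧ costOf s'.2 ≤ costOf s.2 + costOf a.2.2) ∨
    (a.2.1 ∉ S.map Prod.fst ∧ ∀ s' ∈ S, costOf s'.2 ≤ costOf s.2 + costOf a.2.2)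

theorem dijkstraStep_eq (A : List (ℕ × ℕ × List Edge)) (S : List (ℕ × List Edge)) :
    (extensions A S = [] ∧ dijkstraStep A S = S) ∨ ∃ c ∈ extensions A S,
      (∀ b ∈ extensions A S, costOf c.2 ≤ costOf b.2) ∧ dijkstraStep A S = c :: S := by
  rcases minBy_eq_nil_or (le := fun a b : ℕ × List Edge => decide (costOf a.2 ≤ costOf b.2))
    (extensions A S) with ⟨h1, h2⟩ | ⟨c, hc, h⟩
  · exact .inl ⟨h1, by rw [dijkstraStep, h2, List.nil_append]⟩
  · refine .inr ⟨c, hc, fun b hb => ?_, by rw [dijkstraStep, h]; rfl⟩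
    have := le_of_mem_minBy (p := fun _ => True)
      (le := fun a b : ℕ × List Edge => decide (costOf a.2 ≤ costOf b.2))
      (fun a b _ _ => by simpa using le_total _ _)
      (fun a b c _ _ _ h1 h2 => by simp at h1 h2 ⊢; omega) (fun _ _ => trivial)
      (by rw [h]; exact List.mem_singleton_self c) b hb
    simpa using this

theorem DijkstraInv.dijkstraStep (h : DijkstraInv A t S) : DijkstraInv A t (dijkstraStep A S) := by
  rcases dijkstraStep_eq A S with ⟨_, h2⟩ | ⟨c, hc, hmin, h2⟩
  · rwa [h2]
  rw [h2]
  obtain ⟨s₀, hs₀, a₀, ha₀, h1, hnew, rfl⟩ := mem_extensions.1 hc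
  have hmono : ∀ s' ∈ S, costOf s'.2 ≤ costOf (s₀.2 ++ a₀.2.2) := by
    intro s' hs'
    rw [costOf_append]
    rcases h.step s₀ hs₀ a₀ ha₀ h1 with ⟨r, hr, hr1, _⟩ | ⟨_, h3⟩
    · exact absurd (List.mem_map.2 ⟨r, hr, hr1⟩) hnew
    · exact h3 s' hs'
  refine ⟨?_, List.mem_cons_of_mem _ h.source, ?_⟩
  · rw [List.map_cons, List.nodup_cons]
    exact ⟨hnew, h.nodup⟩
  intro s hs a ha has
  rcases List.mem_cons.1 hs with rfl | hs
  · by_cases hin : a.2.1 ∈ S.map Prod.fst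
    · obtain ⟨s', hs', he⟩ := List.mem_map.1 hin
      exact .inl ⟨s', List.mem_cons_of_mem _ hs', he, (hmono s' hs').trans (Nat.le_add_right _ _)⟩
    · by_cases he : a.2.1 = a₀.2.1
      · exact .inl ⟨_, List.mem_cons_self, he.symm, Nat.le_add_right _ _⟩
      · refine .inr ⟨?_, ?_⟩
        · rw [List.map_cons, List.mem_cons]
          exact not_or.2 ⟨he, hin⟩
        · intro s' hs'
          rcases List.mem_cons.1 hs' with rfl | hs'
          · exact Nat.le_add_right _ _
          · exact (hmono s' hs').trans (Nat.le_add_right _ _)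
  · rcases h.step s hs a ha has with ⟨s', hs', h3, h4⟩ | ⟨h3, h4⟩
    · exact .inl ⟨s', List.mem_cons_of_mem _ hs', h3, h4⟩
    · have hcand := hmin _ (mem_extensions.2 ⟨s, hs, a, ha, has, h3, rfl⟩)
      simp only [costOf_append s.2] at hcand
      by_cases he : a.2.1 = a₀.2.1
      · exact .inl ⟨_, List.mem_cons_self, he.symm, hcand⟩
      · refine .inr ⟨?_, ?_⟩
        · rw [List.map_cons, List.mem_cons]
          exact not_or.2 ⟨he, h3⟩
        · intro s' hs'
          rcases List.mem_cons.1 hs' with rfl | hs'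
          · exact hcand
          · exact h4 s' hs'

theorem dijkstra_eq (A : List (ℕ × ℕ × List Edge)) (t : ℕ) (rounds : List ℕ) :
    dijkstra A t rounds = (dijkstraStep A)^[rounds.length] [(t, [])] :=
  List.foldl_const _ _ _

theorem DijkstraInv.iterate (A : List (ℕ × ℕ × List Edge)) (t i : ℕ) :
    DijkstraInv A t ((_root_.dijkstraStep A)^[i] [(t, [])]) := by
  induction i with
  | zero =>
    refine ⟨by simp, by simp, fun s hs a ha has => ?_⟩
    simp only [Function.iterate_zero, id_eq, List.mem_singleton] at hs
    subst hs
    by_cases he : a.2.1 = t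
    · exact .inl ⟨_, by simp, he.symm, Nat.le_add_right _ _⟩
    · exact .inr ⟨by simpa using he, by simp [costOf]⟩
  | succ i ih =>
    rw [Function.iterate_succ_apply']
    exact ih.dijkstraStep

theorem dijkstra_induction {p : ℕ × List Edge → Prop} (h0 : p (t, []))
    (hstep : ∀ s, p s → ∀ a ∈ A, a.1 = s.1 → p (a.2.1, s.2 ++ a.2.2)) (rounds : List ℕ) :
    ∀ s ∈ dijkstra A t rounds, p s := by
  rw [dijkstra_eq]
  induction rounds.length with
  | zero => simpa using h0
  | succ i ih =>
    rw [Function.iterate_succ_apply']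
    rcases dijkstraStep_eq A ((dijkstraStep A)^[i] [(t, [])]) with ⟨_, h2⟩ | ⟨c, hc, _, h2⟩
    · rwa [h2]
    · rw [h2]
      intro s hs
      rcases List.mem_cons.1 hs with rfl | hs
      · obtain ⟨s₀, hs₀, a₀, ha₀, h1, _, rfl⟩ := mem_extensions.1 hc
        exact hstep s₀ (ih s₀ hs₀) a₀ ha₀ h1
      · exact ih s hs

theorem dijkstra_nodup (rounds : List ℕ) : ((dijkstra A t rounds).map Prod.fst).Nodup := by
  rw [dijkstra_eq]
  exact (DijkstraInv.iterate A t _).nodup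

theorem source_mem_dijkstra (rounds : List ℕ) : (t, []) ∈ dijkstra A t rounds := by
  rw [dijkstra_eq]
  exact (DijkstraInv.iterate A t _).source

/-- With as many rounds as there are nodes, the path costs found by Dijkstra's algorithm are a
feasible potential. -/
theorem dijkstra_closed {U : Finset ℕ} (ht : t ∈ U) (hA : ∀ a ∈ A, a.2.1 ∈ U) {rounds : List ℕ}
    (hU : U.card ≤ rounds.length) : ∀ s ∈ dijkstra A t rounds, ∀ a ∈ A, a.1 = s.1 →
      ∃ s' ∈ dijkstra A t rounds, s'.1 = a.2.1 ∧ costOf s'.2 ≤ costOf s.2 + costOf a.2.2 := by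
  have hsub : ∀ s ∈ dijkstra A t rounds, s.1 ∈ U :=
    dijkstra_induction (p := fun s => s.1 ∈ U) ht (fun s _ a ha _ => hA a ha) rounds
  have hnd := dijkstra_nodup (A := A) (t := t) rounds
  rw [dijkstra_eq] at *
  have key : ∀ i, extensions A ((dijkstraStep A)^[i] [(t, [])]) = [] ∨
      ((dijkstraStep A)^[i] [(t, [])]).length = i + 1 := by
    intro i
    induction i with
    | zero => exact .inr rfl
    | succ i ih =>
      rw [Function.iterate_succ_apply']
      rcases dijkstraStep_eq A ((dijkstraStep A)^[i] [(t, [])]) with ⟨h1, h2⟩ | ⟨c, hc, _, h2⟩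
      · rw [h2]; exact .inl h1
      · rw [h2]
        right
        rcases ih with ih | ih
        · rw [ih] at hc; simp at hc
        · rw [List.length_cons, ih]
  have hdone : extensions A ((dijkstraStep A)^[rounds.length] [(t, [])]) = [] := by
    refine (key rounds.length).resolve_right fun hlen => ?_
    have h1 := List.toFinset_card_of_nodup hnd
    have h2 : (((dijkstraStep A)^[rounds.length] [(t, [])]).map Prod.fst).toFinset ⊆ U := by
      intro x hx
      rw [List.mem_toFinset, List.mem_map] at hx
      obtain ⟨s, hs, rfl⟩ := hx
      exact hsub s hs
    have h3 := Finset.card_le_card h2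
    rw [h1, List.length_map, hlen] at h3
    omega
  intro s hs a ha has
  refine ((DijkstraInv.iterate A t _).step s hs a ha has).resolve_right fun h => ?_
  have := mem_extensions.2 ⟨s, hs, a, ha, has, h.1, rfl⟩
  rw [hdone] at this
  simp at this

end Dijkstra

section

variable {X : Type} [Ctx X]

theorem PolyTime.costOf {p : X → List Edge} (hp : PolyTime p) :
    PolyTime (fun x => costOf (p x)) :=
  (hp.map (F := fun _ (e : Edge) => e.2.2.1) PolyTime.var.snd.snd.fst).sum

theorem PolyTime.extensions {A : X → List (ℕ × ℕ × List Edge)} {S : X → List (ℕ × List Edge)}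
    (hA : PolyTime A) (hS : PolyTime S) : PolyTime (fun x => extensions (A x) (S x)) :=
  hS.flatMap (F := fun x (s : ℕ × List Edge) => ((A x).filter fun a => decide (a.1 = s.1) &&
      !decide (a.2.1 ∈ (S x).map Prod.fst)).map fun a => (a.2.1, s.2 ++ a.2.2))
    (((hA.weaken).filter (c := fun (x : X × (ℕ × List Edge)) (a : ℕ × ℕ × List Edge) => decide (a.1 = x.2.1) &&
        !decide (a.2.1 ∈ (S x.1).map Prod.fst))
      ((PolyTime.var.fst.eq PolyTime.var.weaken.fst).and
        (PolyTime.var.snd.fst.mem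
          (hS.weaken.weaken.map (F := fun _ (s : ℕ × List Edge) => s.1) PolyTime.var.fst)).not)).map
      (F := fun (x : X × (ℕ × List Edge)) (a : ℕ × ℕ × List Edge) => (a.2.1, x.2.2 ++ a.2.2))
      (PolyTime.var.snd.fst.pair (PolyTime.var.weaken.snd.append PolyTime.var.snd.snd)))

theorem PolyTime.dijkstraStep {A : X → List (ℕ × ℕ × List Edge)} {S : X → List (ℕ × List Edge)}
    (hA : PolyTime A) (hS : PolyTime S) : PolyTime (fun x => dijkstraStep (A x) (S x)) :=
  ((hA.extensions hS).minBy
    (le := fun _ (a b : ℕ × List Edge) => decide (_root_.costOf a.2 ≤ _root_.costOf b.2))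
    (PolyTime.var.weaken.snd.costOf.le PolyTime.var.snd.costOf)).append hS

theorem size_dijkstra_le (A : List (ℕ × ℕ × List Edge)) (t : ℕ) (rounds : List ℕ) {B : ℕ}
    (hB : (enc A).size ≤ B) (ht : (enc t).size ≤ B) :
    (enc (dijkstra A t rounds)).size ≤
      (rounds.length + 1) * (B + ((rounds.length) * B + 1) + 1 + 1) + 1 := by
  rw [dijkstra_eq]
  generalize rounds.length = r
  have key : ∀ i, ((_root_.dijkstraStep A)^[i] [(t, [])]).length ≤ i + 1 ∧
      ∀ s ∈ (_root_.dijkstraStep A)^[i] [(t, [])], (enc s.1).size ≤ B ∧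
        (enc s.2).size ≤ i * B + 1 := by
    intro i
    induction i with
    | zero => simpa [size_nil] using ht
    | succ i ih =>
      rw [Function.iterate_succ_apply']
      have e : (i + 1) * B = i * B + B := by ring
      rcases dijkstraStep_eq A ((_root_.dijkstraStep A)^[i] [(t, [])])
        with ⟨_, h2⟩ | ⟨c, hc, _, h2⟩
      · rw [h2, e]
        refine ⟨by omega, fun s hs => ?_⟩
        have := ih.2 s hs
        omega
      · rw [h2, e, List.length_cons]
        refine ⟨by omega, fun s hs => ?_⟩
        rcases List.mem_cons.1 hs with rfl | hs
        · obtain ⟨s₀, hs₀, a₀, ha₀, _, _, rfl⟩ := mem_extensions.1 hc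
          have h3 := size_mem_le ha₀
          have h4 := ih.2 s₀ hs₀
          have h5 := size_append s₀.2 a₀.2.2
          rw [size_prod, size_prod] at h3
          simp only
          omega
        · have := ih.2 s hs
          omega
  have h1 := key r
  refine (size_list_le (B := B + (r * B + 1) + 1) fun s hs => ?_).trans ?_
  · have := h1.2 s hs
    rw [size_prod]; omega
  · gcongr
    exact h1.1

theorem PolyTime.dijkstra {A : X → List (ℕ × ℕ × List Edge)} {t : X → ℕ} {r : X → List ℕ}
    (hA : PolyTime A) (ht : PolyTime t) (hr : PolyTime r) :
    PolyTime (fun x => dijkstra (A x) (t x) (r x)) := by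
  obtain ⟨pA, hpA⟩ := hA.size_le
  obtain ⟨pt, hpt⟩ := ht.size_le
  obtain ⟨pr, hpr⟩ := hr.size_le
  refine PolyTime.foldl (F := fun x S _ => _root_.dijkstraStep (A x) S)
    (hA.weaken.weaken.dijkstraStep PolyTime.var.weaken) hr ((ht.pair PolyTime.nil).cons PolyTime.nil)
    ((pr + 1) * ((pA + pt) + (pr * (pA + pt) + 1) + 1 + 1) + 1) (fun x l' hl' => ?_)
  have h1 := size_dijkstra_le (A x) (t x) l' (B := pA.eval (code x).size + pt.eval (code x).size)
    ((hpA x).trans (Nat.le_add_right _ _)) ((hpt x).trans (Nat.le_add_left _ _))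
  refine h1.trans ?_
  have h2 : l'.length ≤ pr.eval (code x).size :=
    ((length_le_size l').trans (size_sublist hl'.sublist)).trans (hpr x)
  simp only [Polynomial.eval_add, Polynomial.eval_mul, Polynomial.eval_one]
  gcongr

end

/-! ### The encoding of the instance -/

/-- The number of a node: `0` for the root and `v + 1` for `v : Fin n`. -/
def nodeNum {n : ℕ} : Option (Fin n) → ℕ
  | none => 0
  | some v => v.val + 1

/-- The node with a given number; numbers out of range stand for the root. -/
def toNode (n x : ℕ) : Option (Fin n) :=
  if h : 1 ≤ x ∧ x ≤ n then some ⟨x - 1, by omega⟩ else none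

/-- The arc between the nodes with two given numbers. -/
def toArc (n : ℕ) (a : ℕ × ℕ) : Arc n := (toNode n a.1, toNode n a.2)

/-- The characteristic vector of a set. -/
def bits {n : ℕ} (A : Finset (Fin n)) : List Bool := (List.finRange n).map (fun v => decide (v ∈ A))

/-- The numbers of the nodes of a set. -/
def numSet {n : ℕ} (A : Finset (Fin n)) : Finset ℕ := A.image (fun v => v.val + 1)

/-- The numbers of the nodes at which a characteristic vector is true. -/
def positions (l : List Bool) : List ℕ := (l.zipIdx.filter (fun q => q.1)).map (fun q => q.2 + 1)

section
variable {n : ℕ}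

theorem encodeNode_eq (x : Option (Fin n)) : encodeNode x = enc (nodeNum x) := by
  cases x <;> rfl

theorem encodeArc_eq (a : Arc n) : encodeArc a = enc (nodeNum a.1, nodeNum a.2) := by
  rw [encodeArc, encodeNode_eq, encodeNode_eq]; rfl

theorem encodeSet_eq (A : Finset (Fin n)) : encodeSet A = enc (bits A) := by
  simp only [encodeSet, bits, enc, List.map_map]
  rfl

theorem toNode_nodeNum (x : Option (Fin n)) : toNode n (nodeNum x) = x := by
  cases x with
  | none => simp [toNode, nodeNum]
  | some v => simp [toNode, nodeNum]

theorem nodeNum_toNode (x : ℕ) : nodeNum (toNode n x) = if 1 ≤ x ∧ x ≤ n then x else 0 := by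
  rw [toNode]
  split
  · simp only [nodeNum]; omega
  · rfl

theorem mem_numSet {A : Finset (Fin n)} {x : ℕ} : x ∈ numSet A ↔ ∃ v ∈ A, v.val + 1 = x := by
  simp [numSet]

theorem mem_numSet_iff_toNode {A : Finset (Fin n)} {x : ℕ} :
    x ∈ numSet A ↔ ∃ v ∈ A, toNode n x = some v := by
  rw [mem_numSet]
  refine exists_congr fun v => and_congr_right fun _ => ?_
  constructor
  · rintro rfl
    exact toNode_nodeNum (some v)
  · intro h
    have h1 := nodeNum_toNode (n := n) x
    rw [h] at h1
    simp only [nodeNum] at h1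
    split at h1 <;> omega

theorem nodeNum_mem_numSet {A : Finset (Fin n)} {x : Option (Fin n)} :
    nodeNum x ∈ numSet A ↔ ∃ v ∈ A, x = some v := by
  rw [mem_numSet_iff_toNode, toNode_nodeNum]

theorem succ_mem_numSet {A : Finset (Fin n)} {v : Fin n} : v.val + 1 ∈ numSet A ↔ v ∈ A := by
  rw [mem_numSet]
  constructor
  · rintro ⟨w, hw, h⟩
    rwa [← Fin.ext (Nat.succ_injective h)]
  · exact fun h => ⟨v, h, rfl⟩

theorem zero_notMem_numSet (A : Finset (Fin n)) : 0 ∉ numSet A := by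
  rw [mem_numSet]
  rintro ⟨v, _, h⟩
  omega

theorem numSet_injective : Function.Injective (numSet (n := n)) := by
  intro A B h
  ext v
  rw [← succ_mem_numSet, h, succ_mem_numSet]

theorem numSet_subset {A B : Finset (Fin n)} : numSet A ⊆ numSet B ↔ A ⊆ B :=
  ⟨fun h _ hv => succ_mem_numSet.1 (h (succ_mem_numSet.2 hv)),
    fun h => Finset.image_subset_image h⟩

theorem numSet_inter (A B : Finset (Fin n)) : numSet (A ∩ B) = numSet A ∩ numSet B :=
  Finset.image_inter _ _ (fun _ _ h => Fin.ext (Nat.succ_injective h))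

theorem numSet_union (A B : Finset (Fin n)) : numSet (A ∪ B) = numSet A ∪ numSet B :=
  Finset.image_union _ _

theorem toArc_enters {a : ℕ × ℕ} {A : Finset (Fin n)} :
    (toArc n a).Enters A ↔ a.2 ∈ numSet A ∧ a.1 ∉ numSet A := by
  rw [Arc.Enters, mem_numSet_iff_toNode, mem_numSet_iff_toNode]
  rfl

theorem mem_positions_bits {A : Finset (Fin n)} {x : ℕ} : x ∈ positions (bits A) ↔ x ∈ numSet A := by
  simp only [positions, List.mem_map, List.mem_filter, Prod.exists, mem_numSet, bits]
  constructor
  · rintro ⟨b, i, ⟨h1, h2⟩, rfl⟩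
    rw [List.mem_zipIdx_iff_getElem?] at h1
    simp only at h1 h2
    subst h2
    rw [List.getElem?_map, Option.map_eq_some_iff] at h1
    obtain ⟨v, hv, hvA⟩ := h1
    obtain ⟨hi, rfl⟩ := List.getElem?_eq_some_iff.1 hv
    exact ⟨_, by simpa using hvA, by simp⟩
  · rintro ⟨v, hv, rfl⟩
    refine ⟨true, v.val, ⟨?_, rfl⟩, rfl⟩
    rw [List.mem_zipIdx_iff_getElem?]
    simp [hv]

theorem size_bits_le (A : Finset (Fin n)) : (enc (bits A)).size ≤ n * 3 + 1 := by
  have := size_list_le (l := bits A) (B := 2) (fun b _ => size_bool_le b)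
  simpa [bits] using this
end

namespace OracleInstance

variable (E : OracleInstance)

/-- The input of the algorithm before its encoding. -/
def raw : List Bool × List ((ℕ × ℕ) × (ℕ × ℕ)) :=
  (bits E.G.T, (List.finRange E.G.m).map fun e =>
    ((nodeNum (E.G.arc e).1, nodeNum (E.G.arc e).2), ((E.G.c e).num, (E.G.c e).den)))

theorem enc_raw : enc E.raw = E.G.encode := by
  simp only [CoverInstance.encode, encodeSet_eq, encodeArc_eq, raw, enc_prod]
  simp only [enc, List.map_map]
  rfl

/-- The numbers of the nodes other than the root. -/
def nodes : List ℕ := E.raw.1.zipIdx.map (fun q => q.2 + 1)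

/-- The numbers of the terminals. -/
def terminals : List ℕ := positions E.raw.1

/-- The product of the denominators of the costs, by which costs are multiplied to make them
integral. -/
def scale : ℕ := (E.raw.2.map (fun q => q.2.2)).prod

/-- The edges with their scaled costs. -/
def edges : List Edge :=
  E.raw.2.zipIdx.map (fun q => (q.1.1.1, q.1.1.2, q.1.2.1 * (E.scale / q.1.2.2), q.2))

/-- The edge with a given index. -/
def edge (i : Fin E.G.m) : Edge :=
  (nodeNum (E.G.arc i).1, nodeNum (E.G.arc i).2, (E.G.c i).num * (E.scale / (E.G.c i).den), i)

theorem mem_nodes {x : ℕ} : x ∈ E.nodes ↔ 1 ≤ x ∧ x ≤ E.G.n := by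
  simp only [nodes, raw, List.mem_map, Prod.exists]
  constructor
  · rintro ⟨b, i, h, rfl⟩
    have := List.snd_lt_of_mem_zipIdx h
    simp [bits] at this
    omega
  · rintro ⟨h1, h2⟩
    refine ⟨decide (⟨x - 1, by omega⟩ ∈ E.G.T), x - 1, ?_, by omega⟩
    rw [List.mem_zipIdx_iff_getElem?]
    have : x - 1 < E.G.n := by omega
    simp [bits, this]

theorem length_nodes : E.nodes.length = E.G.n := by simp [nodes, raw, bits]

theorem mem_nodes_of_mem_numSet {A : Finset (Fin E.G.n)} {x : ℕ} (h : x ∈ numSet A) :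
    x ∈ E.nodes := by
  obtain ⟨v, _, rfl⟩ := mem_numSet.1 h
  rw [mem_nodes]
  omega

theorem mem_terminals {x : ℕ} : x ∈ E.terminals ↔ x ∈ numSet E.G.T := mem_positions_bits

theorem edges_eq : E.edges = (List.finRange E.G.m).map E.edge := by
  apply List.ext_getElem
  · simp [edges, raw]
  · intro i h1 h2
    simp [edges, raw, edge]

theorem mem_edges {e : Edge} : e ∈ E.edges ↔ ∃ i, E.edge i = e := by
  simp [edges_eq]

theorem length_edges : E.edges.length = E.G.m := by simp [edges_eq]

theorem edge_injective : Function.Injective E.edge := by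
  intro i j h
  have := congrArg (fun e : Edge => e.2.2.2) h
  exact Fin.ext (by simpa [edge] using this)

theorem toArc_edge (i : Fin E.G.m) :
    toArc E.G.n ((E.edge i).1, (E.edge i).2.1) = E.G.arc i := by
  simp [toArc, edge, toNode_nodeNum]

/-! ### The number of cores -/

/-- The number of arcs of a list that enter `A`. -/
def _root_.listDeg {n : ℕ} (L : List (Arc n)) (A : Finset (Fin n)) : ℕ :=
  L.countP (fun a => decide (a.Enters A))

theorem _root_.listDeg_submodular {n : ℕ} (L : List (Arc n)) (A B : Finset (Fin n)) :
    listDeg L (A ∩ B) + listDeg L (A ∪ B) ≤ listDeg L A + listDeg L B := by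
  induction L with
  | nil => simp [listDeg]
  | cons a L ih =>
    simp only [listDeg, List.countP_cons, decide_eq_true_eq] at ih ⊢
    have key : (if a.Enters (A ∩ B) then 1 else 0) + (if a.Enters (A ∪ B) then 1 else 0) ≤
        (if a.Enters A then 1 else 0) + (if a.Enters B then 1 else 0) := by
      obtain ⟨x, y⟩ := a
      have e : ∀ (z : Option (Fin n)) (C D : Finset (Fin n)), (∃ v ∈ C ∩ D, z = some v) ↔
          (∃ v ∈ C, z = some v) ∧ ∃ v ∈ D, z = some v := by
        intro z C D; cases z <;> simp
      have e' : ∀ (z : Option (Fin n)) (C D : Finset (Fin n)), (∃ v ∈ C ∪ D, z = some v) ↔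
          (∃ v ∈ C, z = some v) ∨ ∃ v ∈ D, z = some v := by
        intro z C D; cases z <;> simp
      simp only [Arc.Enters, e, e']
      by_cases h1 : ∃ v ∈ A, x = some v <;> by_cases h2 : ∃ v ∈ B, x = some v <;>
        by_cases h3 : ∃ v ∈ A, y = some v <;> by_cases h4 : ∃ v ∈ B, y = some v <;>
        simp [h1, h2, h3, h4]
    omega

theorem le_maxVal {n : ℕ} (g : Finset (Fin n) → ℤ) (A : Finset (Fin n)) : g A ≤ maxVal g :=
  Finset.le_sup' g (Finset.mem_univ A)

theorem exists_eq_maxVal {n : ℕ} (g : Finset (Fin n) → ℤ) : ∃ A, g A = maxVal g := by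
  obtain ⟨A, -, hA⟩ := Finset.exists_mem_eq_sup' (Finset.univ_nonempty) g
  exact ⟨A, hA.symm⟩

theorem mem_maxFamily {n : ℕ} {g : Finset (Fin n) → ℤ} {A : Finset (Fin n)} :
    A ∈ maxFamily g ↔ g A = maxVal g := by simp [maxFamily]

theorem mem_cores {n : ℕ} {F : Finset (Finset (Fin n))} {A : Finset (Fin n)} :
    A ∈ cores F ↔ A ∈ F ∧ ∀ B ∈ F, B ⊆ A → B = A := by simp [cores]

theorem residualFun_eq (L : List (Arc E.G.n)) (A : Finset (Fin E.G.n)) :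
    residualFun E.f L A = max (E.f A - listDeg L A) 0 := rfl

theorem residualFun_supermodular (L : List (Arc E.G.n)) {A B : Finset (Fin E.G.n)} {v : Fin E.G.n}
    (hv : v ∈ E.G.T) (hA : v ∈ A) (hB : v ∈ B) (hA0 : 0 < residualFun E.f L A)
    (hB0 : 0 < residualFun E.f L B) : residualFun E.f L A + residualFun E.f L B ≤
      residualFun E.f L (A ∩ B) + residualFun E.f L (A ∪ B) := by
  simp only [residualFun_eq] at *
  have h1 := listDeg_submodular L A B
  have h2 := E.supermodular A B ⟨v, by simp [hv, hA, hB]⟩ (by omega) (by omega)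
  zify at h1
  omega

theorem inter_mem_maxFamily (L : List (Arc E.G.n)) {A B : Finset (Fin E.G.n)} {v : Fin E.G.n}
    (hv : v ∈ E.G.T) (hA : v ∈ A) (hB : v ∈ B) (h0 : 0 < maxVal (residualFun E.f L))
    (hA' : A ∈ maxFamily (residualFun E.f L)) (hB' : B ∈ maxFamily (residualFun E.f L)) :
    A ∩ B ∈ maxFamily (residualFun E.f L) ∧ A ∪ B ∈ maxFamily (residualFun E.f L) := by
  simp only [mem_maxFamily] at *
  have h1 := E.residualFun_supermodular L hv hA hB (by omega) (by omega)
  have h2 := le_maxVal (residualFun E.f L) (A ∩ B)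
  have h3 := le_maxVal (residualFun E.f L) (A ∪ B)
  omega

theorem f_empty : E.f ∅ ≤ 0 := by
  by_contra h
  obtain ⟨v, hv⟩ := E.terminal ∅ (by omega)
  simp at hv

theorem residualFun_empty (L : List (Arc E.G.n)) : residualFun E.f L ∅ = 0 := by
  have := E.f_empty
  rw [residualFun_eq]
  omega

theorem cores_of_maxVal_residualFun_eq_zero {L : List (Arc E.G.n)}
    (h : maxVal (residualFun E.f L) = 0) : cores (maxFamily (residualFun E.f L)) = {∅} := by
  have h0 : ∅ ∈ maxFamily (residualFun E.f L) := by
    rw [mem_maxFamily, h, residualFun_empty]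
  ext A
  rw [mem_cores, Finset.mem_singleton]
  constructor
  · rintro ⟨_, h2⟩
    exact (h2 ∅ h0 (Finset.empty_subset _)).symm
  · rintro rfl
    exact ⟨h0, fun B _ hB => Finset.subset_empty.1 hB⟩

theorem card_cores_le (L : List (Arc E.G.n)) :
    (cores (maxFamily (residualFun E.f L))).card ≤ E.G.n + 1 := by
  have hnn : 0 ≤ maxVal (residualFun E.f L) :=
    (E.residualFun_empty L).symm.le.trans (le_maxVal _ _)
  rcases hnn.eq_or_lt with h0 | h0
  · rw [E.cores_of_maxVal_residualFun_eq_zero h0.symm]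
    simp
  have hpos : ∀ A ∈ cores (maxFamily (residualFun E.f L)), ∃ v, v ∈ E.G.T ∧ v ∈ A := by
    intro A hA
    have h1 := mem_maxFamily.1 (mem_cores.1 hA).1
    rw [residualFun_eq] at h1
    obtain ⟨v, hv⟩ := E.terminal A (by omega)
    rw [Finset.mem_inter] at hv
    exact ⟨v, hv.2, hv.1⟩
  rcases Nat.eq_zero_or_pos E.G.n with hn | hn
  · have : (Finset.univ : Finset (Finset (Fin E.G.n))).card = 1 := by simp [hn]
    have := Finset.card_le_univ (cores (maxFamily (residualFun E.f L)))
    simp only [Finset.card_univ] at *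
    omega
  have : Nonempty (Fin E.G.n) := ⟨⟨0, hn⟩⟩
  choose! v hv hvA using hpos
  have h1 : (cores (maxFamily (residualFun E.f L))).card ≤ (Finset.univ : Finset (Fin E.G.n)).card := by
    refine Finset.card_le_card_of_injOn v (fun _ _ => Finset.mem_coe.2 (Finset.mem_univ _)) ?_
    intro A hA B hB h
    have hA' := mem_cores.1 hA
    have hB' := mem_cores.1 hB
    have h2 := (E.inter_mem_maxFamily L (hv A hA) (hvA A hA) (by rw [h]; exact hvA B hB) h0
      hA'.1 hB'.1).1
    rw [← hA'.2 _ h2 Finset.inter_subset_left, hB'.2 _ h2 Finset.inter_subset_right]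
  simp only [Finset.card_univ, Fintype.card_fin] at h1
  omega

/-! ### Oracle queries -/

/-- The oracle's answer to the list `L` of arcs. -/
noncomputable def ask (L : List (Arc E.G.n)) : List (Finset (Fin E.G.n)) :=
  (E.coreOracle L).choose

theorem mem_ask {L : List (Arc E.G.n)} {C : Finset (Fin E.G.n)} :
    C ∈ E.ask L ↔ C ∈ cores (maxFamily (residualFun E.f L)) :=
  (E.coreOracle L).choose_spec.2.1 C

theorem oracle_ask (L : List (Arc E.G.n)) :
    E.O (Data.ofList (L.map encodeArc)) = enc ((E.ask L).map bits) := by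
  rw [(E.coreOracle L).choose_spec.2.2]
  simp only [enc, List.map_map]
  congr 1
  refine List.map_congr_left fun A _ => ?_
  exact encodeSet_eq A

theorem length_ask_le (L : List (Arc E.G.n)) : (E.ask L).length ≤ E.G.n + 1 := by
  have h1 := List.toFinset_card_of_nodup (E.coreOracle L).choose_spec.1
  have h2 : (E.ask L).toFinset ⊆ cores (maxFamily (residualFun E.f L)) := by
    intro C hC
    rwa [List.mem_toFinset, mem_ask] at hC
  have h3 := Finset.card_le_card h2
  have h4 := E.card_cores_le L
  rw [ask] at *
  omega

/-- The oracle's answer, with arcs given by numbers and sets by their characteristic vectors. -/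
noncomputable def askBits (L : List (ℕ × ℕ)) : List (List Bool) :=
  (E.ask (L.map (toArc E.G.n))).map bits

end OracleInstance

section
variable {X : Type} [Ctx X]

theorem PolyTime.raw : PolyTime (fun x : X => (Ctx.inst x).raw) := by
  refine PolyTime.subst (Y := OracleInstance) (F := fun E => E.raw) ?_ PolyMap.inst
  refine ⟨.prim .id, 2 * Polynomial.X, fun E => ?_⟩
  rw [E.enc_raw]
  exact (Program.RunsIn.prim .id _).mono (by simp [Prim.apply, code]; omega)

theorem PolyTime.nodes : PolyTime (fun x : X => (Ctx.inst x).nodes) :=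
  PolyTime.raw.fst.zipIdx.map (F := fun _ (q : Bool × ℕ) => q.2 + 1)
    (PolyTime.var.snd.add (PolyTime.const 1))

theorem PolyTime.positions {l : X → List Bool} (hl : PolyTime l) :
    PolyTime (fun x => positions (l x)) :=
  (hl.zipIdx.filter (c := fun _ (q : Bool × ℕ) => q.1) PolyTime.var.fst).map
    (F := fun _ (q : Bool × ℕ) => q.2 + 1) (PolyTime.var.snd.add (PolyTime.const 1))

theorem PolyTime.terminals : PolyTime (fun x : X => (Ctx.inst x).terminals) :=
  PolyTime.raw.fst.positions

theorem PolyTime.scale : PolyTime (fun x : X => (Ctx.inst x).scale) :=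
  (PolyTime.raw.snd.map (F := fun _ (q : (ℕ × ℕ) × (ℕ × ℕ)) => q.2.2) PolyTime.var.snd.snd).prod

theorem PolyTime.edges : PolyTime (fun x : X => (Ctx.inst x).edges) :=
  PolyTime.raw.snd.zipIdx.map
    (F := fun x (q : ((ℕ × ℕ) × (ℕ × ℕ)) × ℕ) =>
      (q.1.1.1, q.1.1.2, q.1.2.1 * ((Ctx.inst x).scale / q.1.2.2), q.2))
    (PolyTime.var.fst.fst.fst.pair (PolyTime.var.fst.fst.snd.pair
      ((PolyTime.var.fst.snd.fst.mul (PolyTime.scale.div PolyTime.var.fst.snd.snd)).pair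
        PolyTime.var.snd)))

/-- Numbers that do not belong to a node are replaced by the root, so that every query is a valid
one and its answer has polynomial size. -/
theorem PolyTime.askBits {L : X → List (ℕ × ℕ)} (hL : PolyTime L) :
    PolyTime (fun x => (Ctx.inst x).askBits (L x)) := by
  have h : PolyTime (fun x => (L x).map (fun a : ℕ × ℕ =>
      ((if decide (a.1 ∈ (Ctx.inst x).nodes) then a.1 else 0),
        (if decide (a.2 ∈ (Ctx.inst x).nodes) then a.2 else 0)))) :=
    hL.map (F := fun x (a : ℕ × ℕ) => ((if decide (a.1 ∈ (Ctx.inst x).nodes) then a.1 else 0),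
        (if decide (a.2 ∈ (Ctx.inst x).nodes) then a.2 else 0)))
      (((PolyTime.var.fst.mem PolyTime.nodes).ite PolyTime.var.fst (PolyTime.const 0)).pair
        ((PolyTime.var.snd.mem PolyTime.nodes).ite PolyTime.var.snd (PolyTime.const 0)))
  obtain ⟨r, hr⟩ := (PolyTime.nodes (X := X)).size_le
  obtain ⟨P, p, hP⟩ := h
  refine ⟨.comp .oracle P, p + (p + ((r + 1) * (r * 3 + 1 + 1) + 1)) + 1, fun x => ?_⟩
  have hn : (Ctx.inst x).G.n ≤ r.eval (code x).size := by
    rw [← (Ctx.inst x).length_nodes]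
    exact (length_le_size _).trans (hr x)
  set E := Ctx.inst x
  have e : enc ((L x).map (fun a : ℕ × ℕ => ((if decide (a.1 ∈ E.nodes) then a.1 else 0),
        (if decide (a.2 ∈ E.nodes) then a.2 else 0)))) =
      Data.ofList (((L x).map (toArc E.G.n)).map encodeArc) := by
    simp only [enc, List.map_map]
    congr 1
    refine List.map_congr_left fun a _ => ?_
    simp only [Function.comp_apply, encodeArc_eq, toArc, nodeNum_toNode, decide_eq_true_eq,
      OracleInstance.mem_nodes]
    rfl
  have h1 := hP x
  rw [e] at h1
  have h2 : Program.oracle.RunsIn E.O (Data.ofList (((L x).map (toArc E.G.n)).map encodeArc))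
      (enc (E.askBits (L x))) _ := ⟨_, le_rfl, by
    rw [OracleInstance.askBits, ← E.oracle_ask]
    exact .oracle _⟩
  refine (h1.comp h2).mono ?_
  rw [E.oracle_ask]
  have h3 : (enc ((E.ask ((L x).map (toArc E.G.n))).map bits)).size ≤
      (r.eval (code x).size + 1) * (r.eval (code x).size * 3 + 1 + 1) + 1 := by
    refine (size_list_le (B := r.eval (code x).size * 3 + 1) fun b hb => ?_).trans ?_
    · obtain ⟨A, _, rfl⟩ := List.mem_map.1 hb
      have := size_bits_le A
      omega
    · rw [List.length_map]
      gcongr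
      exact (E.length_ask_le _).trans (by omega)
  have h4 := h1.size_le.2
  simp only [Polynomial.eval_add, Polynomial.eval_mul, Polynomial.eval_one, Polynomial.eval_ofNat]
  omega
end

namespace OracleInstance

variable (E : OracleInstance)

/-! ### Constrained minimal sets -/

/-- The arcs of the query for a minimal set `A` with `t, y ∈ A` and no element of `forb` in `A`. The
arcs of `I` are taken into account, `f` is lowered by `|K|` on the sets that contain `t`, and sets
that violate a constraint are entered by so many arcs that they become irrelevant. -/
def queryArcs (I K : List Edge) (t y : ℕ) (forb : List ℕ) : List (ℕ × ℕ) :=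
  I.map (fun e => (e.1, e.2.1)) ++ (K.map (fun _ => (0, t)) ++
    E.edges.flatMap (fun _ => E.nodes.map (fun v => (t, v)) ++
      (y, t) :: forb.map (fun s => (0, s))))

/-- The nodes of the first set in the answer to the query. -/
noncomputable def query (I K : List Edge) (t y : ℕ) (forb : List ℕ) : List ℕ :=
  positions ((E.askBits (E.queryArcs I K t y forb)).headD [])

/-- The number of edges of the list `I` that enter `A`. -/
def edgeDeg (I : List Edge) (A : Finset (Fin E.G.n)) : ℕ :=
  listDeg (I.map (fun e => toArc E.G.n (e.1, e.2.1))) A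

/-- The sets over which the query minimizes. -/
def Feasible (I : List Edge) (j t y : ℕ) (forb : List ℕ) (A : Finset (Fin E.G.n)) : Prop :=
  (j : ℤ) < E.f A - E.edgeDeg I A ∧ t ∈ numSet A ∧ y ∈ numSet A ∧ ∀ s ∈ forb, s ∉ numSet A

theorem edgeDeg_eq_zero {I : List Edge} {A : Finset (Fin E.G.n)} :
    E.edgeDeg I A = 0 ↔ ∀ e ∈ I, e.2.1 ∈ numSet A → e.1 ∈ numSet A := by
  simp only [edgeDeg, listDeg, List.countP_eq_zero, List.mem_map, decide_eq_true_eq,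
    forall_exists_index, and_imp, forall_apply_eq_imp_iff₂, toArc_enters, not_and, not_not]

theorem f_le_length_edges (A : Finset (Fin E.G.n)) : E.f A ≤ E.edges.length := by
  obtain ⟨J, hJ⟩ := E.coverable
  refine (hJ A).trans ?_
  rw [length_edges]
  have h1 := Finset.card_filter_le J (fun e => (E.G.arc e).Enters A)
  have h2 := J.card_le_univ
  rw [Fintype.card_fin] at h2
  rw [CoverInstance.inDeg]
  exact_mod_cast h1.trans h2

theorem exists_terminal {A : Finset (Fin E.G.n)} (h : 0 < E.f A) :
    ∃ t ∈ E.terminals, t ∈ numSet A := by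
  obtain ⟨v, hv⟩ := E.terminal A h
  rw [Finset.mem_inter] at hv
  exact ⟨v.val + 1, E.mem_terminals.2 (succ_mem_numSet.2 hv.2), succ_mem_numSet.2 hv.1⟩

section
variable {I K : List Edge} {t y : ℕ} {forb : List ℕ}

theorem listDeg_queryArcs (A : Finset (Fin E.G.n)) :
    listDeg ((E.queryArcs I K t y forb).map (toArc E.G.n)) A =
      E.edgeDeg I A + (K.length * (if t ∈ numSet A then 1 else 0) + E.edges.length *
        listDeg ((E.nodes.map (fun v => (t, v)) ++
          (y, t) :: forb.map (fun s => (0, s))).map (toArc E.G.n)) A) := by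
  have h1 : listDeg ((K.map (fun _ => (0, t))).map (toArc E.G.n)) A =
      K.length * (if t ∈ numSet A then 1 else 0) := by
    induction K with
    | nil => simp [listDeg]
    | cons e K ih =>
      simp only [listDeg, List.map_cons, List.countP_cons, decide_eq_true_eq, toArc_enters,
        List.length_cons, zero_notMem_numSet, not_false_eq_true, and_true] at ih ⊢
      rw [ih]; ring
  have h2 : ∀ (l : List Edge) (c : List (ℕ × ℕ)),
      listDeg ((l.flatMap (fun _ => c)).map (toArc E.G.n)) A =
        l.length * listDeg (c.map (toArc E.G.n)) A := by
    intro l c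
    induction l with
    | nil => simp [listDeg]
    | cons e l ih =>
      simp only [listDeg, List.flatMap_cons, List.map_append, List.countP_append,
        List.length_cons] at ih ⊢
      rw [ih]; ring
  rw [queryArcs, List.map_append, List.map_append]
  rw [← h1, ← h2]
  simp only [listDeg, List.countP_append, edgeDeg, List.map_map]
  rfl

/-- The residual function of the query is positive exactly on the feasible sets. -/
theorem residualFun_queryArcs (A : Finset (Fin E.G.n)) :
    (E.Feasible I K.length t y forb A ∧ residualFun E.f ((E.queryArcs I K t y forb).map
      (toArc E.G.n)) A = E.f A - E.edgeDeg I A - K.length) ∨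
    (¬ E.Feasible I K.length t y forb A ∧
      residualFun E.f ((E.queryArcs I K t y forb).map (toArc E.G.n)) A = 0) := by
  rw [residualFun_eq, listDeg_queryArcs]
  set c := listDeg ((E.nodes.map (fun v => (t, v)) ++
          (y, t) :: forb.map (fun s => (0, s))).map (toArc E.G.n)) A with hc
  have hc0 : c = 0 ↔ (t ∉ numSet A → A = ∅) ∧ (t ∈ numSet A → y ∈ numSet A) ∧
      ∀ s ∈ forb, s ∉ numSet A := by
    rw [hc]
    simp only [listDeg, List.countP_eq_zero, List.mem_map, List.mem_append, List.mem_cons,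
      decide_eq_true_eq, forall_exists_index, and_imp, forall_apply_eq_imp_iff₂, toArc_enters,
      or_imp, forall_and, zero_notMem_numSet, not_false_eq_true, and_true, not_and,
      not_not]
    rw [← and_assoc, ← and_assoc]
    refine and_congr_left fun _ => and_congr ?_ ⟨fun h => h _ rfl, by rintro h _ rfl; exact h⟩
    constructor
    · intro h ht
      by_contra hA
      obtain ⟨v, hv⟩ := Finset.nonempty_iff_ne_empty.2 hA
      exact ht (h _ (E.mem_nodes_of_mem_numSet (succ_mem_numSet.2 hv)) (succ_mem_numSet.2 hv))
    · intro h v _ hv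
      by_contra ht
      rw [h ht] at hv
      simp [numSet] at hv
  have hfm := E.f_le_length_edges A
  have hf0 := E.f_empty
  by_cases hF : E.Feasible I K.length t y forb A
  · left
    refine ⟨hF, ?_⟩
    obtain ⟨h1, h2, h3, h4⟩ := hF
    have : c = 0 := hc0.2 ⟨fun h => absurd h2 h, fun _ => h3, h4⟩
    rw [this, if_pos h2]
    push_cast
    omega
  · right
    refine ⟨hF, ?_⟩
    by_cases hc1 : c = 0
    · obtain ⟨h2, h3, h4⟩ := hc0.1 hc1
      by_cases ht : t ∈ numSet A
      · have : ¬ ((K.length : ℤ) < E.f A - E.edgeDeg I A) := fun h => hF ⟨h, ht, h3 ht, h4⟩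
        rw [hc1, if_pos ht]
        push_cast
        omega
      · rw [h2 ht] at hfm ⊢
        push_cast
        have : 0 ≤ (E.edges.length * c : ℤ) := by positivity
        have : 0 ≤ (K.length : ℤ) * (if t ∈ numSet (∅ : Finset (Fin E.G.n)) then 1 else 0) := by
          split <;> simp
        omega
    · have h1 : E.edges.length ≤ E.edges.length * c :=
        Nat.le_mul_of_pos_right _ (Nat.pos_of_ne_zero hc1)
      zify at h1
      push_cast
      have : 0 ≤ (K.length : ℤ) * (if t ∈ numSet A then 1 else 0) := by
          split <;> simp
      omega

theorem query_spec (ht : t ∈ E.terminals) :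
    (E.query I K t y forb = [] ∧ ∀ A, ¬ E.Feasible I K.length t y forb A) ∨
    ∃ A, E.Feasible I K.length t y forb A ∧ (∀ x, x ∈ E.query I K t y forb ↔ x ∈ numSet A) ∧
      ((∀ B, E.f B ≤ K.length + 1) → ∀ B, E.Feasible I K.length t y forb B → A ⊆ B) := by
  set L := (E.queryArcs I K t y forb).map (toArc E.G.n) with hL
  have hres := E.residualFun_queryArcs (I := I) (K := K) (t := t) (y := y) (forb := forb)
  rw [← hL] at hres
  have hq : E.query I K t y forb = positions (((E.ask L).map bits).headD []) := rfl
  by_cases hex : ∃ A, E.Feasible I K.length t y forb A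
  · right
    obtain ⟨B, hB⟩ := hex
    have hpos : ∀ B, E.Feasible I K.length t y forb B → 0 < residualFun E.f L B := by
      intro B hB
      rcases hres B with ⟨_, h⟩ | ⟨h, _⟩
      · rw [h]
        have := hB.1
        omega
      · exact absurd hB h
    have hmax : 0 < maxVal (residualFun E.f L) := (hpos B hB).trans_le (le_maxVal _ _)
    -- the maximal family has a core, so the answer is not empty
    obtain ⟨C, hC⟩ : ∃ C, C ∈ cores (maxFamily (residualFun E.f L)) := by
      obtain ⟨C, hC⟩ := exists_eq_maxVal (residualFun E.f L)
      obtain ⟨D, hD, hmin⟩ := WellFounded.has_min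
        (measure (Finset.card (α := Fin E.G.n))).wf {A | A ∈ maxFamily (residualFun E.f L)}
        ⟨C, mem_maxFamily.2 hC⟩
      exact ⟨D, mem_cores.2 ⟨hD, fun A hA hAD =>
        Finset.eq_of_subset_of_card_le hAD (not_lt.1 (hmin A hA))⟩⟩
    rw [← mem_ask] at hC
    cases hl : E.ask L with
    | nil => rw [hl] at hC; simp at hC
    | cons A l =>
      have hA : A ∈ cores (maxFamily (residualFun E.f L)) := by
        rw [← mem_ask, hl]; exact List.mem_cons_self
      have hA' := mem_cores.1 hA
      have hAF : E.Feasible I K.length t y forb A := by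
        have h1 := mem_maxFamily.1 hA'.1
        rcases hres A with ⟨h, _⟩ | ⟨_, h⟩
        · exact h
        · omega
      refine ⟨A, hAF, fun x => ?_, fun hf B hB => ?_⟩
      · rw [hq, hl, List.map_cons, List.headD_cons, mem_positions_bits]
      · obtain ⟨v, hv, hvt⟩ := mem_numSet.1 (E.mem_terminals.1 ht)
        have hvA : v ∈ A := succ_mem_numSet.1 (by rw [hvt]; exact hAF.2.1)
        have hvB : v ∈ B := succ_mem_numSet.1 (by rw [hvt]; exact hB.2.1)
        have hBmax : B ∈ maxFamily (residualFun E.f L) := by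
          rw [mem_maxFamily]
          refine le_antisymm (le_maxVal _ _) ?_
          rw [← mem_maxFamily.1 hA'.1]
          have h1 := hpos B hB
          have h2 := hf A
          rcases hres A with ⟨_, h⟩ | ⟨h, _⟩
          · rw [h]; omega
          · exact absurd hAF h
        have h3 := (E.inter_mem_maxFamily L hv hvA hvB hmax hA'.1 hBmax).1
        rw [← hA'.2 _ h3 Finset.inter_subset_left]
        exact Finset.inter_subset_right
  · left
    push Not at hex
    refine ⟨?_, hex⟩
    have h0 : maxVal (residualFun E.f L) = 0 := by
      obtain ⟨A, hA⟩ := exists_eq_maxVal (residualFun E.f L)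
      rw [← hA]
      exact ((hres A).resolve_left fun h => hex A h.1).2
    rw [List.eq_nil_iff_forall_not_mem]
    intro x hx
    cases hl : E.ask L with
    | nil => rw [hq, hl] at hx; simp [positions] at hx
    | cons A l =>
      have hA : A ∈ cores (maxFamily (residualFun E.f L)) := by
        rw [← mem_ask, hl]; exact List.mem_cons_self
      rw [E.cores_of_maxVal_residualFun_eq_zero h0, Finset.mem_singleton] at hA
      rw [hq, hl, List.map_cons, List.headD_cons, mem_positions_bits, hA] at hx
      simp [numSet] at hx

theorem query_eq_nil_iff (ht : t ∈ E.terminals) :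
    E.query I K t y forb = [] ↔ ∀ A, ¬ E.Feasible I K.length t y forb A := by
  rcases E.query_spec (I := I) (K := K) (y := y) (forb := forb) ht with h | ⟨A, hA, h, _⟩
  · exact iff_of_true h.1 h.2
  · refine iff_of_false (fun h0 => ?_) (fun h0 => h0 A hA)
    have := (h t).2 hA.2.1
    rw [h0] at this
    simp at this

end

/-! ### The maximum value -/

/-- Some set has a value greater than `|K|`. -/
noncomputable def exceeds (K : List Edge) : Bool :=
  E.terminals.any (fun t => !(E.query [] K t t []).isEmpty)

theorem exceeds_iff {K : List Edge} : E.exceeds K = true ↔ (K.length : ℤ) < maxVal E.f := by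
  have hdeg : ∀ A, E.edgeDeg [] A = 0 := fun A => rfl
  simp only [exceeds, List.any_eq_true, Bool.not_eq_true', List.isEmpty_eq_false_iff]
  constructor
  · rintro ⟨t, ht, h⟩
    rw [Ne, E.query_eq_nil_iff ht] at h
    push Not at h
    obtain ⟨A, hA⟩ := h
    have h1 := hA.1
    rw [hdeg] at h1
    have := le_maxVal E.f A
    omega
  · intro h
    obtain ⟨A, hA⟩ := exists_eq_maxVal E.f
    obtain ⟨t, ht, htA⟩ := E.exists_terminal (A := A) (by omega)
    refine ⟨t, ht, ?_⟩
    rw [Ne, E.query_eq_nil_iff ht]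
    push Not
    refine ⟨A, ?_, htA, htA, by simp⟩
    rw [hdeg]
    omega

/-- A list of length `k_f - 1`. -/
noncomputable def level : List Edge :=
  E.edges.foldl (fun K e => if E.exceeds (e :: K) then e :: K else K) []

theorem level_sublist (l : List Edge) :
    (l.foldl (fun K e => if E.exceeds (e :: K) then e :: K else K) []).reverse.Sublist l := by
  induction l using List.reverseRecOn with
  | nil => exact List.Sublist.slnil
  | append_singleton l e ih =>
    rw [List.foldl_append, List.foldl_cons, List.foldl_nil]
    split
    · rw [List.reverse_cons]
      exact ih.append (List.Sublist.refl _)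
    · exact ih.trans (List.sublist_append_left _ _)

theorem length_level : (E.level.length : ℤ) + 1 = maxVal E.f := by
  have key : ∀ l : List Edge,
      ((l.foldl (fun K e => if E.exceeds (e :: K) then e :: K else K) []).length : ℤ) =
        min (l.length : ℤ) (maxVal E.f - 1) := by
    intro l
    have h1 := E.one_le_maxVal
    induction l using List.reverseRecOn with
    | nil => simp; omega
    | append_singleton l e ih =>
      rw [List.foldl_append, List.foldl_cons, List.foldl_nil]
      split
      · rename_i h
        rw [E.exceeds_iff, List.length_cons] at h
        rw [List.length_cons, List.length_append, List.length_singleton]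
        push_cast at *
        omega
      · rename_i h
        rw [E.exceeds_iff, List.length_cons] at h
        rw [List.length_append, List.length_singleton]
        push_cast at *
        omega
  obtain ⟨A, hA⟩ := exists_eq_maxVal E.f
  have := E.f_le_length_edges A
  rw [level, key]
  omega

/-! ### The residual family -/

/-- The sets of maximum value that are not covered by `I`, as sets of node numbers. -/
def family (I : List Edge) : Set (Finset ℕ) :=
  {B | ∃ A : Finset (Fin E.G.n), B = numSet A ∧ E.f A = maxVal E.f ∧
    ∀ e ∈ I, e.2.1 ∈ B → e.1 ∈ B}

/-- The set of terminals. -/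
def terminalSet : Set ℕ := {x | x ∈ E.terminals}

/-- The least member of `family I` that contains `t` and `y` and no element of `forb`. -/
noncomputable def leastSet (I : List Edge) (t y : ℕ) (forb : List ℕ) : List ℕ :=
  E.query I E.level t y forb

theorem feasible_level_iff {I : List Edge} {t y : ℕ} {forb : List ℕ} {A : Finset (Fin E.G.n)} :
    E.Feasible I E.level.length t y forb A ↔
      numSet A ∈ E.family I ∧ t ∈ numSet A ∧ y ∈ numSet A ∧ ∀ s ∈ forb, s ∉ numSet A := by
  refine and_congr_left fun _ => ?_
  have h1 := E.length_level
  have h2 := le_maxVal E.f A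
  have h3 : numSet A ∈ E.family I ↔ E.f A = maxVal E.f ∧ E.edgeDeg I A = 0 := by
    rw [edgeDeg_eq_zero]
    constructor
    · rintro ⟨B, hB, hf, hI⟩
      rw [numSet_injective hB]
      exact ⟨hf, by rwa [← hB]⟩
    · rintro ⟨hf, hI⟩
      exact ⟨A, rfl, hf, hI⟩
  rw [h3]
  omega

theorem leastSet_spec {I : List Edge} {t y : ℕ} {forb : List ℕ} (ht : t ∈ E.terminals) :
    (E.leastSet I t y forb = [] ∧
      ∀ B ∈ E.family I, t ∈ B → y ∈ B → ∃ s ∈ forb, s ∈ B) ∨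
    ∃ A ∈ E.family I, t ∈ A ∧ y ∈ A ∧ (∀ s ∈ forb, s ∉ A) ∧
      (∀ x, x ∈ E.leastSet I t y forb ↔ x ∈ A) ∧
      ∀ B ∈ E.family I, t ∈ B → y ∈ B → (∀ s ∈ forb, s ∉ B) → A ⊆ B := by
  rcases E.query_spec (I := I) (K := E.level) (y := y) (forb := forb) ht with
    ⟨h1, h2⟩ | ⟨A, hA, h1, h2⟩
  · refine .inl ⟨h1, ?_⟩
    rintro B hBF htB hyB
    obtain ⟨B, rfl, -⟩ := id hBF
    by_contra hcon
    push Not at hcon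
    exact h2 B (E.feasible_level_iff.2 ⟨hBF, htB, hyB, hcon⟩)
  · right
    have hA' := E.feasible_level_iff.1 hA
    refine ⟨numSet A, hA'.1, hA'.2.1, hA'.2.2.1, hA'.2.2.2, h1, ?_⟩
    rintro B hBF htB hyB hforb
    obtain ⟨B, rfl, -⟩ := id hBF
    refine numSet_subset.2 (h2 (fun B => ?_) B (E.feasible_level_iff.2 ⟨hBF, htB, hyB, hforb⟩))
    rw [E.length_level]
    exact le_maxVal _ _

theorem intersectingFamily (I : List Edge) : IntersectingFamily E.terminalSet (E.family I) := by
  have key : ∀ A ∈ E.family I, ∀ B ∈ E.family I, ∀ x ∈ E.terminalSet, x ∈ A → x ∈ B →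
      A ∩ B ∈ E.family I ∧ A ∪ B ∈ E.family I := by
    rintro A ⟨A, rfl, hfA, hA⟩ B ⟨B, rfl, hfB, hB⟩ x hx hxA hxB
    obtain ⟨v, hv, rfl⟩ := mem_numSet.1 (E.mem_terminals.1 hx)
    rw [succ_mem_numSet] at hxA hxB
    have h0 := E.one_le_maxVal
    have h1 := E.supermodular A B ⟨v, by simp [hxA, hxB, hv]⟩ (by omega) (by omega)
    have h2 := le_maxVal E.f (A ∩ B)
    have h3 := le_maxVal E.f (A ∪ B)
    have h4 := listDeg_submodular (I.map (fun e => toArc E.G.n (e.1, e.2.1))) A B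
    have h5 := E.edgeDeg_eq_zero.2 hA
    have h6 := E.edgeDeg_eq_zero.2 hB
    simp only [edgeDeg] at h5 h6
    refine ⟨⟨A ∩ B, (numSet_inter A B).symm, by omega, ?_⟩,
      ⟨A ∪ B, (numSet_union A B).symm, by omega, ?_⟩⟩
    · rw [← numSet_inter, ← edgeDeg_eq_zero, edgeDeg]
      omega
    · rw [← numSet_union, ← edgeDeg_eq_zero, edgeDeg]
      omega
  refine ⟨fun A hA B hB x hx hxA hxB => (key A hA B hB x hx hxA hxB).1,
    fun A hA B hB x hx hxA hxB => (key A hA B hB x hx hxA hxB).2, ?_⟩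
  rintro A ⟨A, rfl, hfA, -⟩
  have h0 := E.one_le_maxVal
  exact E.exists_terminal (by omega)

theorem family_subset_nodes {I : List Edge} : ∀ A ∈ E.family I, A ⊆ E.nodes.toFinset := by
  rintro A ⟨A, rfl, -⟩ x hx
  rw [List.mem_toFinset]
  exact E.mem_nodes_of_mem_numSet hx

end OracleInstance

section
variable {X : Type} [Ctx X]

theorem PolyTime.query {I K : X → List Edge} {t y : X → ℕ} {forb : X → List ℕ} (hI : PolyTime I)
    (hK : PolyTime K) (ht : PolyTime t) (hy : PolyTime y) (hforb : PolyTime forb) :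
    PolyTime (fun x => (Ctx.inst x).query (I x) (K x) (t x) (y x) (forb x)) :=
  PolyTime.positions (PolyTime.headD_nil (PolyTime.askBits
    ((hI.map (F := fun _ (e : Edge) => (e.1, e.2.1)) (PolyTime.var.fst.pair PolyTime.var.snd.fst)).append
      ((hK.map (F := fun x (_ : Edge) => (0, t x)) ((PolyTime.const 0).pair ht.weaken)).append
        (PolyTime.edges.flatMap
          (F := fun x (_ : Edge) => (Ctx.inst x).nodes.map (fun v => (t x, v)) ++
            (y x, t x) :: (forb x).map (fun s => (0, s)))
          ((PolyTime.nodes.map (F := fun (x : X × Edge) v => (t x.1, v))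
            (ht.weaken.weaken.pair PolyTime.var)).append
            ((hy.weaken.pair ht.weaken).cons (hforb.weaken.map (F := fun _ (s : ℕ) => (0, s))
              ((PolyTime.const 0).pair PolyTime.var)))))))))

theorem PolyTime.level : PolyTime (fun x : X => (Ctx.inst x).level) := by
  obtain ⟨p, hp⟩ := (PolyTime.edges (X := X)).size_le
  refine PolyTime.foldl (F := fun x (K : List Edge) e =>
      if (Ctx.inst x).exceeds (e :: K) then e :: K else K) (PolyTime.ite
      (PolyTime.any (X := (X × List Edge) × Edge)
        (c := fun x t => !((Ctx.inst x).query [] (x.2 :: x.1.2) t t []).isEmpty)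
        PolyTime.terminals
        (PolyTime.query PolyTime.nil (PolyTime.var.cons PolyTime.var.weaken).weaken PolyTime.var
          PolyTime.var PolyTime.nil).isEmpty.not)
      (PolyTime.var.cons PolyTime.var.weaken) PolyTime.var.weaken)
    PolyTime.edges PolyTime.nil p (fun x l' hl' => ?_)
  rw [← size_reverse]
  exact (size_sublist (((Ctx.inst x).level_sublist l').trans hl'.sublist)).trans (hp x)

theorem PolyTime.leastSet {I : X → List Edge} {t y : X → ℕ} {forb : X → List ℕ} (hI : PolyTime I)
    (ht : PolyTime t) (hy : PolyTime y) (hforb : PolyTime forb) :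
    PolyTime (fun x => (Ctx.inst x).leastSet (I x) (t x) (y x) (forb x)) :=
  PolyTime.query hI PolyTime.level ht hy hforb

end

namespace OracleInstance

variable (E : OracleInstance)

/-! ### The greedy algorithm -/

/-- One terminal from each core of `family I`, namely the one with the smallest number: the
terminals `t` such that each terminal `s` in the least set containing `t` has a number no smaller
than `t`, and the least set containing `s` contains `t`. -/
noncomputable def reps (I : List Edge) : List ℕ :=
  E.terminals.filter (fun t => decide (t ∈ E.leastSet I t t []) &&
    E.terminals.all (fun s => !decide (s ∈ E.leastSet I t t []) ||
      (decide (t ≤ s) && decide (t ∈ E.leastSet I s s []))))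

/-- The least set that contains `y` and no representative but `t`. -/
noncomputable def hull (I : List Edge) (P : List ℕ) (t y : ℕ) : List ℕ :=
  E.leastSet I t y (P.filter (fun s => !decide (s = t)))

/-- The arcs along which paths from the core of `t` are sought: the reversed edges inside the hull
of the core, and arcs without cost from each node `y` to the nodes of the least set that contains
`y`. A set that contains only the representative `t` and is not left by a path is not covered by
the edges of the path. -/
noncomputable def hullArcs (I : List Edge) (P : List ℕ) (t : ℕ) : List (ℕ × ℕ × List Edge) :=
  (E.edges.filter (fun e => !(E.hull I P t e.1).isEmpty && !(E.hull I P t e.2.1).isEmpty)).map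
    (fun e => (e.2.1, e.1, [e])) ++
  E.nodes.flatMap (fun y => (E.hull I P t y).map (fun x => (y, x, [])))

/-- The nodes that can be reached from the core of `t`, with the edges of shortest paths. There are
as many rounds as nodes. -/
noncomputable def labels (I : List Edge) (P : List ℕ) (t : ℕ) : List (ℕ × List Edge) :=
  dijkstra (E.hullArcs I P t) t E.nodes

/-- The list of the paths found from the core of `t` to `v`; it has at most one element. -/
noncomputable def paths (I : List Edge) (P : List ℕ) (t v : ℕ) : List (List Edge) :=
  ((E.labels I P t).filter (fun s => decide (s.1 = v))).map (fun s => s.2)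

/-- The path found from the core of `t` to `v`. -/
noncomputable def path (I : List Edge) (P : List ℕ) (t v : ℕ) : List Edge :=
  (E.paths I P t v).headD []

/-- The edge `e` enters the hull of the core of `t`, at a node with a path to the core. -/
noncomputable def attaches (I : List Edge) (P : List ℕ) (e : Edge) (t : ℕ) : Bool :=
  (E.hull I P t e.1).isEmpty && !(E.paths I P t e.2.1).isEmpty

/-- The representatives, other than `x`, of the cores to which `e` is attached by a path at most as
expensive as the one for `t₁`. -/
noncomputable def starReps (I : List Edge) (P : List ℕ) (e : Edge) (t₁ x : ℕ) : List ℕ :=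
  P.filter (fun t => !decide (t = x) && (E.attaches I P e t &&
    decide (costOf (E.path I P t e.2.1) ≤ costOf (E.path I P t₁ e.2.1))))

/-- The star that consists of the edge `e` and the paths from its head to the cores of `S`. -/
noncomputable def star (I : List Edge) (P : List ℕ) (e : Edge) (S : List ℕ) : List Edge :=
  e :: S.flatMap (fun t => E.path I P t e.2.1)

/-- The stars among which the algorithm chooses. Since `0` is not a representative,
`starReps I P e t₁ 0` leaves out no core. -/
noncomputable def stars (I : List Edge) (P : List ℕ) : List (List Edge) :=
  E.edges.flatMap (fun e => P.flatMap (fun t₁ =>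
    ([t₁] :: (0 :: P).map (fun x => E.starReps I P e t₁ x)).map (fun S => E.star I P e S)))

/-- The stars that reduce the number of cores, with their costs and the reductions. -/
noncomputable def scoredStars (I : List Edge) (P : List ℕ) : List (List Edge × (ℕ × ℕ)) :=
  ((E.stars I P).map (fun Z => (Z, (costOf Z, P.length - (E.reps (Z ++ I)).length)))).filter
    (fun q => decide (1 ≤ q.2.2))

/-- A star of minimum cost per core, if there is one. -/
noncomputable def bestStar (I : List Edge) (P : List ℕ) : List (List Edge × (ℕ × ℕ)) :=
  minBy (fun a b => decide (a.2.1 * b.2.2 ≤ b.2.1 * a.2.2)) (E.scoredStars I P)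

/-- The edges of the best star. -/
noncomputable def bestEdges (I : List Edge) : List Edge :=
  ((E.bestStar I (E.reps I)).map (fun q => q.1)).flatten

/-- The indices of the edges of a list. -/
def _root_.indices (I : List Edge) : List ℕ := I.map (fun e => e.2.2.2)

/-- One round of the greedy algorithm adds the edges of the best star to `I`. -/
noncomputable def greedyStep (I : List Edge) : List Edge :=
  E.edges.filter (fun e => decide (e.2.2.2 ∈ indices (E.bestEdges I ++ I)))

/-- The edges chosen by the greedy algorithm. -/
noncomputable def solution : List Edge := E.nodes.foldl (fun I _ => E.greedyStep I) []

/-- The characteristic vector of the chosen edges. -/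
noncomputable def output : List Bool :=
  E.edges.map (fun e => decide (e.2.2.2 ∈ indices E.solution))

end OracleInstance

section
variable {X : Type} [Ctx X]

theorem PolyTime.reps {I : X → List Edge} (hI : PolyTime I) :
    PolyTime (fun x => (Ctx.inst x).reps (I x)) :=
  PolyTime.terminals.filter (c := fun x t => decide (t ∈ (Ctx.inst x).leastSet (I x) t t []) &&
    (Ctx.inst x).terminals.all (fun s => !decide (s ∈ (Ctx.inst x).leastSet (I x) t t []) ||
      (decide (t ≤ s) && decide (t ∈ (Ctx.inst x).leastSet (I x) s s []))))
    ((PolyTime.var.mem (hI.weaken.leastSet PolyTime.var PolyTime.var PolyTime.nil)).and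
      (PolyTime.terminals.all (X := X × ℕ) (c := fun x s =>
        !decide (s ∈ (Ctx.inst x).leastSet (I x.1) x.2 x.2 []) ||
        (decide (x.2 ≤ s) && decide (x.2 ∈ (Ctx.inst x).leastSet (I x.1) s s [])))
        ((PolyTime.var.mem (hI.weaken.weaken.leastSet PolyTime.var.weaken PolyTime.var.weaken
          PolyTime.nil)).not.or ((PolyTime.var.weaken.le PolyTime.var).and
            (PolyTime.var.weaken.mem (hI.weaken.weaken.leastSet PolyTime.var PolyTime.var
              PolyTime.nil))))))

variable {I : X → List Edge} {P : X → List ℕ} {t y : X → ℕ}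

theorem PolyTime.hull (hI : PolyTime I) (hP : PolyTime P) (ht : PolyTime t) (hy : PolyTime y) :
    PolyTime (fun x => (Ctx.inst x).hull (I x) (P x) (t x) (y x)) :=
  hI.leastSet ht hy (hP.filter (c := fun x s => !decide (s = t x))
    (PolyTime.var.eq ht.weaken).not)

theorem PolyTime.hullArcs (hI : PolyTime I) (hP : PolyTime P) (ht : PolyTime t) :
    PolyTime (fun x => (Ctx.inst x).hullArcs (I x) (P x) (t x)) :=
  ((PolyTime.edges.filter (c := fun x (e : Edge) =>
      !((Ctx.inst x).hull (I x) (P x) (t x) e.1).isEmpty &&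
        !((Ctx.inst x).hull (I x) (P x) (t x) e.2.1).isEmpty)
      ((hI.weaken.hull hP.weaken ht.weaken PolyTime.var.fst).isEmpty.not.and
        (hI.weaken.hull hP.weaken ht.weaken PolyTime.var.snd.fst).isEmpty.not)).map
    (F := fun _ (e : Edge) => (e.2.1, e.1, [e]))
    (PolyTime.var.snd.fst.pair (PolyTime.var.fst.pair (PolyTime.var.cons PolyTime.nil)))).append
  (PolyTime.nodes.flatMap (F := fun x y =>
      ((Ctx.inst x).hull (I x) (P x) (t x) y).map (fun z => (y, z, ([] : List Edge))))
    ((hI.weaken.hull hP.weaken ht.weaken PolyTime.var).map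
      (F := fun (x : X × ℕ) (z : ℕ) => (x.2, z, ([] : List Edge)))
      (PolyTime.var.weaken.pair (PolyTime.var.pair PolyTime.nil))))

theorem PolyTime.labels (hI : PolyTime I) (hP : PolyTime P) (ht : PolyTime t) :
    PolyTime (fun x => (Ctx.inst x).labels (I x) (P x) (t x)) :=
  (hI.hullArcs hP ht).dijkstra ht PolyTime.nodes

theorem PolyTime.paths (hI : PolyTime I) (hP : PolyTime P) (ht : PolyTime t) (hy : PolyTime y) :
    PolyTime (fun x => (Ctx.inst x).paths (I x) (P x) (t x) (y x)) :=
  ((hI.labels hP ht).filter (c := fun x (s : ℕ × List Edge) => decide (s.1 = y x))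
    (PolyTime.var.fst.eq hy.weaken)).map (F := fun _ (s : ℕ × List Edge) => s.2) PolyTime.var.snd

theorem PolyTime.path (hI : PolyTime I) (hP : PolyTime P) (ht : PolyTime t) (hy : PolyTime y) :
    PolyTime (fun x => (Ctx.inst x).path (I x) (P x) (t x) (y x)) :=
  (hI.paths hP ht hy).headD_nil

variable {e : X → Edge}

theorem PolyTime.attaches (hI : PolyTime I) (hP : PolyTime P) (he : PolyTime e) (ht : PolyTime t) :
    PolyTime (fun x => (Ctx.inst x).attaches (I x) (P x) (e x) (t x)) :=
  (hI.hull hP ht he.fst).isEmpty.and (hI.paths hP ht he.snd.fst).isEmpty.not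

theorem PolyTime.starReps (hI : PolyTime I) (hP : PolyTime P) (he : PolyTime e) (ht : PolyTime t)
    (hy : PolyTime y) :
    PolyTime (fun x => (Ctx.inst x).starReps (I x) (P x) (e x) (t x) (y x)) :=
  hP.filter (c := fun x s => !decide (s = y x) && ((Ctx.inst x).attaches (I x) (P x) (e x) s &&
      decide (_root_.costOf ((Ctx.inst x).path (I x) (P x) s (e x).2.1) ≤
        _root_.costOf ((Ctx.inst x).path (I x) (P x) (t x) (e x).2.1))))
    ((PolyTime.var.eq hy.weaken).not.and
      ((hI.weaken.attaches hP.weaken he.weaken PolyTime.var).and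
        ((hI.weaken.path hP.weaken PolyTime.var he.weaken.snd.fst).costOf.le
          (hI.weaken.path hP.weaken ht.weaken he.weaken.snd.fst).costOf)))

theorem PolyTime.star {S : X → List ℕ} (hI : PolyTime I) (hP : PolyTime P) (he : PolyTime e)
    (hS : PolyTime S) : PolyTime (fun x => (Ctx.inst x).star (I x) (P x) (e x) (S x)) :=
  he.cons (hS.flatMap (F := fun x t => (Ctx.inst x).path (I x) (P x) t (e x).2.1)
    (hI.weaken.path hP.weaken PolyTime.var he.weaken.snd.fst))

theorem PolyTime.stars (hI : PolyTime I) (hP : PolyTime P) :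
    PolyTime (fun x => (Ctx.inst x).stars (I x) (P x)) :=
  PolyTime.edges.flatMap (F := fun x e => (P x).flatMap (fun t₁ =>
      ([t₁] :: (0 :: P x).map (fun z => (Ctx.inst x).starReps (I x) (P x) e t₁ z)).map
        (fun S => (Ctx.inst x).star (I x) (P x) e S)))
    (hP.weaken.flatMap (F := fun (x : X × Edge) t₁ =>
        ([t₁] :: (0 :: P x.1).map (fun z =>
          (Ctx.inst x).starReps (I x.1) (P x.1) x.2 t₁ z)).map
        (fun S => (Ctx.inst x).star (I x.1) (P x.1) x.2 S))
      (((PolyTime.var.cons PolyTime.nil).cons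
        (((PolyTime.const 0).cons hP.weaken.weaken).map
          (F := fun (x : (X × Edge) × ℕ) z =>
            (Ctx.inst x).starReps (I x.1.1) (P x.1.1) x.1.2 x.2 z)
          (hI.weaken.weaken.weaken.starReps hP.weaken.weaken.weaken PolyTime.var.weaken.weaken
            PolyTime.var.weaken PolyTime.var))).map
        (F := fun (x : (X × Edge) × ℕ) S => (Ctx.inst x).star (I x.1.1) (P x.1.1) x.1.2 S)
        (hI.weaken.weaken.weaken.star hP.weaken.weaken.weaken PolyTime.var.weaken.weaken
          PolyTime.var)))

theorem PolyTime.scoredStars (hI : PolyTime I) (hP : PolyTime P) :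
    PolyTime (fun x => (Ctx.inst x).scoredStars (I x) (P x)) :=
  ((hI.stars hP).map (F := fun x Z => (Z, (_root_.costOf Z,
      (P x).length - ((Ctx.inst x).reps (Z ++ I x)).length)))
    (PolyTime.var.pair (PolyTime.var.costOf.pair
      (hP.weaken.length.sub (PolyTime.var.append hI.weaken).reps.length)))).filter
    (c := fun _ (q : List Edge × (ℕ × ℕ)) => decide (1 ≤ q.2.2))
    ((PolyTime.const 1).le PolyTime.var.snd.snd)

theorem PolyTime.bestStar (hI : PolyTime I) (hP : PolyTime P) :
    PolyTime (fun x => (Ctx.inst x).bestStar (I x) (P x)) :=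
  (hI.scoredStars hP).minBy (le := fun _ (a b : List Edge × (ℕ × ℕ)) =>
      decide (a.2.1 * b.2.2 ≤ b.2.1 * a.2.2))
    ((PolyTime.var.weaken.snd.fst.mul PolyTime.var.snd.snd).le
      (PolyTime.var.snd.fst.mul PolyTime.var.weaken.snd.snd))

theorem PolyTime.indices (hI : PolyTime I) : PolyTime (fun x => indices (I x)) :=
  hI.map (F := fun _ (e : Edge) => e.2.2.2) PolyTime.var.snd.snd.snd

theorem PolyTime.bestEdges (hI : PolyTime I) :
    PolyTime (fun x => (Ctx.inst x).bestEdges (I x)) :=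
  ((hI.bestStar hI.reps).map (F := fun _ (q : List Edge × (ℕ × ℕ)) => q.1)
    PolyTime.var.fst).flatten

theorem PolyTime.greedyStep (hI : PolyTime I) :
    PolyTime (fun x => (Ctx.inst x).greedyStep (I x)) :=
  PolyTime.edges.filter (c := fun x (e : Edge) => decide (e.2.2.2 ∈ _root_.indices
      ((Ctx.inst x).bestEdges (I x) ++ I x)))
    (PolyTime.var.snd.snd.snd.mem (hI.bestEdges.append hI).indices.weaken)

theorem PolyTime.solution : PolyTime (fun x : X => (Ctx.inst x).solution) := by
  obtain ⟨p, hp⟩ := (PolyTime.edges (X := X)).size_le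
  refine PolyTime.foldl (F := fun x (I : List Edge) (_ : ℕ) => (Ctx.inst x).greedyStep I)
    (PolyTime.var.weaken.greedyStep) PolyTime.nodes PolyTime.nil p (fun x l' _ => ?_)
  induction l' using List.reverseRecOn with
  | nil => exact (size_sublist (List.nil_sublist _)).trans (hp x)
  | append_singleton l' a _ =>
    rw [List.foldl_append]
    exact (size_sublist List.filter_sublist).trans (hp x)

theorem PolyTime.output : PolyTime (fun E : OracleInstance => E.output) :=
  PolyTime.edges.map (F := fun x e => decide (e.2.2.2 ∈ _root_.indices (Ctx.inst x).solution))
    (PolyTime.var.snd.snd.snd.mem PolyTime.solution.indices)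

end

namespace OracleInstance

variable (E : OracleInstance) {I : List Edge} {t : ℕ}

/-! ### The representatives and the hulls -/

theorem positions_nodup (l : List Bool) : (positions l).Nodup := by
  have h : (positions l).Sublist (l.zipIdx.map (fun q => q.2 + 1)) :=
    List.Sublist.map _ List.filter_sublist
  refine h.nodup ?_
  have e : l.zipIdx.map (fun q => q.2 + 1) = (l.zipIdx.map Prod.snd).map (· + 1) := by
    rw [List.map_map]; rfl
  rw [e, List.zipIdx_map_snd]
  exact (List.nodup_range' (step := 1)).map (fun a b h => Nat.succ_injective h)

theorem reps_nodup (I : List Edge) : (E.reps I).Nodup :=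
  List.filter_sublist.nodup (positions_nodup _)

theorem mem_reps : t ∈ E.reps I ↔ t ∈ E.terminals ∧ t ∈ E.leastSet I t t [] ∧
    ∀ s ∈ E.terminals, s ∈ E.leastSet I t t [] → t ≤ s ∧ t ∈ E.leastSet I s s [] := by
  rw [reps, List.mem_filter]
  simp only [Bool.and_eq_true, decide_eq_true_eq, List.all_eq_true, Bool.or_eq_true,
    Bool.not_eq_true', decide_eq_false_iff_not, ← imp_iff_not_or]

theorem leastSet_nil_spec (ht : t ∈ E.terminals) :
    (E.leastSet I t t [] = [] ∧ ∀ B ∈ E.family I, t ∉ B) ∨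
    ∃ A ∈ E.family I, t ∈ A ∧ (∀ x, x ∈ E.leastSet I t t [] ↔ x ∈ A) ∧
      ∀ B ∈ E.family I, t ∈ B → A ⊆ B := by
  rcases E.leastSet_spec (I := I) (y := t) (forb := []) ht with ⟨h1, h2⟩ | ⟨A, h1, h2, _, _, h3, h4⟩
  · exact .inl ⟨h1, fun B hB htB => by obtain ⟨s, hs, _⟩ := h2 B hB htB htB; simp at hs⟩
  · exact .inr ⟨A, h1, h2, h3, fun B hB htB => h4 B hB htB htB (by simp)⟩

theorem isReps_reps (I : List Edge) :
    IsReps E.terminalSet (E.family I) (E.reps I).toFinset := by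
  refine ⟨fun t ht => (E.mem_reps.1 (List.mem_toFinset.1 ht)).1, fun B hB => ?_, fun t ht => ?_⟩
  · obtain ⟨D, ⟨hD, hDB⟩, hmin⟩ := WellFounded.has_min (measure (Finset.card (α := ℕ))).wf
      {A | A ∈ E.family I ∧ A ⊆ B} ⟨B, hB, subset_rfl⟩
    have hD' : ∀ A ∈ E.family I, A ⊆ D → A = D := fun A hA hAD =>
      Finset.eq_of_subset_of_card_le hAD (not_lt.1 (hmin A ⟨hA, hAD.trans hDB⟩))
    have hleast : ∀ s ∈ E.terminals, s ∈ D → ∀ x, x ∈ E.leastSet I s s [] ↔ x ∈ D := by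
      intro s hs hsD x
      rcases E.leastSet_nil_spec (I := I) hs with ⟨_, h⟩ | ⟨A, hA, _, hAx, hA'⟩
      · exact absurd hsD (h D hD)
      · rw [hAx, hD' A hA (hA' D hD hsD)]
    have hex : ∃ t, t ∈ E.terminals ∧ t ∈ D := by
      obtain ⟨t, ht, htD⟩ := (E.intersectingFamily I).terminal D hD
      exact ⟨t, ht, htD⟩
    classical
    obtain ⟨ht, htD⟩ := Nat.find_spec hex
    refine ⟨Nat.find hex, List.mem_toFinset.2 (E.mem_reps.2 ⟨ht, ?_, fun s hs hsA => ?_⟩),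
      hDB htD⟩
    · exact (hleast _ ht htD _).2 htD
    · have hsD := (hleast _ ht htD _).1 hsA
      exact ⟨Nat.find_min' hex ⟨hs, hsD⟩, (hleast _ hs hsD _).2 htD⟩
  · rw [List.mem_toFinset, E.mem_reps] at ht
    obtain ⟨hT, htA, hall⟩ := ht
    rcases E.leastSet_nil_spec (I := I) hT with ⟨h, _⟩ | ⟨A, hA, htA', hAx, _⟩
    · rw [h] at htA; simp at htA
    · refine ⟨A, hA, htA', fun s hs hsA => ?_⟩
      rw [List.mem_toFinset, E.mem_reps] at hs
      obtain ⟨h1, h2⟩ := hall s hs.1 ((hAx s).2 hsA)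
      exact le_antisymm (hs.2.2 t hT h2).1 h1

theorem hull_spec (ht : t ∈ E.reps I) (y : ℕ) :
    (E.hull I (E.reps I) t y = [] ∧ ¬ InHull (E.family I) (E.reps I).toFinset t y) ∨
    ∃ A ∈ single (E.family I) (E.reps I).toFinset t, y ∈ A ∧
      (∀ x, x ∈ E.hull I (E.reps I) t y ↔ x ∈ A) ∧
      ∀ B ∈ single (E.family I) (E.reps I).toFinset t, y ∈ B → A ⊆ B := by
  have hforb : ∀ B : Finset ℕ, (∀ s ∈ (E.reps I).filter (fun s => !decide (s = t)), s ∉ B) ↔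
      ∀ s ∈ (E.reps I).toFinset, s ∈ B → s = t := by
    intro B
    simp only [List.mem_filter, Bool.not_eq_true', decide_eq_false_iff_not, List.mem_toFinset]
    exact ⟨fun h s hs hsB => not_not.1 fun hst => h s ⟨hs, hst⟩ hsB,
      fun h s hs hsB => hs.2 (h s hs.1 hsB)⟩
  rcases E.leastSet_spec (I := I) (y := y)
    (forb := (E.reps I).filter (fun s => !decide (s = t))) (E.mem_reps.1 ht).1 with
    ⟨h1, h2⟩ | ⟨A, h1, h2, h3, h4, h5, h6⟩
  · refine .inl ⟨h1, ?_⟩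
    rintro ⟨B, ⟨hB, htB, hB'⟩, hyB⟩
    obtain ⟨s, hs, hsB⟩ := h2 B hB htB hyB
    exact (hforb B).2 hB' s hs hsB
  · exact .inr ⟨A, ⟨h1, h2, (hforb A).1 h4⟩, h3, h5, fun B hB hyB =>
      h6 B hB.1 hB.2.1 hyB ((hforb B).2 hB.2.2)⟩

theorem hull_isEmpty_iff (ht : t ∈ E.reps I) (y : ℕ) :
    (E.hull I (E.reps I) t y).isEmpty = true ↔
      ¬ InHull (E.family I) (E.reps I).toFinset t y := by
  rw [List.isEmpty_iff]
  rcases E.hull_spec ht y with h | ⟨A, hA, hy, hx, _⟩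
  · exact iff_of_true h.1 h.2
  · refine iff_of_false (fun h => ?_) (fun h => h ⟨A, hA, hy⟩)
    have := (hx y).2 hy
    rw [h] at this
    simp at this

/-! ### The paths -/

theorem mem_hullArcs {P : List ℕ} {a : ℕ × ℕ × List Edge} : a ∈ E.hullArcs I P t ↔
    (∃ e ∈ E.edges, (E.hull I P t e.1).isEmpty = false ∧ (E.hull I P t e.2.1).isEmpty = false ∧
      a = (e.2.1, e.1, [e])) ∨
    ∃ y ∈ E.nodes, ∃ x ∈ E.hull I P t y, a = (y, x, []) := by
  simp only [hullArcs, List.mem_append, List.mem_map, List.mem_filter, Bool.and_eq_true,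
    Bool.not_eq_true', List.mem_flatMap, and_assoc, eq_comm (a := a)]

theorem mem_nodes_of_inHull {P : Finset ℕ} {x : ℕ} (h : InHull (E.family I) P t x) :
    x ∈ E.nodes := by
  obtain ⟨A, hA, hx⟩ := h
  exact List.mem_toFinset.1 (E.family_subset_nodes A hA.1 hx)

theorem hull_isEmpty_eq_false_iff (ht : t ∈ E.reps I) (y : ℕ) :
    (E.hull I (E.reps I) t y).isEmpty = false ↔
      InHull (E.family I) (E.reps I).toFinset t y := by
  rw [← not_iff_not, ← E.hull_isEmpty_iff ht, Bool.not_eq_false]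

theorem inHull_of_mem_hull (ht : t ∈ E.reps I) {x y : ℕ} (hx : x ∈ E.hull I (E.reps I) t y) :
    InHull (E.family I) (E.reps I).toFinset t x := by
  rcases E.hull_spec ht y with ⟨h, _⟩ | ⟨A, hA, _, h, _⟩
  · rw [h] at hx; simp at hx
  · exact ⟨A, hA, (h x).1 hx⟩

theorem inHull_self (ht : t ∈ E.reps I) :
    InHull (E.family I) (E.reps I).toFinset t t := by
  obtain ⟨C, hC, htC, hC'⟩ := (E.isReps_reps I).own t (List.mem_toFinset.2 ht)
  exact ⟨C, ⟨hC, htC, hC'⟩, htC⟩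

/-- A path to `x` lies inside the hull, and a set that contains only the representative `t` and is
not covered by the edges of the path contains `x`. -/
theorem labels_spec (ht : t ∈ E.reps I) : ∀ s ∈ E.labels I (E.reps I) t,
    InHull (E.family I) (E.reps I).toFinset t s.1 ∧
    (∀ g ∈ s.2, g ∈ E.edges ∧ InHull (E.family I) (E.reps I).toFinset t g.1) ∧
    ∀ A ∈ single (E.family I) (E.reps I).toFinset t, (∀ g ∈ s.2, g.2.1 ∈ A → g.1 ∈ A) →
      s.1 ∈ A := by
  refine dijkstra_induction ⟨E.inHull_self ht, by simp, fun A hA _ => hA.2.1⟩ ?_ E.nodes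
  rintro s ⟨h1, h2, h3⟩ a ha has
  rcases E.mem_hullArcs.1 ha with ⟨e, he, hu, hv, rfl⟩ | ⟨y, _, x, hx, rfl⟩
  · rw [E.hull_isEmpty_eq_false_iff ht] at hu
    refine ⟨hu, fun g hg => ?_, fun A hA hg => ?_⟩
    · rcases List.mem_append.1 hg with hg | hg
      · exact h2 g hg
      · rw [List.mem_singleton] at hg
        subst hg
        exact ⟨he, hu⟩
    · refine hg e (by simp) ?_
      have h4 := h3 A hA (fun g hg' => hg g (List.mem_append_left _ hg'))
      rwa [← has] at h4
  · refine ⟨E.inHull_of_mem_hull ht hx, fun g hg => h2 g (by simpa using hg), fun A hA hg => ?_⟩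
    have h4 := h3 A hA (fun g hg' => hg g (List.mem_append_left _ hg'))
    rw [← has] at h4
    rcases E.hull_spec ht y with ⟨h, _⟩ | ⟨B, hB, _, h, hmin⟩
    · rw [h] at hx; simp at hx
    · exact hmin A hA h4 ((h x).1 hx)

/-- The nodes to which a path from the core of `t` has been found. -/
noncomputable def reached (I : List Edge) (P : List ℕ) (t : ℕ) : Finset ℕ :=
  ((E.labels I P t).map Prod.fst).toFinset

theorem path_eq {P : List ℕ} {s : ℕ × List Edge} (hs : s ∈ E.labels I P t) :
    E.path I P t s.1 = s.2 := by
  have hnd : ((E.labels I P t).map Prod.fst).Nodup := dijkstra_nodup _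
  have hmem : s ∈ (E.labels I P t).filter (fun r => decide (r.1 = s.1)) :=
    List.mem_filter.2 ⟨hs, by simp⟩
  rw [path, paths]
  cases hl : (E.labels I P t).filter (fun r => decide (r.1 = s.1)) with
  | nil => rw [hl] at hmem; simp at hmem
  | cons r l =>
    have hr : r ∈ (E.labels I P t).filter (fun r => decide (r.1 = s.1)) := by rw [hl]; simp
    rw [List.mem_filter, decide_eq_true_eq] at hr
    rw [List.map_cons, List.headD_cons]
    rw [List.inj_on_of_nodup_map hnd hr.1 hs hr.2]

theorem mem_reached {P : List ℕ} {x : ℕ} :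
    x ∈ E.reached I P t ↔ (x, E.path I P t x) ∈ E.labels I P t := by
  rw [reached, List.mem_toFinset, List.mem_map]
  constructor
  · rintro ⟨s, hs, rfl⟩
    rwa [E.path_eq hs]
  · exact fun h => ⟨_, h, rfl⟩

theorem mem_reached_iff_paths {P : List ℕ} {x : ℕ} :
    x ∈ E.reached I P t ↔ (E.paths I P t x).isEmpty = false := by
  rw [reached, List.mem_toFinset, paths, List.isEmpty_eq_false_iff, Ne, List.map_eq_nil_iff,
    List.filter_eq_nil_iff, List.mem_map]
  simp

theorem source_mem_reached {P : List ℕ} :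
    t ∈ E.reached I P t ∧ E.path I P t t = [] := by
  have h : (t, []) ∈ E.labels I P t := source_mem_dijkstra _
  have h1 := E.path_eq h
  simp only at h1
  exact ⟨E.mem_reached.2 (by rw [h1]; exact h), h1⟩

theorem labels_closed (ht : t ∈ E.reps I) {y : ℕ} (hy : y ∈ E.reached I (E.reps I) t)
    {a : ℕ × ℕ × List Edge} (ha : a ∈ E.hullArcs I (E.reps I) t) (hay : a.1 = y) :
    a.2.1 ∈ E.reached I (E.reps I) t ∧ costOf (E.path I (E.reps I) t a.2.1) ≤
      costOf (E.path I (E.reps I) t y) + costOf a.2.2 := by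
  have hU : ∀ a ∈ E.hullArcs I (E.reps I) t, a.2.1 ∈ E.nodes.toFinset := by
    intro a ha
    rw [List.mem_toFinset]
    rcases E.mem_hullArcs.1 ha with ⟨e, he, hu, hv, rfl⟩ | ⟨y, _, x, hx, rfl⟩
    · exact E.mem_nodes_of_inHull ((E.hull_isEmpty_eq_false_iff ht _).1 hu)
    · exact E.mem_nodes_of_inHull (E.inHull_of_mem_hull ht hx)
  obtain ⟨s', hs', h1, h2⟩ := dijkstra_closed
    (List.mem_toFinset.2 (E.mem_nodes_of_inHull (E.inHull_self ht))) hU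
    (List.toFinset_card_le _) _ (E.mem_reached.1 hy) a ha hay
  have h3 := E.path_eq hs'
  rw [← h1, h3]
  exact ⟨E.mem_reached.2 (by rw [h3]; exact hs'), h2⟩

theorem inHull_of_mem_reached (ht : t ∈ E.reps I) {x : ℕ}
    (hx : x ∈ E.reached I (E.reps I) t) : InHull (E.family I) (E.reps I).toFinset t x :=
  (E.labels_spec ht _ (E.mem_reached.1 hx)).1

theorem reached_step (ht : t ∈ E.reps I) {e : Edge} (he : e ∈ E.edges)
    (hv : e.2.1 ∈ E.reached I (E.reps I) t)
    (hu : InHull (E.family I) (E.reps I).toFinset t e.1) :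
    e.1 ∈ E.reached I (E.reps I) t ∧ costOf (E.path I (E.reps I) t e.1) ≤
      costOf (E.path I (E.reps I) t e.2.1) + e.2.2.1 := by
  have h := E.labels_closed ht hv (a := (e.2.1, e.1, [e])) (E.mem_hullArcs.2 (.inl ⟨e, he,
    (E.hull_isEmpty_eq_false_iff ht _).2 hu,
    (E.hull_isEmpty_eq_false_iff ht _).2 (E.inHull_of_mem_reached ht hv), rfl⟩)) rfl
  simpa [costOf] using h

theorem mem_single_of_forall_mem {T : Set ℕ} {ℱ : Set (Finset ℕ)} {P D : Finset ℕ}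
    (h : IntersectingFamily T ℱ) (ht : t ∈ T) (hne : D.Nonempty)
    (hD : ∀ y ∈ D, ∃ A ∈ single ℱ P t, y ∈ A ∧ A ⊆ D) : D ∈ single ℱ P t := by
  have key : ∀ s : Finset ℕ, s ⊆ D → ∃ B ∈ single ℱ P t, s ⊆ B ∧ B ⊆ D := by
    intro s
    induction s using Finset.induction with
    | empty =>
      intro _
      obtain ⟨y, hy⟩ := hne
      obtain ⟨A, hA, _, hAD⟩ := hD y hy
      exact ⟨A, hA, Finset.empty_subset _, hAD⟩
    | insert y s _ ih =>
      intro hs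
      rw [Finset.insert_subset_iff] at hs
      obtain ⟨B, hB, hsB, hBD⟩ := ih hs.2
      obtain ⟨A, hA, hy, hAD⟩ := hD y hs.1
      refine ⟨B ∪ A, single_union h ht hB hA, ?_, Finset.union_subset hBD hAD⟩
      rw [Finset.insert_subset_iff]
      exact ⟨Finset.mem_union_right _ hy, hsB.trans Finset.subset_union_left⟩
  obtain ⟨B, hB, h1, h2⟩ := key D subset_rfl
  rwa [h1.antisymm h2]

/-- The nodes within a given distance from the core of `t` form a member of the family. -/
theorem layer_mem_single (ht : t ∈ E.reps I) (c : ℕ → Prop) [DecidablePred c] (hc0 : c 0)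
    (hc : ∀ i j, i ≤ j → c j → c i) :
    (E.reached I (E.reps I) t).filter (fun x => c (costOf (E.path I (E.reps I) t x))) ∈
      single (E.family I) (E.reps I).toFinset t := by
  refine mem_single_of_forall_mem (E.intersectingFamily I) (E.mem_reps.1 ht).1
    ⟨t, Finset.mem_filter.2 ⟨E.source_mem_reached.1, by rw [E.source_mem_reached.2]; exact hc0⟩⟩
    fun y hy => ?_
  rw [Finset.mem_filter] at hy
  have hin := E.inHull_of_mem_reached ht hy.1
  rcases E.hull_spec ht y with ⟨_, h⟩ | ⟨A, hA, hyA, hx, _⟩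
  · exact absurd hin h
  · refine ⟨A, hA, hyA, fun x hxA => ?_⟩
    have h := E.labels_closed ht hy.1 (a := (y, x, [])) (E.mem_hullArcs.2 (.inr ⟨y,
      E.mem_nodes_of_inHull hin, x, (hx x).2 hxA, rfl⟩)) rfl
    rw [Finset.mem_filter]
    exact ⟨h.1, hc _ _ (by simpa [costOf] using h.2) hy.2⟩

/-! ### The stars -/

theorem family_append (Z : List Edge) : E.family (Z ++ I) =
    {A | A ∈ E.family I ∧ ∀ g ∈ Z, g.2.1 ∈ A → g.1 ∈ A} := by
  ext B
  simp only [family, Set.mem_ofPred_eq, List.mem_append, or_imp, forall_and]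
  constructor
  · rintro ⟨A, h1, h2, h3, h4⟩
    exact ⟨⟨A, h1, h2, h4⟩, h3⟩
  · rintro ⟨⟨A, h1, h2, h4⟩, h3⟩
    exact ⟨A, h1, h2, h3, h4⟩

theorem attaches_iff (ht : t ∈ E.reps I) (e : Edge) :
    E.attaches I (E.reps I) e t = true ↔
      ¬ InHull (E.family I) (E.reps I).toFinset t e.1 ∧ e.2.1 ∈ E.reached I (E.reps I) t := by
  rw [attaches, Bool.and_eq_true, E.hull_isEmpty_iff ht, mem_reached_iff_paths,
    Bool.not_eq_true']

theorem costOf_star (e : Edge) {P S : List ℕ} (hS : S.Nodup) :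
    costOf (E.star I P e S) = e.2.2.1 + ∑ t ∈ S.toFinset, costOf (E.path I P t e.2.1) := by
  have h : ∀ S : List ℕ, costOf (S.flatMap (fun t => E.path I P t e.2.1)) =
      (S.map (fun t => costOf (E.path I P t e.2.1))).sum := by
    intro S
    induction S with
    | nil => rfl
    | cons t S ih => rw [List.flatMap_cons, costOf_append, ih, List.map_cons, List.sum_cons]
  rw [List.sum_toFinset _ hS, ← h]
  rfl

/-- A good star reduces the number of cores by at least the number of cores it is attached to. -/
theorem length_reps_star_add_le {e : Edge} {S : List ℕ} (hnd : S.Nodup)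
    (hS : ∀ t ∈ S, t ∈ E.reps I ∧ E.attaches I (E.reps I) e t = true)
    (hgood : (∀ A ∈ E.family I, e.1 ∈ A → ∃ t ∈ (E.reps I).toFinset, t ∉ S.toFinset ∧ t ∈ A) ∨
      ∀ s ∈ S.toFinset, ∀ t ∈ S.toFinset, s = t) :
    (E.reps (E.star I (E.reps I) e S ++ I)).length + S.length ≤ (E.reps I).length := by
  have h := card_reps_add_card_le (E.intersectingFamily (E.star I (E.reps I) e S ++ I))
    (E.isReps_reps I) (E.isReps_reps (E.star I (E.reps I) e S ++ I)) (S := S.toFinset)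
    (fun t ht => List.mem_toFinset.2 (hS t (List.mem_toFinset.1 ht)).1) ?_
  · rwa [List.toFinset_card_of_nodup (E.reps_nodup _), List.toFinset_card_of_nodup (E.reps_nodup _),
      List.toFinset_card_of_nodup hnd] at h
  · intro A hA
    rw [family_append] at hA
    have hatt : ∀ t ∈ S.toFinset, t ∈ E.reps I ∧
        ¬ InHull (E.family I) (E.reps I).toFinset t e.1 ∧ e.2.1 ∈ E.reached I (E.reps I) t := by
      intro t ht
      obtain ⟨h1, h2⟩ := hS t (List.mem_toFinset.1 ht)
      exact ⟨h1, (E.attaches_iff h1 e).1 h2⟩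
    refine exists_rep_of_not_entered (E.intersectingFamily I) E.family_subset_nodes
      (E.isReps_reps I) (u := e.1) (v := e.2.1)
      (Y := fun t => {g | ∃ d ∈ E.path I (E.reps I) t e.2.1, g = (d.1, d.2.1)})
      (X := {g | ∃ d ∈ E.star I (E.reps I) e S, g = (d.1, d.2.1)})
      ⟨e, List.mem_cons_self, rfl⟩ ?_ (fun t ht => (hatt t ht).2.1) ?_ ?_ hgood hA.1 ?_
    · rintro t ht g ⟨d, hd, rfl⟩
      exact ⟨d, List.mem_cons_of_mem _ (List.mem_flatMap.2 ⟨t, List.mem_toFinset.1 ht, hd⟩), rfl⟩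
    · rintro t ht g ⟨d, hd, rfl⟩
      exact ((E.labels_spec (hatt t ht).1 _ (E.mem_reached.1 (hatt t ht).2.2)).2.1 d hd).2
    · intro t ht A hA hg
      exact (E.labels_spec (hatt t ht).1 _ (E.mem_reached.1 (hatt t ht).2.2)).2.2 A hA
        (fun d hd => hg (d.1, d.2.1) ⟨d, hd, rfl⟩)
    · rintro g ⟨d, hd, rfl⟩
      exact hA.2 d hd

theorem mem_stars {P : List ℕ} {e : Edge} {t₁ : ℕ} {S : List ℕ} (he : e ∈ E.edges) (ht : t₁ ∈ P)
    (hS : S = [t₁] ∨ ∃ x ∈ 0 :: P, S = E.starReps I P e t₁ x) :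
    E.star I P e S ∈ E.stars I P := by
  rw [stars, List.mem_flatMap]
  refine ⟨e, he, List.mem_flatMap.2 ⟨t₁, ht, List.mem_map.2 ⟨S, ?_, rfl⟩⟩⟩
  rcases hS with rfl | ⟨x, hx, rfl⟩
  · exact List.mem_cons_self
  · exact List.mem_cons_of_mem _ (List.mem_map.2 ⟨x, hx, rfl⟩)

theorem mem_edges_of_mem_stars {Z : List Edge} (hZ : Z ∈ E.stars I (E.reps I)) :
    ∀ g ∈ Z, g ∈ E.edges := by
  have hpath : ∀ t ∈ E.reps I, ∀ v, ∀ g ∈ E.path I (E.reps I) t v, g ∈ E.edges := by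
    intro t ht v g hg
    by_cases hv : v ∈ E.reached I (E.reps I) t
    · exact ((E.labels_spec ht _ (E.mem_reached.1 hv)).2.1 g hg).1
    · rw [mem_reached_iff_paths, Bool.not_eq_false, List.isEmpty_iff] at hv
      rw [path, hv] at hg
      simp at hg
  simp only [stars, List.mem_flatMap, List.mem_map] at hZ
  obtain ⟨e, he, t₁, ht₁, S, hS, rfl⟩ := hZ
  have hSP : ∀ t ∈ S, t ∈ E.reps I := by
    rcases List.mem_cons.1 hS with rfl | hS
    · intro t ht
      rwa [List.mem_singleton.1 ht]
    · obtain ⟨x, _, rfl⟩ := List.mem_map.1 hS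
      exact fun t ht => (List.mem_filter.1 ht).1
  intro g hg
  rcases List.mem_cons.1 hg with rfl | hg
  · exact he
  · obtain ⟨t, ht, hg⟩ := List.mem_flatMap.1 hg
    exact hpath t (hSP t ht) _ g hg

theorem bestStar_le {q r : List Edge × (ℕ × ℕ)} (hq : q ∈ E.bestStar I (E.reps I))
    (hr : r ∈ E.scoredStars I (E.reps I)) : q.2.1 * r.2.2 ≤ r.2.1 * q.2.2 := by
  have h := le_of_mem_minBy (p := fun q : List Edge × (ℕ × ℕ) => 1 ≤ q.2.2)
    (le := fun a b : List Edge × (ℕ × ℕ) => decide (a.2.1 * b.2.2 ≤ b.2.1 * a.2.2))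
    (fun a b _ _ => by simpa using le_total _ _)
    (fun a b c _ hb _ h1 h2 => by
      rw [decide_eq_true_eq] at *
      refine Nat.le_of_mul_le_mul_right (c := b.2.2) ?_ hb
      calc a.2.1 * c.2.2 * b.2.2 = a.2.1 * b.2.2 * c.2.2 := by ring
        _ ≤ b.2.1 * a.2.2 * c.2.2 := by gcongr
        _ = b.2.1 * c.2.2 * a.2.2 := by ring
        _ ≤ c.2.1 * b.2.2 * a.2.2 := by gcongr
        _ = c.2.1 * a.2.2 * b.2.2 := by ring)
    (fun a ha => by simpa using (List.mem_filter.1 ha).2) hq r hr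
  simpa using h

theorem mem_scoredStars {P : List ℕ} {Z : List Edge} (hZ : Z ∈ E.stars I P)
    (h : (E.reps (Z ++ I)).length < P.length) :
    (Z, (costOf Z, P.length - (E.reps (Z ++ I)).length)) ∈ E.scoredStars I P :=
  List.mem_filter.2 ⟨List.mem_map.2 ⟨Z, hZ, rfl⟩, decide_eq_true (Nat.sub_pos_of_lt h)⟩

/-- Every member of the family is entered by at least `k_f` edges of a cover. -/
theorem maxVal_le_card_filter {J : Finset (Fin E.G.m)} (hJ : E.G.CoversFun J E.f) {A : Finset ℕ}
    (hA : A ∈ E.family I) : (maxVal E.f).toNat ≤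
      (J.filter (fun i => (E.edge i).2.1 ∈ A ∧ (E.edge i).1 ∉ A)).card := by
  obtain ⟨A, rfl, hf, -⟩ := hA
  have h := hJ A
  rw [hf, CoverInstance.inDeg] at h
  have e : J.filter (fun i => (E.edge i).2.1 ∈ numSet A ∧ (E.edge i).1 ∉ numSet A) =
      J.filter (fun i => (E.G.arc i).Enters A) := by
    refine Finset.filter_congr fun i _ => ?_
    simp only [edge, nodeNum_mem_numSet]
    rfl
  rw [e]
  omega

theorem quasiBipartite_edge (i : Fin E.G.m) :
    (E.edge i).1 ∈ E.terminalSet ∨ (E.edge i).2.1 ∈ E.terminalSet ∨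
      (∀ A ∈ E.family I, (E.edge i).1 ∉ A) ∨ ∀ A ∈ E.family I, (E.edge i).2.1 ∉ A := by
  have key : ∀ x : Option (Fin E.G.n), E.G.GoodEnd E.f x →
      nodeNum x ∈ E.terminalSet ∨ ∀ A ∈ E.family I, nodeNum x ∉ A := by
    rintro x (⟨v, hv, rfl⟩ | h)
    · exact .inl (E.mem_terminals.2 (succ_mem_numSet.2 hv))
    · right
      rintro A ⟨A, rfl, hf, -⟩ hx
      obtain ⟨v, hv, hxv⟩ := nodeNum_mem_numSet.1 hx
      have := E.one_le_maxVal
      exact h A (by omega) v hv hxv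
  rcases E.quasiBipartite i with h | h
  · rcases key _ h with h | h
    · exact .inl h
    · exact .inr (.inr (.inl h))
  · rcases key _ h with h | h
    · exact .inr (.inl h)
    · exact .inr (.inr (.inr h))

/-- As long as there is a core, there is a star that reduces the number of cores. -/
theorem scoredStars_ne_nil (hne : E.reps I ≠ []) : E.scoredStars I (E.reps I) ≠ [] := by
  obtain ⟨t, ht⟩ := List.exists_mem_of_ne_nil _ hne
  obtain ⟨J, hJ⟩ := E.coverable
  have hlayer := E.layer_mem_single ht (fun _ => True) trivial (fun _ _ _ _ => trivial)
  rw [Finset.filter_true] at hlayer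
  have h1 := E.maxVal_le_card_filter hJ hlayer.1
  have h2 := E.one_le_maxVal
  obtain ⟨i, hi⟩ := Finset.card_pos.1 (lt_of_lt_of_le (by omega) h1)
  rw [Finset.mem_filter] at hi
  have hie : E.edge i ∈ E.edges := E.mem_edges.2 ⟨i, rfl⟩
  have hatt : E.attaches I (E.reps I) (E.edge i) t = true := (E.attaches_iff ht _).2
    ⟨fun h => hi.2.2 (E.reached_step ht hie hi.2.1 h).1, hi.2.1⟩
  have h3 := E.length_reps_star_add_le (S := [t]) (List.nodup_singleton t)
    (fun s hs => by rw [List.mem_singleton.1 hs]; exact ⟨ht, hatt⟩) (.inr fun s hs r hr => by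
      simp at hs hr; rw [hs, hr])
  rw [List.length_singleton] at h3
  exact List.ne_nil_of_mem (E.mem_scoredStars (E.mem_stars hie ht (.inl rfl)) (by omega))

/-- The cost per core of the best star is at most `2 / (k_f * ν)` times the cost of a cover. -/
theorem bestStar_density {J : Finset (Fin E.G.m)} (hJ : E.G.CoversFun J E.f)
    {q : List Edge × (ℕ × ℕ)} (hq : q ∈ E.bestStar I (E.reps I)) :
    (maxVal E.f).toNat * q.2.1 * (E.reps I).length ≤ 2 * (q.2.2 * ∑ i ∈ J, (E.edge i).2.2.1) := by
  have hedge : ∀ i, E.edge i ∈ E.edges := fun i => E.mem_edges.2 ⟨i, rfl⟩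
  have h := mul_card_reps_le_cost (E.intersectingFamily I) (E.isReps_reps I) (J := J)
    (tail := fun i => (E.edge i).1) (head := fun i => (E.edge i).2.1)
    (c := fun i => q.2.2 * (E.edge i).2.2.1) (R := fun t => E.reached I (E.reps I) t)
    (d := fun t x => q.2.2 * costOf (E.path I (E.reps I) t x)) (θ := q.2.1)
    (k := (maxVal E.f).toNat)
    (fun t ht i => E.layer_mem_single (List.mem_toFinset.1 ht) (fun j => q.2.2 * j ≤ i)
      (by simp) (fun j l hjl hl => (Nat.mul_le_mul_left _ hjl).trans hl))
    (fun t ht i _ hv hu => by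
      obtain ⟨h1, h2⟩ := E.reached_step (List.mem_toFinset.1 ht) (hedge i) hv hu
      exact ⟨h1, (Nat.mul_le_mul_left _ h2).trans (by rw [mul_add])⟩)
    (fun A hA => E.maxVal_le_card_filter hJ hA) (fun i _ => E.quasiBipartite_edge i) ?_
  · rwa [List.toFinset_card_of_nodup (E.reps_nodup I), ← Finset.mul_sum] at h
  intro i _ S S' hS' hne hSS' hshape hgood
  -- the star with the representatives `S` is one of the stars that the algorithm compares
  obtain ⟨t₁, ht₁, Sl, hSl, hnd, hcand⟩ : ∃ t₁ ∈ E.reps I, ∃ Sl : List ℕ, Sl.toFinset = S ∧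
      Sl.Nodup ∧ (Sl = [t₁] ∨ ∃ x ∈ 0 :: E.reps I, Sl = E.starReps I (E.reps I) (E.edge i) t₁ x)
      := by
    obtain ⟨s, hs⟩ := hne
    have hsP := List.mem_toFinset.1 ((hS' s).1 (hSS' hs)).1
    obtain ⟨t₁, ht₁, hmax⟩ := Finset.exists_max_image S'
      (fun t => costOf (E.path I (E.reps I) t (E.edge i).2.1)) ⟨s, hSS' hs⟩
    have ht₁P := List.mem_toFinset.1 ((hS' t₁).1 ht₁).1
    have hsr : ∀ x t, t ∈ E.starReps I (E.reps I) (E.edge i) t₁ x ↔ t ≠ x ∧ t ∈ S' := by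
      intro x t
      simp only [starReps, List.mem_filter, Bool.and_eq_true, decide_eq_true_eq,
        Bool.not_eq_true', decide_eq_false_iff_not]
      constructor
      · rintro ⟨htP, hx, hatt, hle⟩
        rw [E.attaches_iff htP] at hatt
        refine ⟨hx, (hS' t).2 ⟨List.mem_toFinset.2 htP, hatt.1, hatt.2, ?_⟩⟩
        exact (Nat.mul_le_mul_left _ hle).trans_lt ((hS' t₁).1 ht₁).2.2.2
      · rintro ⟨hx, htS⟩
        have h1 := (hS' t).1 htS
        have htP := List.mem_toFinset.1 h1.1
        exact ⟨htP, hx, (E.attaches_iff htP _).2 ⟨h1.2.1, h1.2.2.1⟩, hmax t htS⟩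
    have hsnd : ∀ x, (E.starReps I (E.reps I) (E.edge i) t₁ x).Nodup := fun x =>
      List.filter_sublist.nodup (E.reps_nodup I)
    have hpos : ∀ t ∈ S', t ≠ 0 := by
      rintro t ht rfl
      have h1 := (E.mem_reps.1 (List.mem_toFinset.1 ((hS' 0).1 ht).1)).1
      exact zero_notMem_numSet _ (E.mem_terminals.1 h1)
    rcases hshape with ⟨t, rfl⟩ | rfl | ⟨x, hx, rfl⟩
    · rw [Finset.mem_singleton] at hs
      subst hs
      exact ⟨s, hsP, [s], by simp, List.nodup_singleton s, .inl rfl⟩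
    · refine ⟨t₁, ht₁P, _, ?_, hsnd 0, .inr ⟨0, List.mem_cons_self, rfl⟩⟩
      ext t
      rw [List.mem_toFinset, hsr]
      exact ⟨fun h => h.2, fun h => ⟨hpos t h, h⟩⟩
    · refine ⟨t₁, ht₁P, _, ?_, hsnd x, .inr ⟨x, List.mem_cons_of_mem _
        (List.mem_toFinset.1 ((hS' x).1 hx).1), rfl⟩⟩
      ext t
      rw [List.mem_toFinset, hsr, Finset.mem_erase]
  subst hSl
  have hdec := E.length_reps_star_add_le (e := E.edge i) hnd (fun t ht => by
    have h1 := (hS' t).1 (hSS' (List.mem_toFinset.2 ht))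
    have htP := List.mem_toFinset.1 h1.1
    exact ⟨htP, (E.attaches_iff htP _).2 ⟨h1.2.1, h1.2.2.1⟩⟩) hgood
  have hcard : Sl.toFinset.card = Sl.length := List.toFinset_card_of_nodup hnd
  have hlen : 0 < Sl.length := by rw [← hcard]; exact hne.card_pos
  have hmin := E.bestStar_le hq (E.mem_scoredStars (E.mem_stars (hedge i) ht₁ hcand) (by omega))
  simp only [E.costOf_star _ hnd] at hmin
  calc q.2.1 * Sl.toFinset.card ≤ q.2.1 * ((E.reps I).length -
        (E.reps (E.star I (E.reps I) (E.edge i) Sl ++ I)).length) := by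
        rw [hcard]; gcongr; omega
    _ ≤ _ := hmin
    _ = _ := by rw [← Finset.mul_sum]; ring

end OracleInstance

/-! ### The cost of the greedy solution -/

theorem div_le_harmonic_sub {a b : ℕ} (h : b ≤ a) :
    ((a - b : ℕ) : ℚ) / a ≤ harmonic a - harmonic b := by
  induction a, h using Nat.le_induction with
  | base => simp
  | succ a hab ih =>
    rw [harmonic_succ, Nat.succ_sub hab]
    have ha : (0 : ℚ) < (a + 1 : ℕ) := by positivity
    have h1 : ((a - b : ℕ) : ℚ) / (a + 1 : ℕ) ≤ ((a - b : ℕ) : ℚ) / a := by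
      rcases Nat.eq_zero_or_pos a with rfl | ha0
      · simp
      · gcongr
        omega
    rw [Nat.succ_eq_add_one, Nat.cast_add _ 1, add_div, Nat.cast_one, one_div]
    linarith

namespace OracleInstance

variable (E : OracleInstance) {I : List Edge}

theorem length_reps_le_of_family_subset {I I' : List Edge} (h : E.family I' ⊆ E.family I) :
    (E.reps I').length ≤ (E.reps I).length := by
  have h1 := card_reps_add_card_le (E.intersectingFamily I') (E.isReps_reps I) (E.isReps_reps I')
    (Finset.empty_subset _) (fun A hA => by
      obtain ⟨t, ht, htA⟩ := (E.isReps_reps I).hit A (h hA)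
      exact ⟨t, ht, Finset.notMem_empty _, htA⟩)
  rwa [List.toFinset_card_of_nodup (E.reps_nodup _), List.toFinset_card_of_nodup (E.reps_nodup _),
    Finset.card_empty, add_zero] at h1

theorem mem_of_mem_indices {i : Fin E.G.m} (hI : ∀ e ∈ I, e ∈ E.edges) :
    (E.edge i).2.2.2 ∈ indices I ↔ E.edge i ∈ I := by
  constructor
  · intro h
    obtain ⟨e, he, hie⟩ := List.mem_map.1 h
    obtain ⟨j, rfl⟩ := E.mem_edges.1 (hI e he)
    have : j = i := Fin.ext (by simpa [edge] using hie)
    rwa [← this]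
  · exact fun h => List.mem_map.2 ⟨_, h, rfl⟩

theorem bestEdges_eq_nil_or (I : List Edge) :
    (E.scoredStars I (E.reps I) = [] ∧ E.bestEdges I = []) ∨
    ∃ q ∈ E.bestStar I (E.reps I), E.bestEdges I = q.1 ∧ q.1 ∈ E.stars I (E.reps I) ∧
      q.2.1 = costOf q.1 ∧ 1 ≤ q.2.2 ∧ (E.reps (q.1 ++ I)).length + q.2.2 = (E.reps I).length := by
  rcases minBy_eq_nil_or
    (le := fun a b : List Edge × (ℕ × ℕ) => decide (a.2.1 * b.2.2 ≤ b.2.1 * a.2.2))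
    (E.scoredStars I (E.reps I)) with ⟨h1, h2⟩ | ⟨q, hq, h⟩
  · exact .inl ⟨h1, by rw [bestEdges, bestStar, h2]; rfl⟩
  · right
    refine ⟨q, by rw [bestStar, h]; exact List.mem_singleton_self q,
      by rw [bestEdges, bestStar, h]; simp, ?_⟩
    rw [scoredStars, List.mem_filter, List.mem_map, decide_eq_true_eq] at hq
    obtain ⟨⟨Z, hZ, rfl⟩, hδ⟩ := hq
    simp only at hδ ⊢
    exact ⟨hZ, trivial, hδ, by omega⟩

theorem bestEdges_subset (I : List Edge) : ∀ e ∈ E.bestEdges I, e ∈ E.edges := by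
  rcases E.bestEdges_eq_nil_or I with ⟨_, h⟩ | ⟨q, _, h, hq, _⟩
  · simp [h]
  · rw [h]
    exact E.mem_edges_of_mem_stars hq

theorem mem_greedyStep (hI : ∀ e ∈ I, e ∈ E.edges) {e : Edge} :
    e ∈ E.greedyStep I ↔ e ∈ E.bestEdges I ++ I := by
  have hsub : ∀ e ∈ E.bestEdges I ++ I, e ∈ E.edges := fun e he =>
    (List.mem_append.1 he).elim (E.bestEdges_subset I e) (hI e)
  rw [greedyStep, List.mem_filter, decide_eq_true_eq]
  constructor
  · rintro ⟨h1, h2⟩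
    obtain ⟨i, rfl⟩ := E.mem_edges.1 h1
    exact (E.mem_of_mem_indices hsub).1 h2
  · intro h
    refine ⟨hsub e h, ?_⟩
    obtain ⟨i, rfl⟩ := E.mem_edges.1 (hsub e h)
    exact (E.mem_of_mem_indices hsub).2 h

/-- The edges of the instance that occur in a list. -/
def edgeSet (I : List Edge) : Finset (Fin E.G.m) := Finset.univ.filter (fun i => E.edge i ∈ I)

/-- The scaled cost of a set of edges. -/
def scaledCost (J : Finset (Fin E.G.m)) : ℕ := ∑ i ∈ J, (E.edge i).2.2.1

theorem scaledCost_edgeSet_le (I : List Edge) : E.scaledCost (E.edgeSet I) ≤ costOf I := by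
  have h1 : E.scaledCost (E.edgeSet I) =
      ∑ e ∈ (E.edgeSet I).image E.edge, e.2.2.1 := by
    rw [Finset.sum_image (fun i _ j _ h => E.edge_injective h)]
    rfl
  have h2 : (E.edgeSet I).image E.edge ⊆ I.toFinset := by
    intro e he
    obtain ⟨i, hi, rfl⟩ := Finset.mem_image.1 he
    exact List.mem_toFinset.2 (Finset.mem_filter.1 hi).2
  have h3 : ∀ I : List Edge, ∑ e ∈ I.toFinset, e.2.2.1 ≤ costOf I := by
    intro I
    induction I with
    | nil => simp
    | cons e I ih =>
      have e1 : costOf (e :: I) = e.2.2.1 + costOf I := by simp [costOf]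
      rw [List.toFinset_cons, e1]
      by_cases he : e ∈ I.toFinset
      · rw [Finset.insert_eq_of_mem he]
        exact ih.trans (Nat.le_add_left _ _)
      · rw [Finset.sum_insert he]
        omega
  rw [h1]
  exact (Finset.sum_le_sum_of_subset h2).trans (h3 I)

/-- After `i` rounds, at most `n - i` cores are left, and the cost is at most
`2 / k_f * (H ν - H ν')` times the cost of a cover, where `ν` and `ν'` are the initial and the current
number of cores and `H` denotes harmonic numbers. -/
theorem greedy_invariant {J : Finset (Fin E.G.m)} (hJ : E.G.CoversFun J E.f) (l : List ℕ) :
    (∀ e ∈ l.foldl (fun I _ => E.greedyStep I) [], e ∈ E.edges) ∧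
    (E.reps (l.foldl (fun I _ => E.greedyStep I) [])).length ≤ E.G.n - l.length ∧
    ((maxVal E.f).toNat : ℚ) *
        E.scaledCost (E.edgeSet (l.foldl (fun I _ => E.greedyStep I) [])) ≤
      2 * E.scaledCost J * (harmonic (E.reps []).length -
        harmonic (E.reps (l.foldl (fun I _ => E.greedyStep I) [])).length) := by
  induction l using List.reverseRecOn with
  | nil =>
    refine ⟨by simp, ?_, by simp [edgeSet, scaledCost]⟩
    have h1 := List.toFinset_card_of_nodup (E.reps_nodup [])
    have h2 : (E.reps []).toFinset ⊆ E.nodes.toFinset := by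
      intro t ht
      rw [List.mem_toFinset] at *
      exact E.mem_nodes_of_mem_numSet (E.mem_terminals.1 (E.mem_reps.1 ht).1)
    have h3 := (Finset.card_le_card h2).trans (List.toFinset_card_le _)
    rw [h1, length_nodes] at h3
    simpa using h3
  | append_singleton l a ih =>
    rw [List.foldl_append, List.foldl_cons, List.foldl_nil]
    set I := l.foldl (fun I _ => E.greedyStep I) [] with hIdef
    obtain ⟨hI, hlen, hcost⟩ := ih
    have hmem := fun e => E.mem_greedyStep hI (e := e)
    have hfam : E.family (E.greedyStep I) = E.family (E.bestEdges I ++ I) := by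
      simp only [family, hmem]
    have hreps : (E.reps (E.greedyStep I)).length = (E.reps (E.bestEdges I ++ I)).length :=
      le_antisymm (E.length_reps_le_of_family_subset hfam.subset)
        (E.length_reps_le_of_family_subset hfam.symm.subset)
    have hset : E.edgeSet (E.greedyStep I) = E.edgeSet (E.bestEdges I) ∪ E.edgeSet I := by
      ext i
      simp [edgeSet, hmem]
    have hadd : E.scaledCost (E.edgeSet (E.greedyStep I)) ≤
        costOf (E.bestEdges I) + E.scaledCost (E.edgeSet I) := by
      rw [hset]
      have h1 := E.scaledCost_edgeSet_le (E.bestEdges I)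
      have h2 : E.scaledCost (E.edgeSet (E.bestEdges I) ∪ E.edgeSet I) ≤
          E.scaledCost (E.edgeSet (E.bestEdges I)) + E.scaledCost (E.edgeSet I) := by
        rw [scaledCost, scaledCost, scaledCost, ← Finset.sum_union_inter]
        exact Nat.le_add_right _ _
      omega
    refine ⟨fun e he => (List.mem_filter.1 he).1, ?_, ?_⟩
    · rw [hreps, List.length_append, List.length_singleton]
      rcases E.bestEdges_eq_nil_or I with ⟨h1, h2⟩ | ⟨q, _, h, _, _, h1, h2⟩
      · have h3 : E.reps I = [] := by
          by_contra hne
          exact E.scoredStars_ne_nil hne h1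
        rw [h2, List.nil_append, h3]
        simp
      · rw [h]
        omega
    · have hbest : ((maxVal E.f).toNat : ℚ) * costOf (E.bestEdges I) ≤ 2 * E.scaledCost J *
          (harmonic (E.reps I).length - harmonic (E.reps (E.greedyStep I)).length) := by
        rcases E.bestEdges_eq_nil_or I with ⟨_, h2⟩ | ⟨q, hq, h, _, h0, h1, h2⟩
        · rw [hreps, h2]
          simp [costOf]
        · have hd := E.bestStar_density hJ hq
          rw [hreps, h, ← h0]
          have hν : (0 : ℚ) < (E.reps I).length := by
            rw [Nat.cast_pos]; omega
          have h3 := div_le_harmonic_sub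
            (show (E.reps (q.1 ++ I)).length ≤ (E.reps I).length by omega)
          have h4 : (E.reps I).length - (E.reps (q.1 ++ I)).length = q.2.2 := by omega
          rw [h4] at h3
          have h5 : ((maxVal E.f).toNat : ℚ) * q.2.1 * (E.reps I).length ≤
              2 * (q.2.2 * E.scaledCost J) := by exact_mod_cast hd
          calc ((maxVal E.f).toNat : ℚ) * q.2.1
              ≤ 2 * E.scaledCost J * (q.2.2 / (E.reps I).length) := by
                rw [← mul_div_assoc, le_div_iff₀ hν]; linarith
            _ ≤ _ := by gcongr
      have hadd' : (E.scaledCost (E.edgeSet (E.greedyStep I)) : ℚ) ≤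
          costOf (E.bestEdges I) + E.scaledCost (E.edgeSet I) := by exact_mod_cast hadd
      have hk : (0 : ℚ) ≤ ((maxVal E.f).toNat : ℚ) := Nat.cast_nonneg _
      nlinarith [mul_le_mul_of_nonneg_left hadd' hk]

theorem scale_pos : 0 < E.scale := by
  refine List.prod_pos fun d hd => ?_
  obtain ⟨q, hq, rfl⟩ := List.mem_map.1 hd
  obtain ⟨i, _, rfl⟩ := List.mem_map.1 hq
  exact (E.G.c i).den_pos

theorem cast_scaledCost (J : Finset (Fin E.G.m)) :
    (E.scaledCost J : ℚ≥0) = E.scale * E.G.cost J := by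
  rw [scaledCost, CoverInstance.cost, Finset.mul_sum, Nat.cast_sum]
  refine Finset.sum_congr rfl fun i _ => ?_
  have hdvd : (E.G.c i).den ∣ E.scale := by
    refine List.dvd_prod (List.mem_map.2 ⟨_, List.mem_map.2 ⟨i, List.mem_finRange i, rfl⟩, rfl⟩)
  have hden : ((E.G.c i).den : ℚ≥0) ≠ 0 := by exact_mod_cast (E.G.c i).den_ne_zero
  simp only [edge]
  rw [Nat.cast_mul, Nat.cast_div hdvd hden]
  conv_rhs => rw [← NNRat.num_div_den (E.G.c i)]
  field_simp

/-- The representatives for the empty list lie in different cores. -/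
theorem length_reps_nil_le_nu : (E.reps []).length ≤ E.G.nu E.f ∅ := by
  have hF : E.G.residualFamily (maxFamily E.f) ∅ = maxFamily E.f := by
    simp [CoverInstance.residualFamily, CoverInstance.inDeg]
  have hfam : ∀ A : Finset (Fin E.G.n), numSet A ∈ E.family [] ↔ A ∈ maxFamily E.f := by
    intro A
    rw [mem_maxFamily]
    constructor
    · rintro ⟨B, hB, hf, _⟩
      rwa [numSet_injective hB]
    · exact fun h => ⟨A, rfl, h, by simp⟩
  have hP := E.isReps_reps []
  have hcore : ∀ t ∈ (E.reps []).toFinset, ∃ D ∈ cores (maxFamily E.f),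
      ∀ s ∈ (E.reps []).toFinset, s ∈ numSet D → s = t := by
    intro t ht
    obtain ⟨C, hC, htC, hC'⟩ := hP.own t ht
    obtain ⟨C, rfl, -⟩ := id hC
    obtain ⟨D, ⟨hD, hDC⟩, hmin⟩ := WellFounded.has_min
      (measure (Finset.card (α := Fin E.G.n))).wf {A | A ∈ maxFamily E.f ∧ A ⊆ C}
      ⟨C, (hfam C).1 hC, subset_rfl⟩
    exact ⟨D, mem_cores.2 ⟨hD, fun A hA hAD => Finset.eq_of_subset_of_card_le hAD
      (not_lt.1 (hmin A ⟨hA, hAD.trans hDC⟩))⟩, fun s hs hsD => hC' s hs (numSet_subset.2 hDC hsD)⟩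
  choose! D hD hDu using hcore
  rw [CoverInstance.nu, hF, ← List.toFinset_card_of_nodup (E.reps_nodup [])]
  refine Finset.card_le_card_of_injOn D (fun t ht => hD t ht) fun t ht s hs hts => ?_
  obtain ⟨r, hr, hrD⟩ := hP.hit _ ((hfam (D t)).2 (mem_cores.1 (hD t ht)).1)
  rw [← hDu t ht r hr hrD]
  rw [hts] at hrD
  exact hDu s hs r hr hrD

theorem solution_subset : ∀ e ∈ E.solution, e ∈ E.edges := by
  obtain ⟨J, hJ⟩ := E.coverable
  exact (E.greedy_invariant hJ E.nodes).1

theorem reps_solution : E.reps E.solution = [] := by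
  obtain ⟨J, hJ⟩ := E.coverable
  have h := (E.greedy_invariant hJ E.nodes).2.1
  rw [length_nodes, Nat.sub_self] at h
  exact List.eq_nil_of_length_eq_zero (Nat.le_zero.1 h)

theorem enc_output : Enc.enc E.output = encodeSet (E.edgeSet E.solution) := by
  rw [encodeSet_eq, output, bits, edges_eq, List.map_map]
  congr 1
  refine List.map_congr_left fun i _ => ?_
  simp only [Function.comp_apply, E.mem_of_mem_indices E.solution_subset, edgeSet,
    Finset.mem_filter, Finset.mem_univ, true_and]

theorem coversFamily_solution : E.G.CoversFamily (E.edgeSet E.solution) (maxFamily E.f) := by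
  intro A hA
  by_contra hcon
  have h0 : E.G.inDeg (E.edgeSet E.solution) A = 0 := by omega
  rw [CoverInstance.inDeg, Finset.card_eq_zero, Finset.filter_eq_empty_iff] at h0
  have hfam : numSet A ∈ E.family E.solution := by
    refine ⟨A, rfl, mem_maxFamily.1 hA, fun e he hv => ?_⟩
    obtain ⟨i, rfl⟩ := E.mem_edges.1 (E.solution_subset e he)
    by_contra hu
    refine h0 (x := i) (by simp [edgeSet, he]) ?_
    rw [← E.toArc_edge i, toArc_enters]
    exact ⟨hv, hu⟩
  obtain ⟨t, ht, _⟩ := (E.isReps_reps E.solution).hit _ hfam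
  rw [reps_solution] at ht
  simp at ht

theorem cost_solution_le {J : Finset (Fin E.G.m)} (hJ : E.G.CoversFun J E.f) :
    ((E.G.cost (E.edgeSet E.solution) : ℚ≥0) : ℝ) ≤
      2 / (maxVal E.f : ℝ) * (1 + Real.log (E.G.nu E.f ∅ : ℝ)) * ((E.G.cost J : ℚ≥0) : ℝ) := by
  have h := (E.greedy_invariant hJ E.nodes).2.2
  change ((maxVal E.f).toNat : ℚ) * E.scaledCost (E.edgeSet E.solution) ≤
    2 * E.scaledCost J * (harmonic (E.reps []).length - harmonic (E.reps E.solution).length) at h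
  rw [reps_solution, List.length_nil, harmonic_zero, sub_zero] at h
  have hR : ((maxVal E.f).toNat : ℝ) * E.scaledCost (E.edgeSet E.solution) ≤
      2 * E.scaledCost J * (harmonic (E.reps []).length : ℚ) := by exact_mod_cast h
  have hcast : ∀ J, (E.scaledCost J : ℝ) = E.scale * ((E.G.cost J : ℚ≥0) : ℝ) := by
    intro J
    have := congrArg (fun x : ℚ≥0 => (x : ℝ)) (E.cast_scaledCost J)
    push_cast at this
    exact this
  have hk : ((maxVal E.f).toNat : ℝ) = (maxVal E.f : ℝ) := by
    have := E.one_le_maxVal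
    have h1 : ((maxVal E.f).toNat : ℤ) = maxVal E.f := Int.toNat_of_nonneg (by omega)
    exact_mod_cast congrArg (fun z : ℤ => (z : ℝ)) h1
  have hkpos : (0 : ℝ) < (maxVal E.f : ℝ) := by
    have := E.one_le_maxVal
    exact_mod_cast (by omega : 0 < maxVal E.f)
  have hs : (0 : ℝ) < E.scale := by exact_mod_cast E.scale_pos
  have hν : ((harmonic (E.reps []).length : ℚ) : ℝ) ≤ 1 + Real.log (E.G.nu E.f ∅ : ℝ) := by
    have h1 := harmonic_le_one_add_log (E.reps []).length
    have h2 := E.length_reps_nil_le_nu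
    rcases Nat.eq_zero_or_pos (E.reps []).length with h0 | h0
    · rw [h0] at h1 ⊢
      rw [harmonic_zero]
      have := Real.log_natCast_nonneg (E.G.nu E.f ∅)
      push_cast
      linarith
    · have h3 : Real.log ((E.reps []).length : ℝ) ≤ Real.log (E.G.nu E.f ∅ : ℝ) :=
        Real.log_le_log (by exact_mod_cast h0) (by exact_mod_cast h2)
      linarith
  rw [hk, hcast, hcast] at hR
  have hJ0 : (0 : ℝ) ≤ ((E.G.cost J : ℚ≥0) : ℝ) := by positivity
  have hmain : (maxVal E.f : ℝ) * ((E.G.cost (E.edgeSet E.solution) : ℚ≥0) : ℝ) ≤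
      2 * (1 + Real.log (E.G.nu E.f ∅ : ℝ)) * ((E.G.cost J : ℚ≥0) : ℝ) := by
    refine le_of_mul_le_mul_left ?_ hs
    calc (E.scale : ℝ) * ((maxVal E.f : ℝ) * ((E.G.cost (E.edgeSet E.solution) : ℚ≥0) : ℝ))
        ≤ 2 * (E.scale * ((E.G.cost J : ℚ≥0) : ℝ)) * (harmonic (E.reps []).length : ℚ) := by
          linarith
      _ ≤ 2 * (E.scale * ((E.G.cost J : ℚ≥0) : ℝ)) * (1 + Real.log (E.G.nu E.f ∅ : ℝ)) := by
          gcongr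
      _ = _ := by ring
  rw [div_mul_eq_mul_div, div_mul_eq_mul_div, le_div_iff₀ hkpos]
  linarith

end OracleInstance

theorem mainTheorem4 :
    ∃ (P : Program) (p : Polynomial ℕ),
      ∀ (G : CoverInstance) (f : Finset (Fin G.n) → ℤ) (O : Data → Data) (τ : ℚ≥0),
        PositivelyTIntersectingSupermodular G.T f →
        (∀ A, 0 < f A → (A ∩ G.T).Nonempty) →
        G.QuasiBipartite f →
        1 ≤ maxVal f →
        G.IsOptValue f τ →
        IsCoreOracle f O →
        ∃ (I : Finset (Fin G.m)) (t : ℕ),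
          P.Runs O G.encode (encodeSet I) t ∧
          t ≤ p.eval G.encode.size ∧
          G.CoversFamily I (maxFamily f) ∧
          ((G.cost I : ℚ≥0) : ℝ) ≤
            2 / (maxVal f : ℝ) * (1 + Real.log (G.nu f ∅ : ℝ)) * (τ : ℝ) := by
  obtain ⟨P, p, hP⟩ := PolyTime.output
  refine ⟨P, p, fun G f O τ hsup hT hq hk hτ hO => ?_⟩
  obtain ⟨⟨J, hJ, rfl⟩, -⟩ := hτ
  set E : OracleInstance := ⟨G, f, O, hsup, hT, hq, hk, ⟨J, hJ⟩, hO⟩ with hE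
  obtain ⟨t, ht, hrun⟩ := hP E
  rw [E.enc_output] at hrun
  exact ⟨E.edgeSet E.solution, t, hrun, ht, E.coversFamily_solution, E.cost_solution_le hJ⟩
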